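/- Setting. A seller sells one object to two bidders. Each bidder has a privately known type (her valuation) in $\Theta=[0,1]$. The reference belief $P$ is a probability measure on $\Theta^2$ with a positive density, and it is IID: $P=F\times F$, where $F$ denotes the marginal. For a probability measure $\mu$ on $\Omega$ let $\Delta(\Omega,\mu)$ be the set of probability measures $\nu\ll\mu$. A belief $\nu'\in\Delta(\Omega,\mu)$ is a rearrangement of $\nu\in\Delta(\Omega,\mu)$ if $\mu\{d\nu'/d\mu\le c\}=\mu\{d\nu/d\mu\le c\}$ for all $c\ge 0$. A set $\mathcal Q\subset\mathcal S\subset\Delta(\Omega,\mu)$ is rearrangement invariant relative to $\mathcal S$ if every rearrangement in $\mathcal S$ of an element of $\mathcal Q$ belongs to $\mathcal Q$. The seller has a weakly compact set of priors $\mathcal Q\ni P$ which is, with respect to $P$, rearrangement invariant relative to $\mathcal S$, where $\mathcal S$ is one of: $\Delta(\Theta^2,P)$, the set of independent beliefs $Q=Q_1\times Q_2$ in $\Delta(\Theta^2,P)$, or the set of IID beliefs $Q=Q_1\times Q_1$ in $\Delta(\Theta^2,P)$. If $t_i(\theta,\theta')\ge 0$ is the payment of bidder $i$ when her type is $\theta$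 and her competitor's type is $\theta'$, the worst-case revenue is $$\mathcal R(t)=\min_{Q\in\mathcal Q}\iint_{\Theta^2}[t_1(\theta,\theta')+t_2(\theta',\theta)]\,Q(d\theta,d\theta').$$ Both bidders have the same nonempty weakly compact set of priors $\mathcal Q^B\subset\Delta(\Theta,F)$ about the competitor's type, rearrangement invariant relative to $\Delta(\Theta,F)$ with respect to $F$. In an auction in which a bid $b\ge0$ against $b'\ge0$ wins with probability $x(b,b')$ and pays $\tau(b,b')$, an equilibrium is a strategy $b^*:\Theta\to\mathbb R_+$, non-decreasing on $[0,1)$, such that for every $\theta\in[0,1)$ $$b^*(\theta)\in\arg\max_{b\ge 0}\ \min_{G\in\mathcal Q^B}\int_\Theta[\theta\,x(b,b^*(\theta'))-\tau(b,b^*(\theta'))]\,dG(\theta'),$$ and the resulting transfers are $t_i(\theta,\theta')=\tau(b^*(\theta),b^*(\theta'))$. (The top type $\theta=1$, null under all priors, is left out because bids in the war of attrition may tend to infinity as $\theta\to1$.) In all four auctions the higher bid wins and ties are broken evenly, $x(b,b')=\mathbf 1[b>b']+\tfrac12\mathbf 1[b=b']$. The payments are $\tau=b\,x(b,b')$ (first-price,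 I), $\tau=b'\,x(b,b')$ (second-price, II), $\tau=b$ (all-pay, A), $\tau=b'\mathbf 1[b>b']+b\,\mathbf 1[b\le b']$ (war of attrition, W). Claim. The first-price, second-price and all-pay auctions have equilibria; in the first-price auction there is one in which every type $\theta<1$ whose worst-case winning probability $\min_{G\in\mathcal Q^B}\int x(b^*(\theta),b^*(\theta'))\,dG(\theta')$ is $0$ bids her valuation (such a type is indifferent among all bids that do not exceed her valuation and have worst-case winning probability $0$). Moreover: (i) $\mathcal R(t^I)\ge\mathcal R(t^{II})$ for every equilibrium of the first-price auction with the last-mentioned property and every equilibrium of the second-price auction. (ii) $\mathcal R(t^I)\ge\mathcal R(t^A)$ for all equilibria of the first-price and all-pay auctions. (iii) $\mathcal R(t^A)\ge\mathcal R(t^W)$ for every equilibrium of the all-pay auction and every equilibrium of the war of attrition, if the latter has any. -/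

import Mathlib

open MeasureTheory
open scoped NNReal ENNReal

noncomputable section

namespace AmbiguousAuction

/-- The type space `[0, 1]`, with its Borel sets and Lebesgue measure. -/
abbrev Θ : Type := unitInterval

/-! ### Beliefs and rearrangements -/

section Rearrangement

/-- `Δ(Ω, μ)`: the probability measures that are absolutely continuous with respect to `μ`. -/
def acBeliefs {Ω : Type*} [MeasurableSpace Ω] (μ : ProbabilityMeasure Ω) :
    Set (ProbabilityMeasure Ω) :=
  {ν | (ν : Measure Ω) ≪ (μ : Measure Ω)}

/-- `ν'` is a rearrangement of `ν` with respect to `μ`: the densities `dν'/dμ` and `dν/dμ` have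
the same distribution under `μ`. -/
def IsRearrangement {Ω : Type*} [MeasurableSpace Ω] (μ ν' ν : ProbabilityMeasure Ω) : Prop :=
  ∀ c : ℝ≥0,
    (μ : Measure Ω) {ω | (ν' : Measure Ω).rnDeriv (μ : Measure Ω) ω ≤ (c : ℝ≥0∞)} =
      (μ : Measure Ω) {ω | (ν : Measure Ω).rnDeriv (μ : Measure Ω) ω ≤ (c : ℝ≥0∞)}

/-- `𝒬` is a subset of `𝒮` that is rearrangement invariant relative to `𝒮`
(with respect to `μ`). -/
def IsRearrangementInvariant {Ω : Type*} [MeasurableSpace Ω] (μ : ProbabilityMeasure Ω)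
    (𝒮 𝒬 : Set (ProbabilityMeasure Ω)) : Prop :=
  𝒬 ⊆ 𝒮 ∧ ∀ ν ∈ 𝒬, ∀ ν' ∈ 𝒮, IsRearrangement μ ν' ν → ν' ∈ 𝒬

end Rearrangement

/-- The belief makes the two types independent. -/
def IsIndependent (Q : ProbabilityMeasure (Θ × Θ)) : Prop :=
  ∃ Q₁ Q₂ : ProbabilityMeasure Θ, Q = Q₁.prod Q₂

/-- The belief makes the two types independent and identically distributed. -/
def IsIID (Q : ProbabilityMeasure (Θ × Θ)) : Prop :=
  ∃ Q₁ : ProbabilityMeasure Θ, Q = Q₁.prod Q₁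

/-- The domain of independent beliefs that are absolutely continuous with respect to `P`. -/
def indepBeliefs (P : ProbabilityMeasure (Θ × Θ)) : Set (ProbabilityMeasure (Θ × Θ)) :=
  {Q | Q ∈ acBeliefs P ∧ IsIndependent Q}

/-- The domain of IID beliefs that are absolutely continuous with respect to `P`. -/
def iidBeliefs (P : ProbabilityMeasure (Θ × Θ)) : Set (ProbabilityMeasure (Θ × Θ)) :=
  {Q | Q ∈ acBeliefs P ∧ IsIID Q}

/-- `P` has a positive density with respect to Lebesgue measure on `[0, 1]²`. -/
def HasPositiveDensity (P : ProbabilityMeasure (Θ × Θ)) : Prop :=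
  ∃ p : Θ × Θ → ℝ≥0, Measurable p ∧ (∀ z, 0 < p z) ∧
    (P : Measure (Θ × Θ)) = (volume : Measure (Θ × Θ)).withDensity (fun z => (p z : ℝ≥0∞))

/-- The first marginal of a joint belief. -/
def marginal (P : ProbabilityMeasure (Θ × Θ)) : ProbabilityMeasure Θ :=
  P.map measurable_fst.aemeasurable

/-! ### Revenue -/

/-- The worst-case revenue of a transfer function `t = (t₁, t₂)`, where `t i θ θ'` is the payment
of bidder `i` when her own type is `θ` and her competitor's type is `θ'`. -/
def worstCaseRevenue (𝒬 : Set (ProbabilityMeasure (Θ × Θ))) (t : Fin 2 → Θ → Θ → ℝ≥0) : ℝ≥0∞ :=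
  ⨅ Q ∈ 𝒬, ∫⁻ z, ((t 0 z.1 z.2 + t 1 z.2 z.1 : ℝ≥0) : ℝ≥0∞) ∂(Q : Measure (Θ × Θ))

/-! ### Symmetric sealed-bid auctions with two bidders -/

/-- A symmetric sealed-bid auction: a bidder who bids `b` against `b'` wins with probability
`x b b'` and pays `τ b b'`. -/
structure Auction where
  x : ℝ≥0 → ℝ≥0 → ℝ≥0
  τ : ℝ≥0 → ℝ≥0 → ℝ≥0

/-- The higher bid wins; ties are broken with equal probability. -/
def highestBidWins (b b' : ℝ≥0) : ℝ≥0 :=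
  if b' < b then 1 else if b = b' then 1 / 2 else 0

/-- First-price auction: the winner pays her own bid. -/
def firstPrice : Auction where
  x := highestBidWins
  τ b b' := b * highestBidWins b b'

/-- Second-price auction: the winner pays the competitor's bid. -/
def secondPrice : Auction where
  x := highestBidWins
  τ b b' := b' * highestBidWins b b'

/-- All-pay auction: each bidder pays her own bid. -/
def allPay : Auction where
  x := highestBidWins
  τ b _ := b

/-- War of attrition: the higher bidder pays the competitor's bid, otherwise a bidder pays her
own bid. -/
def warOfAttrition : Auction where
  x := highestBidWins
  τ b b' := if b' < b then b' else b

/-- The transfer function induced by a common bidding strategy `s`. -/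
def Auction.transfer (A : Auction) (s : Θ → ℝ≥0) : Fin 2 → Θ → Θ → ℝ≥0 :=
  fun _ θ θ' => A.τ (s θ) (s θ')

/-- The maxmin expected payoff of a bidder of type `θ` with set of priors `𝒬B` who bids `b`
against a competitor who follows the strategy `s`. -/
def Auction.payoff (A : Auction) (𝒬B : Set (ProbabilityMeasure Θ)) (s : Θ → ℝ≥0) (θ : Θ)
    (b : ℝ≥0) : ℝ :=
  ⨅ G : 𝒬B, ∫ θ', ((θ : ℝ) * (A.x b (s θ') : ℝ) - (A.τ b (s θ') : ℝ))
    ∂((G : ProbabilityMeasure Θ) : Measure Θ)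

/-- The worst-case probability with which a bidder of type `θ` wins when both bidders follow the
strategy `s`. -/
def Auction.winProb (A : Auction) (𝒬B : Set (ProbabilityMeasure Θ)) (s : Θ → ℝ≥0) (θ : Θ) : ℝ :=
  ⨅ G : 𝒬B, ∫ θ', (A.x (s θ) (s θ') : ℝ) ∂((G : ProbabilityMeasure Θ) : Measure Θ)

/-- `s` is a (non-decreasing) symmetric equilibrium. The top type `θ = 1`, which is null under
every prior, is left out: in the war of attrition bids may tend to infinity as `θ` tends to `1`,
so that no finite bid of this type is optimal and monotonicity cannot extend to it. -/
def Auction.IsEquilibrium (A : Auction) (𝒬B : Set (ProbabilityMeasure Θ)) (s : Θ → ℝ≥0) : Prop :=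
  MonotoneOn s (Set.Iio 1) ∧
    ∀ θ : Θ, θ < 1 → ∀ b : ℝ≥0, A.payoff 𝒬B s θ b ≤ A.payoff 𝒬B s θ (s θ)

/-- In the auction `A` with strategy `s`, a type whose worst-case probability of winning is zero
bids her valuation. -/
def Auction.BidsValueIfHopeless (A : Auction) (𝒬B : Set (ProbabilityMeasure Θ))
    (s : Θ → ℝ≥0) : Prop :=
  ∀ θ : Θ, θ < 1 → A.winProb 𝒬B s θ = 0 → (s θ : ℝ) = (θ : ℝ)

end AmbiguousAuction

end

namespace AmbiguousAuction

open Set Filter Topology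

/-! ### Rearranging densities along an atomless random variable -/

section Rearranging

variable {Ω : Type*} [MeasurableSpace Ω]

/-! Let w(t) be the smallest probability, over the bidders' priors, that the competitor's type is
below t, and let R(θ) be the integral of w from 0 to θ. Both sides of the market are handled by
rearranging densities, but in opposite directions.

Bidders fear strong competitors. Rearranging a prior so that its density with respect to F becomes
non-decreasing keeps it in the set and lowers the expectation of every decreasing function
(Hardy-Littlewood). Hence w/F is non-decreasing (`IsBidderModel.worstCDF_mul_le`). In the
first-price and all-pay auctions and in the war of attrition, a tie of positive probability is
broken by a slight overbid unless some prior makes winning almost impossible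
(`IsBidderModel.exists_measure_le_lt`). So type θ wins with worst-case probability w(θ), and
imitation arguments compare equilibrium payoffs with the rent R(θ): in the all-pay auction the bid
equals θ w(θ) - R(θ); in the first-price auction (θ - s(θ)) w(θ) ≤ R(θ), which together with the
monotonicity of w/F says that s(θ) is at least the F-mean of the types below θ, hopeless types
bidding their valuation; in the war of attrition the payment increases in the competitor's type, so
a prior with increasing density that makes winning unlikely also makes the expected payment large.
The expected payment under F is therefore at most θ w(θ) - R(θ). In the second-price auction bids do
not exceed valuations (`secondPrice_bid_le`).

The seller fears low types. In each comparison the revenue of the format claimed to be better is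
non-decreasing in both types, so it suffices to compare the formats under beliefs whose density is
non-increasing in both types (`iInf_lintegral_le`). Fix one bidder's type θ, and let f be the
density along the competitor's type. Chebyshev's inequality decides every case: f is negatively
correlated with the second-price payment θ' among the types below θ and with the payment in the war
of attrition, and positively correlated with the event θ' < θ in which the first-price bid is paid.

Existence in the first-price and all-pay auctions comes from the convexity of R: deviations give
points on tangents of R. In the second-price auction truthful bidding is optimal state by state. -/

/-- A continuous distribution function takes every value strictly between `0` and `1`. -/
theorem exists_measure_le_eq {μ : Measure Ω} [IsProbabilityMeasure μ] {Z : Ω → ℝ}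
    (hZ : Measurable Z) (hatom : ∀ z, μ {ω | Z ω = z} = 0) {a : ℝ≥0∞} (h0 : 0 < a) (h1 : a < 1) :
    ∃ z, μ {ω | Z ω ≤ z} = a := by
  have : IsProbabilityMeasure (μ.map Z) := Measure.isProbabilityMeasure_map hZ.aemeasurable
  have hne : a ≠ ∞ := (h1.trans ENNReal.one_lt_top).ne
  have hc : Continuous (ProbabilityTheory.cdf (μ.map Z)) := by
    rw [continuous_iff_continuousAt]
    intro z
    rw [(ProbabilityTheory.monotone_cdf _).continuousAt_iff_leftLim_eq_rightLim,
      StieltjesFunction.rightLim_eq]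
    have h := (ProbabilityTheory.cdf (μ.map Z)).measure_singleton z
    rw [ProbabilityTheory.measure_cdf, Measure.map_apply hZ (measurableSet_singleton z)] at h
    have h' : μ (Z ⁻¹' {z}) = 0 := hatom z
    rw [h', eq_comm, ENNReal.ofReal_eq_zero] at h
    exact le_antisymm ((ProbabilityTheory.monotone_cdf _).leftLim_le le_rfl) (by linarith)
  have ha0 : 0 < a.toReal := ENNReal.toReal_pos h0.ne' hne
  have ha1 : a.toReal < 1 := by
    rw [← ENNReal.toReal_one]; exact (ENNReal.toReal_lt_toReal hne ENNReal.one_ne_top).2 h1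
  obtain ⟨z, hz⟩ := mem_range_of_exists_le_of_exists_ge hc
    (((ProbabilityTheory.tendsto_cdf_atBot (μ.map Z)).eventually (gt_mem_nhds ha0)).exists.imp
      fun _ h => h.le)
    (((ProbabilityTheory.tendsto_cdf_atTop (μ.map Z)).eventually (lt_mem_nhds ha1)).exists.imp
      fun _ h => h.le)
  refine ⟨z, ?_⟩
  have h := ProbabilityTheory.ofReal_cdf (μ.map Z) z
  rw [hz, ENNReal.ofReal_toReal hne, Measure.map_apply hZ measurableSet_Iic] at h
  exact h.symm

/-- The distribution function of an atomless random variable, evaluated at this random variable,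
is uniformly distributed. -/
theorem measure_measure_le_lt {μ : Measure Ω} [IsProbabilityMeasure μ] {Z : Ω → ℝ}
    (hZ : Measurable Z) (hatom : ∀ z, μ {ω | Z ω = z} = 0) {a : ℝ≥0∞} (ha : a ≤ 1) :
    μ {ω | μ {ω' | Z ω' ≤ Z ω} < a} = a := by
  refine le_antisymm ?_ (le_of_forall_lt fun c hc => ?_)
  · rcases ha.eq_or_lt with rfl | h1
    · exact prob_le_one
    rcases eq_or_ne a 0 with rfl | h0
    · simp
    obtain ⟨z, hz⟩ := exists_measure_le_eq hZ hatom h0.bot_lt h1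
    refine (measure_mono fun ω hω => ?_).trans hz.le
    by_contra hlt
    rw [mem_ofPred_eq, not_le] at hlt
    refine absurd hω (not_lt.2 (hz.symm.le.trans (measure_mono fun ω' hω' => ?_)))
    exact le_trans hω' hlt.le
  · obtain ⟨u, hcu, hua⟩ := exists_between hc
    obtain ⟨z, hz⟩ := exists_measure_le_eq hZ hatom (zero_le.trans_lt hcu) (hua.trans_le ha)
    refine hcu.trans_le (hz.symm.le.trans (measure_mono fun ω hω => ?_))
    have hle : μ {ω' | Z ω' ≤ Z ω} ≤ μ {ω' | Z ω' ≤ z} :=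
      measure_mono fun ω' hω' => le_trans (show Z ω' ≤ Z ω from hω') hω
    exact hle.trans_lt (hz.trans_lt hua)

/-- The decreasing function of `Z` that has the same distribution as `f`. -/
noncomputable def antitoneProfile (μ : Measure Ω) (f : Ω → ℝ≥0∞) (Z : Ω → ℝ) (z : ℝ) : ℝ≥0∞ :=
  sSup {c | μ {ω | Z ω ≤ z} < μ {ω | c < f ω}}

theorem antitone_antitoneProfile (μ : Measure Ω) (f : Ω → ℝ≥0∞) (Z : Ω → ℝ) :
    Antitone (antitoneProfile μ f Z) := fun _ _ h =>
  sSup_le_sSup fun _ hc => (measure_mono fun _ hω => le_trans hω h).trans_lt hc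

/-- The tail `c ↦ μ {c < f}` is right-continuous: a strict inequality at c persists at some larger
c', which witnesses that the supremum exceeds c. At c = ∞ both sides are false. -/
theorem lt_antitoneProfile_iff {μ : Measure Ω} {f : Ω → ℝ≥0∞} {Z : Ω → ℝ} {z : ℝ} {c : ℝ≥0∞} :
    c < antitoneProfile μ f Z z ↔ μ {ω | Z ω ≤ z} < μ {ω | c < f ω} := by
  rw [antitoneProfile, lt_sSup_iff]
  constructor
  · rintro ⟨c', hc', hcc'⟩
    exact lt_of_lt_of_le hc' (measure_mono fun _ hω => hcc'.trans hω)
  · intro h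
    rcases eq_or_ne c ∞ with rfl | hc
    · simp at h
    obtain ⟨u, hu, hu', hlim⟩ := exists_seq_strictAnti_tendsto' hc.lt_top
    have hU : {ω | c < f ω} = ⋃ n, {ω | u n < f ω} := by
      ext ω
      simp only [mem_ofPred_eq, mem_iUnion]
      exact ⟨fun hω => (hlim.eventually (gt_mem_nhds hω)).exists,
        fun ⟨n, hn⟩ => (hu' n).1.trans hn⟩
    have hmono : Monotone fun n => {ω | u n < f ω} := fun m n hmn ω hω =>
      (hu.antitone hmn).trans_lt hω
    rw [hU, hmono.measure_iUnion, lt_iSup_iff] at h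
    obtain ⟨n, hn⟩ := h
    exact ⟨u n, hn, (hu' n).1⟩

/-- The distribution function of Z evaluated at Z is uniform, so the event that the profile exceeds
c, namely that this uniform variable is below `μ {c < f}`, has exactly that probability. -/
theorem map_antitoneProfile {μ : Measure Ω} [IsProbabilityMeasure μ] {f : Ω → ℝ≥0∞}
    (hf : Measurable f) {Z : Ω → ℝ} (hZ : Measurable Z) (hatom : ∀ z, μ {ω | Z ω = z} = 0) :
    μ.map (fun ω => antitoneProfile μ f Z (Z ω)) = μ.map f := by
  have hD : Measurable fun ω => antitoneProfile μ f Z (Z ω) :=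
    (antitone_antitoneProfile μ f Z).measurable.comp hZ
  have : IsProbabilityMeasure (μ.map f) := Measure.isProbabilityMeasure_map hf.aemeasurable
  have : IsProbabilityMeasure (μ.map fun ω => antitoneProfile μ f Z (Z ω)) :=
    Measure.isProbabilityMeasure_map hD.aemeasurable
  refine Measure.ext_of_Iic _ _ fun c => ?_
  rw [← compl_Ioi, prob_compl_eq_one_sub measurableSet_Ioi,
    prob_compl_eq_one_sub measurableSet_Ioi, Measure.map_apply hD measurableSet_Ioi,
    Measure.map_apply hf measurableSet_Ioi]
  congr 1
  have h : (fun ω => antitoneProfile μ f Z (Z ω)) ⁻¹' Ioi c =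
      {ω | μ {ω' | Z ω' ≤ Z ω} < μ {ω | c < f ω}} := by
    ext ω
    exact lt_antitoneProfile_iff
  rw [h, measure_measure_le_lt hZ hatom prob_le_one]
  rfl

/-- Beliefs whose densities have the same distribution are rearrangements of one another. -/
theorem isRearrangement_of_map_eq {μ ν ν' : ProbabilityMeasure Ω} {f f' : Ω → ℝ≥0∞}
    (hf : Measurable f) (hf' : Measurable f')
    (hν : (ν : Measure Ω) = (μ : Measure Ω).withDensity f)
    (hν' : (ν' : Measure Ω) = (μ : Measure Ω).withDensity f')
    (h : (μ : Measure Ω).map f' = (μ : Measure Ω).map f) : IsRearrangement μ ν' ν := by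
  intro c
  have key : ∀ {g : Ω → ℝ≥0∞} {η : ProbabilityMeasure Ω}, Measurable g →
      (η : Measure Ω) = (μ : Measure Ω).withDensity g →
      (μ : Measure Ω) {ω | (η : Measure Ω).rnDeriv (μ : Measure Ω) ω ≤ (c : ℝ≥0∞)} =
        (μ : Measure Ω).map g (Iic (c : ℝ≥0∞)) := by
    intro g η hg hη
    rw [Measure.map_apply hg measurableSet_Iic, hη]
    refine measure_congr ?_
    filter_upwards [Measure.rnDeriv_withDensity (μ : Measure Ω) hg] with ω hω
    exact congrArg (· ≤ (c : ℝ≥0∞)) hω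
  rw [key hf' hν', key hf hν, h]

theorem eq_withDensity_of_mem_acBeliefs {μ ν : ProbabilityMeasure Ω} (hν : ν ∈ acBeliefs μ) :
    (ν : Measure Ω) = (μ : Measure Ω).withDensity ((ν : Measure Ω).rnDeriv (μ : Measure Ω)) :=
  (Measure.withDensity_rnDeriv_eq _ _ hν).symm

/-- Every belief has a rearrangement whose density is a decreasing function of a given atomless
random variable. -/
theorem exists_antitone_rearrangement {μ ν : ProbabilityMeasure Ω} (hν : ν ∈ acBeliefs μ)
    {Z : Ω → ℝ} (hZ : Measurable Z) (hatom : ∀ z, (μ : Measure Ω) {ω | Z ω = z} = 0) :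
    ∃ ν' : ProbabilityMeasure Ω, ∃ D : ℝ → ℝ≥0∞, Antitone D ∧
      (ν' : Measure Ω) = (μ : Measure Ω).withDensity (fun ω => D (Z ω)) ∧
      (μ : Measure Ω).map (fun ω => D (Z ω)) =
        (μ : Measure Ω).map ((ν : Measure Ω).rnDeriv (μ : Measure Ω)) := by
  set f := (ν : Measure Ω).rnDeriv (μ : Measure Ω)
  have hf : Measurable f := Measure.measurable_rnDeriv _ _
  have hD := antitone_antitoneProfile (μ : Measure Ω) f Z
  have hmap := map_antitoneProfile hf hZ hatom
  have hDm : Measurable fun ω => antitoneProfile (μ : Measure Ω) f Z (Z ω) :=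
    hD.measurable.comp hZ
  refine ⟨⟨(μ : Measure Ω).withDensity fun ω => antitoneProfile (μ : Measure Ω) f Z (Z ω), ⟨?_⟩⟩,
    _, hD, rfl, hmap⟩
  have h1 : ∫⁻ ω, f ω ∂(μ : Measure Ω) = 1 := by
    rw [Measure.lintegral_rnDeriv hν, measure_univ]
  rw [withDensity_apply _ MeasurableSet.univ, Measure.restrict_univ, ← h1,
    ← lintegral_map (f := fun x => x) measurable_id hDm, hmap,
    lintegral_map (f := fun x => x) measurable_id hf]

/-- Among the beliefs whose densities have a given distribution, one whose density is largest on a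
set gives this set the greatest probability. -/
theorem measure_le_of_map_eq {μ : Measure Ω} {f f' : Ω → ℝ≥0∞}
    (hf : Measurable f) (hf' : Measurable f') (h : μ.map f' = μ.map f) {B S : Set Ω}
    (hB : MeasurableSet B) (hS : μ Sᶜ = 0)
    (hBS : ∀ ω ∈ S, ω ∈ B → ∀ ω' ∈ S, ω' ∉ B → f' ω' ≤ f' ω) :
    μ.withDensity f B ≤ μ.withDensity f' B := by
  -- The threshold c separates the values of f' outside B from those inside. Truncating at c gives f
  -- ≤ (f - c) + c, with equality for f' on B. The excess of f' over c lives on B, and its total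
  -- mass depends only on the distribution of the density.
  set c : ℝ≥0∞ := ⨆ ω' ∈ S \ B, f' ω'
  have hS' : ∀ᵐ ω ∂μ, ω ∈ S := hS
  have hB' : ∀ᵐ ω ∂μ, ω ∈ B → c ≤ f' ω := by
    filter_upwards [hS'] with ω hω hωB
    exact iSup₂_le fun ω' hω' => hBS ω hω hωB ω' hω'.1 hω'.2
  have hBc : ∀ᵐ ω ∂μ, ω ∉ B → f' ω ≤ c := by
    filter_upwards [hS'] with ω hω hωB
    exact le_iSup₂_of_le ω ⟨hω, hωB⟩ le_rfl
  have hint : ∫⁻ ω, (f' ω - c) ∂μ = ∫⁻ ω, (f ω - c) ∂μ := by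
    rw [← lintegral_map (f := fun x => x - c) (measurable_id.sub_const c) hf', h,
      lintegral_map (f := fun x => x - c) (measurable_id.sub_const c) hf]
  have hsub : ∀ g : Ω → ℝ≥0∞, Measurable g →
      ∫⁻ ω in B, (g ω - c) + c ∂μ = ∫⁻ ω in B, (g ω - c) ∂μ + c * μ B := fun g hg => by
    rw [lintegral_add_right _ measurable_const, setLIntegral_const]
  calc μ.withDensity f B = ∫⁻ ω in B, f ω ∂μ := withDensity_apply _ hB
    _ ≤ ∫⁻ ω in B, (f ω - c) + c ∂μ := lintegral_mono fun ω => le_tsub_add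
    _ = ∫⁻ ω in B, (f ω - c) ∂μ + c * μ B := hsub f hf
    _ ≤ ∫⁻ ω, (f ω - c) ∂μ + c * μ B := by exact add_le_add_left (setLIntegral_le_lintegral _ _) _
    _ = ∫⁻ ω, (f' ω - c) ∂μ + c * μ B := by rw [hint]
    _ = ∫⁻ ω in B, (f' ω - c) ∂μ + c * μ B := by
        congr 1
        rw [← lintegral_indicator hB]
        refine lintegral_congr_ae ?_
        filter_upwards [hBc] with ω hω
        by_cases hωB : ω ∈ B
        · simp [hωB]
        · simp [hωB, tsub_eq_zero_of_le (hω hωB)]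
    _ = ∫⁻ ω in B, (f' ω - c) + c ∂μ := (hsub f' hf').symm
    _ = ∫⁻ ω in B, f' ω ∂μ := by
        refine setLIntegral_congr_fun_ae hB ?_
        filter_upwards [hB'] with ω hω hωB
        exact tsub_add_cancel_of_le (hω hωB)
    _ = μ.withDensity f' B := (withDensity_apply _ hB).symm

/-- The Hardy-Littlewood inequality. -/
theorem lintegral_le_of_map_eq {μ : Measure Ω} {f f' : Ω → ℝ≥0∞}
    (hf : Measurable f) (hf' : Measurable f') (h : μ.map f' = μ.map f)
    [IsProbabilityMeasure (μ.withDensity f)] [IsProbabilityMeasure (μ.withDensity f')] {S : Set Ω}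
    (hS : μ Sᶜ = 0) {X : Ω → ℝ≥0} (hX : Measurable X)
    (hXf : ∀ ω ∈ S, ∀ ω' ∈ S, X ω < X ω' → f' ω' ≤ f' ω) :
    ∫⁻ ω, X ω ∂(μ.withDensity f') ≤ ∫⁻ ω, X ω ∂(μ.withDensity f) := by
  have key : ∀ g : Ω → ℝ≥0∞, ∫⁻ ω, X ω ∂(μ.withDensity g) =
      ∫⁻ t in Ioi (0 : ℝ), μ.withDensity g {ω | t < X ω} := fun g => by
    rw [← lintegral_eq_lintegral_meas_lt (μ.withDensity g) (f := fun ω => (X ω : ℝ))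
      (ae_of_all _ fun ω => (X ω).2) hX.coe_nnreal_real.aemeasurable]
    simp
  rw [key, key]
  refine lintegral_mono fun t => ?_
  have hB : MeasurableSet {ω | (X ω : ℝ) ≤ t} := measurableSet_le hX.coe_nnreal_real measurable_const
  have hc : {ω | t < (X ω : ℝ)} = {ω | (X ω : ℝ) ≤ t}ᶜ := by ext; simp
  -- In the layer-cake formula it suffices to compare superlevel sets of X. The sublevel sets are
  -- where f' is largest, so they gain mass and their complements lose it.
  rw [hc, prob_compl_eq_one_sub hB, prob_compl_eq_one_sub hB]
  refine tsub_le_tsub_left (measure_le_of_map_eq hf hf' h hB hS ?_) 1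
  intro ω hω hωB ω' hω' hωB'
  refine hXf ω hω ω' hω' ?_
  exact_mod_cast lt_of_le_of_lt (show (X ω : ℝ) ≤ t from hωB) (lt_of_not_ge fun h => hωB' h)

/-- Chebyshev's inequality for two oppositely ordered functions. -/
theorem lintegral_mul_mul_le {μ : Measure Ω} [SFinite μ] {S : Set Ω} (hS : μ Sᶜ = 0)
    {f g : Ω → ℝ≥0∞} (hf : Measurable f) (hg : Measurable g)
    (hfg : ∀ x ∈ S, ∀ y ∈ S, f x * g x + f y * g y ≤ f x * g y + f y * g x) :
    (∫⁻ x, f x * g x ∂μ) * μ univ ≤ (∫⁻ x, f x ∂μ) * ∫⁻ x, g x ∂μ := by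
  have hS' : ∀ᵐ ω ∂μ, ω ∈ S := hS
  have hfgm : Measurable fun x => f x * g x := hf.mul hg
  -- The pairing inequality is integrated over two independent copies of the variable; every term
  -- then occurs twice.
  have h : ∫⁻ x, ∫⁻ y, (f x * g x + f y * g y) ∂μ ∂μ ≤
      ∫⁻ x, ∫⁻ y, (f x * g y + f y * g x) ∂μ ∂μ := by
    refine lintegral_mono_ae ?_
    filter_upwards [hS'] with x hx
    refine lintegral_mono_ae ?_
    filter_upwards [hS'] with y hy using hfg x hx y hy
  have h1 : ∀ x, ∫⁻ y, (f x * g x + f y * g y) ∂μ =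
      f x * g x * μ univ + ∫⁻ y, f y * g y ∂μ := fun x => by
    rw [lintegral_add_left measurable_const, lintegral_const]
  have h2 : ∀ x, ∫⁻ y, (f x * g y + f y * g x) ∂μ =
      f x * ∫⁻ y, g y ∂μ + (∫⁻ y, f y ∂μ) * g x := fun x => by
    rw [lintegral_add_left (hg.const_mul _), lintegral_const_mul _ hg, lintegral_mul_const _ hf]
  simp only [h1, h2] at h
  rw [lintegral_add_right _ measurable_const, lintegral_add_left (hf.mul_const _),
    lintegral_mul_const _ hfgm, lintegral_mul_const _ hf, lintegral_const_mul _ hg,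
    lintegral_const, ← two_mul, ← two_mul] at h
  exact (ENNReal.mul_le_mul_iff_right two_ne_zero ENNReal.ofNat_ne_top).1 h

/-- Chebyshev's inequality for two similarly ordered functions. -/
theorem mul_lintegral_le_lintegral_mul {μ : Measure Ω} [SFinite μ] {S : Set Ω} (hS : μ Sᶜ = 0)
    {f g : Ω → ℝ≥0∞} (hf : Measurable f) (hg : Measurable g)
    (hfg : ∀ x ∈ S, ∀ y ∈ S, f x * g y + f y * g x ≤ f x * g x + f y * g y) :
    (∫⁻ x, f x ∂μ) * ∫⁻ x, g x ∂μ ≤ (∫⁻ x, f x * g x ∂μ) * μ univ := by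
  have hS' : ∀ᵐ ω ∂μ, ω ∈ S := hS
  have hfgm : Measurable fun x => f x * g x := hf.mul hg
  have h : ∫⁻ x, ∫⁻ y, (f x * g y + f y * g x) ∂μ ∂μ ≤
      ∫⁻ x, ∫⁻ y, (f x * g x + f y * g y) ∂μ ∂μ := by
    refine lintegral_mono_ae ?_
    filter_upwards [hS'] with x hx
    refine lintegral_mono_ae ?_
    filter_upwards [hS'] with y hy using hfg x hx y hy
  have h1 : ∀ x, ∫⁻ y, (f x * g x + f y * g y) ∂μ =
      f x * g x * μ univ + ∫⁻ y, f y * g y ∂μ := fun x => by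
    rw [lintegral_add_left measurable_const, lintegral_const]
  have h2 : ∀ x, ∫⁻ y, (f x * g y + f y * g x) ∂μ =
      f x * ∫⁻ y, g y ∂μ + (∫⁻ y, f y ∂μ) * g x := fun x => by
    rw [lintegral_add_left (hg.const_mul _), lintegral_const_mul _ hg, lintegral_mul_const _ hf]
  simp only [h1, h2] at h
  rw [lintegral_add_right _ measurable_const, lintegral_add_left (hf.mul_const _),
    lintegral_mul_const _ hfgm, lintegral_mul_const _ hf, lintegral_const_mul _ hg,
    lintegral_const, ← two_mul, ← two_mul] at h
  exact (ENNReal.mul_le_mul_iff_right two_ne_zero ENNReal.ofNat_ne_top).1 h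

end Rearranging

/-! ### Monotone functions on the type space -/

section Monotone

theorem ennreal_mul_add_mul_le {a b c d : ℝ≥0∞} (hab : a ≤ b) (hcd : c ≤ d) :
    a * d + b * c ≤ a * c + b * d := by
  obtain ⟨e, rfl⟩ := exists_add_of_le hab
  obtain ⟨k, rfl⟩ := exists_add_of_le hcd
  refine le_of_le_of_eq (le_self_add (b := e * k)) ?_
  ring

/-- Two functions of one variable are oppositely ordered if one of them decreases whenever the
other one increases. -/
theorem pairing_le_of_opposite {α : Type*} {S : Set α} {f g : α → ℝ≥0∞}
    (h : ∀ x ∈ S, ∀ y ∈ S, (f x ≤ f y ∧ g y ≤ g x) ∨ (f y ≤ f x ∧ g x ≤ g y)) :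
    ∀ x ∈ S, ∀ y ∈ S, f x * g x + f y * g y ≤ f x * g y + f y * g x := by
  intro x hx y hy
  rcases h x hx y hy with ⟨h1, h2⟩ | ⟨h1, h2⟩
  · exact ennreal_mul_add_mul_le h1 h2
  · rw [add_comm, add_comm (f x * g y)]
    exact ennreal_mul_add_mul_le h1 h2

theorem pairing_le_of_similar {α : Type*} {S : Set α} {f g : α → ℝ≥0∞}
    (h : ∀ x ∈ S, ∀ y ∈ S, (f x ≤ f y ∧ g x ≤ g y) ∨ (f y ≤ f x ∧ g y ≤ g x)) :
    ∀ x ∈ S, ∀ y ∈ S, f x * g y + f y * g x ≤ f x * g x + f y * g y := by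
  intro x hx y hy
  rcases h x hx y hy with ⟨h1, h2⟩ | ⟨h1, h2⟩
  · exact ennreal_mul_add_mul_le h1 h2
  · rw [add_comm, add_comm (f x * g x)]
    exact ennreal_mul_add_mul_le h1 h2

/-- Below 1 the preimage of a lower set is order-connected; the unconstrained value at 1 adds at
most one point. -/
theorem measurable_of_monotoneOn_Iio {s : Θ → ℝ≥0} (hs : MonotoneOn s (Iio 1)) :
    Measurable s := by
  refine measurable_of_Iic fun c => ?_
  have h : s ⁻¹' Iic c = (s ⁻¹' Iic c ∩ Iio 1) ∪ (s ⁻¹' Iic c ∩ {1}) := by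
    rw [← inter_union_distrib_left, eq_comm, inter_eq_left]
    intro x _
    rcases lt_or_eq_of_le (unitInterval.le_one' (t := x)) with h | h
    · exact Or.inl h
    · exact Or.inr h
  rw [h]
  refine MeasurableSet.union (OrdConnected.measurableSet ⟨?_⟩)
    (((finite_singleton (1 : Θ)).subset inter_subset_right).measurableSet)
  rintro x ⟨_, _⟩ y ⟨hy, hy1⟩ z ⟨_, hzy⟩
  have hz1 : z < 1 := lt_of_le_of_lt hzy hy1
  exact ⟨(hs hz1 hy1 hzy).trans hy, hz1⟩

end Monotone

/-- A full-support atomless distribution of types and a set of priors that is invariant under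
rearrangements. -/
structure IsBidderModel (F : ProbabilityMeasure Θ) (𝒬B : Set (ProbabilityMeasure Θ)) : Prop where
  ac : (F : Measure Θ) ≪ volume
  volume_ac : volume ≪ (F : Measure Θ)
  nonempty : 𝒬B.Nonempty
  compact : IsCompact 𝒬B
  invariant : IsRearrangementInvariant F (acBeliefs F) 𝒬B

/-- The smallest expectation of `h` over a set of priors. -/
noncomputable def worstExp (𝒬B : Set (ProbabilityMeasure Θ)) (h : Θ → ℝ) : ℝ :=
  ⨅ G : 𝒬B, ∫ θ', h θ' ∂((G : ProbabilityMeasure Θ) : Measure Θ)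

/-- The smallest probability of types below `t`. -/
noncomputable def worstCDF (𝒬B : Set (ProbabilityMeasure Θ)) (t : ℝ) : ℝ :=
  ⨅ G : 𝒬B, ((G : ProbabilityMeasure Θ) : Measure Θ).real {θ' | (θ' : ℝ) < t}

/-! ### Worst-case expectations and the worst-case distribution function. -/

section WorstCase

variable {𝒬B : Set (ProbabilityMeasure Θ)}

theorem abs_integral_le_of_abs_le {G : Measure Θ} [IsProbabilityMeasure G] {h : Θ → ℝ} {C : ℝ}
    (hC : ∀ x, |h x| ≤ C) : |∫ x, h x ∂G| ≤ C := by
  have := norm_integral_le_of_norm_le_const (μ := G) (f := h) (C := C)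
    (ae_of_all _ fun x => by rw [Real.norm_eq_abs]; exact hC x)
  simpa using this

theorem integrable_of_abs_le {G : Measure Θ} [IsProbabilityMeasure G] {h : Θ → ℝ}
    (hm : Measurable h) {C : ℝ} (hC : ∀ x, |h x| ≤ C) : Integrable h G :=
  Integrable.of_bound hm.aestronglyMeasurable C
    (ae_of_all _ fun x => by rw [Real.norm_eq_abs]; exact hC x)

theorem worstExp_le {h : Θ → ℝ} {C : ℝ} (hC : ∀ x, |h x| ≤ C) {G : ProbabilityMeasure Θ}
    (hG : G ∈ 𝒬B) : worstExp 𝒬B h ≤ ∫ x, h x ∂(G : Measure Θ) :=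
  ciInf_le (f := fun G : 𝒬B => ∫ x, h x ∂((G : ProbabilityMeasure Θ) : Measure Θ))
    ⟨-C, by rintro _ ⟨G, rfl⟩; exact (abs_le.1 (abs_integral_le_of_abs_le hC)).1⟩ ⟨G, hG⟩

theorem le_worstExp (hne : 𝒬B.Nonempty) {h : Θ → ℝ} {c : ℝ}
    (hc : ∀ G ∈ 𝒬B, c ≤ ∫ x, h x ∂(G : Measure Θ)) : c ≤ worstExp 𝒬B h := by
  have := hne.to_subtype
  exact le_ciInf fun G => hc G G.2

theorem exists_integral_lt (hne : 𝒬B.Nonempty) {h : Θ → ℝ} {c : ℝ} (hc : worstExp 𝒬B h < c) :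
    ∃ G ∈ 𝒬B, ∫ x, h x ∂(G : Measure Θ) < c := by
  have := hne.to_subtype
  obtain ⟨G, hG⟩ := exists_lt_of_ciInf_lt hc
  exact ⟨G, G.2, hG⟩

theorem worstCDF_le {G : ProbabilityMeasure Θ} (hG : G ∈ 𝒬B) (t : ℝ) :
    worstCDF 𝒬B t ≤ (G : Measure Θ).real {θ' | (θ' : ℝ) < t} :=
  ciInf_le (f := fun G : 𝒬B => ((G : ProbabilityMeasure Θ) : Measure Θ).real {θ' | (θ' : ℝ) < t})
    ⟨0, by rintro _ ⟨G, rfl⟩; exact measureReal_nonneg⟩ ⟨G, hG⟩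

theorem le_worstCDF (hne : 𝒬B.Nonempty) {t c : ℝ}
    (hc : ∀ G ∈ 𝒬B, c ≤ (G : Measure Θ).real {θ' | (θ' : ℝ) < t}) : c ≤ worstCDF 𝒬B t := by
  have := hne.to_subtype
  exact le_ciInf fun G => hc G G.2

theorem exists_measure_lt (hne : 𝒬B.Nonempty) {t c : ℝ} (hc : worstCDF 𝒬B t < c) :
    ∃ G ∈ 𝒬B, (G : Measure Θ).real {θ' | (θ' : ℝ) < t} < c := by
  have := hne.to_subtype
  obtain ⟨G, hG⟩ := exists_lt_of_ciInf_lt hc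
  exact ⟨G, G.2, hG⟩

theorem measurableSet_coe_lt (t : ℝ) : MeasurableSet {θ' : Θ | (θ' : ℝ) < t} :=
  measurableSet_lt measurable_subtype_coe measurable_const

theorem worstCDF_nonneg (𝒬B : Set (ProbabilityMeasure Θ)) (t : ℝ) : 0 ≤ worstCDF 𝒬B t :=
  Real.iInf_nonneg fun _ => measureReal_nonneg

theorem monotone_worstCDF (hne : 𝒬B.Nonempty) : Monotone (worstCDF 𝒬B) := fun _ _ h =>
  le_worstCDF hne fun _ hG => (worstCDF_le hG _).trans
    (measureReal_mono fun _ hx => lt_of_lt_of_le hx h)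

theorem worstCDF_le_one (hne : 𝒬B.Nonempty) (t : ℝ) : worstCDF 𝒬B t ≤ 1 := by
  obtain ⟨G, hG⟩ := hne
  exact (worstCDF_le hG t).trans measureReal_le_one

theorem worstCDF_zero (hne : 𝒬B.Nonempty) : worstCDF 𝒬B 0 = 0 := by
  refine le_antisymm ?_ (worstCDF_nonneg _ _)
  obtain ⟨G, hG⟩ := hne
  refine (worstCDF_le hG 0).trans ?_
  have : {θ' : Θ | (θ' : ℝ) < 0} = ∅ := by
    ext x
    simpa using x.2.1
  simp [this]

/-- By the portmanteau theorem the mass of an open set is lower semicontinuous under weak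
convergence. -/
theorem isClosed_measure_le {U : Set Θ} (hU : IsOpen U) (c : ℝ≥0∞) :
    IsClosed {G : ProbabilityMeasure Θ | (G : Measure Θ) U ≤ c} := by
  rw [isClosed_iff_ultrafilter]
  intro G u hu hmem
  have h := ProbabilityMeasure.le_liminf_measure_open_of_tendsto
    (μs := fun G : ProbabilityMeasure Θ => G) (L := (u : Filter (ProbabilityMeasure Θ)))
    (tendsto_id.mono_left hu) hU
  refine h.trans (liminf_le_of_frequently_le' ?_)
  exact Eventually.frequently hmem

/-- The worst-case distribution function is left-continuous. -/
theorem exists_lt_worstCDF (hne : 𝒬B.Nonempty) (hcpt : IsCompact 𝒬B) {t c : ℝ}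
    (hc : c < worstCDF 𝒬B t) : ∃ t' < t, c < worstCDF 𝒬B t' := by
  by_contra! hcon
  obtain ⟨c', hcc', hc't⟩ := exists_between hc
  obtain ⟨u, hu, hut, hlim⟩ := exists_seq_strictMono_tendsto t
  have hc0 : 0 ≤ c' := (worstCDF_nonneg 𝒬B _).trans ((hcon _ (hut 0)).trans hcc'.le)
  have hopen : ∀ n, IsOpen {θ' : Θ | (θ' : ℝ) < u n} := fun n =>
    isOpen_lt continuous_subtype_val continuous_const
  -- If w stayed below c' left of t, these nested compact sets of priors would be nonempty. A prior
  -- in their intersection gives every {θ' < u n}, hence their union {θ' < t}, mass at most c' <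
  -- w(t).
  let K : ℕ → Set (ProbabilityMeasure Θ) := fun n =>
    𝒬B ∩ {G | (G : Measure Θ) {θ' : Θ | (θ' : ℝ) < u n} ≤ ENNReal.ofReal c'}
  have hK : ∀ n, IsClosed (K n) := fun n =>
    hcpt.isClosed.inter (isClosed_measure_le (hopen n) _)
  obtain ⟨G, hG⟩ := IsCompact.nonempty_iInter_of_sequence_nonempty_isCompact_isClosed K
    (fun n G hG => by
      have hle : (G : Measure Θ) {θ' : Θ | (θ' : ℝ) < u n} ≤
          (G : Measure Θ) {θ' : Θ | (θ' : ℝ) < u (n + 1)} :=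
        measure_mono fun x hx => lt_trans (show (x : ℝ) < u n from hx) (hu n.lt_succ_self)
      exact ⟨hG.1, hle.trans hG.2⟩)
    (fun n => by
      obtain ⟨G, hG, hlt⟩ := exists_measure_lt hne ((hcon _ (hut n)).trans_lt hcc')
      refine ⟨G, hG, ?_⟩
      rw [mem_ofPred_eq, ← ENNReal.ofReal_toReal (measure_ne_top (G : Measure Θ) _)]
      exact ENNReal.ofReal_le_ofReal hlt.le)
    (hcpt.inter_right (isClosed_measure_le (hopen 0) _)) hK
  rw [mem_iInter] at hG
  refine absurd ((worstCDF_le (hG 0).1 t).trans ?_) (not_le.2 hc't)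
  have hU : {θ' : Θ | (θ' : ℝ) < t} = ⋃ n, {θ' : Θ | (θ' : ℝ) < u n} := by
    ext x
    simp only [mem_ofPred_eq, mem_iUnion]
    exact ⟨fun hx => (hlim.eventually (lt_mem_nhds hx)).exists, fun ⟨n, hn⟩ => hn.trans (hut n)⟩
  have hmono : Monotone fun n => {θ' : Θ | (θ' : ℝ) < u n} := fun m n hmn x hx =>
    lt_of_lt_of_le (show (x : ℝ) < u m from hx) (hu.monotone hmn)
  refine ENNReal.toReal_le_of_le_ofReal hc0 ?_
  rw [hU, hmono.measure_iUnion]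
  exact iSup_le fun n => (hG n).2

end WorstCase

/-! ### Rearranged priors and likelihood-ratio inequalities. -/

namespace IsBidderModel

variable {F : ProbabilityMeasure Θ} {𝒬B : Set (ProbabilityMeasure Θ)}

theorem prior_ac (hM : IsBidderModel F 𝒬B) {G : ProbabilityMeasure Θ} (hG : G ∈ 𝒬B) :
    (G : Measure Θ) ≪ (F : Measure Θ) := hM.invariant.1 hG

theorem measure_singleton (hM : IsBidderModel F 𝒬B) (x : Θ) : (F : Measure Θ) {x} = 0 :=
  hM.ac (MeasureTheory.measure_singleton x)

theorem measure_compl_Iio_one (hM : IsBidderModel F 𝒬B) : (F : Measure Θ) (Iio 1)ᶜ = 0 := by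
  refine measure_mono_null (fun x hx => ?_) (hM.measure_singleton 1)
  exact le_antisymm unitInterval.le_one' (not_lt.1 fun h => hx h)

theorem measure_Ioo_ne_zero (hM : IsBidderModel F 𝒬B) {a b : Θ} (hab : a < b) :
    (F : Measure Θ) (Ioo a b) ≠ 0 := by
  intro h
  have h' := hM.volume_ac h
  rw [unitInterval.volume_Ioo, ENNReal.ofReal_eq_zero] at h'
  have : (a : ℝ) < b := hab
  linarith

theorem measure_subsingleton (hM : IsBidderModel F 𝒬B) {A : Set Θ} (hA : A.Subsingleton) :
    (F : Measure Θ) A = 0 := by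
  rcases hA.eq_empty_or_singleton with rfl | ⟨x, rfl⟩
  · exact measure_empty
  · exact hM.measure_singleton x

/-- Every prior has a rearrangement with a density that decreases along a given injective ranking
of the types. -/
theorem exists_ranked_density (hM : IsBidderModel F 𝒬B) {G : ProbabilityMeasure Θ}
    (hG : G ∈ 𝒬B) {Z : Θ → ℝ} (hZ : Measurable Z) (hinj : Function.Injective Z) :
    ∃ G' ∈ 𝒬B, ∃ D : ℝ → ℝ≥0∞, Antitone D ∧
      (G' : Measure Θ) = (F : Measure Θ).withDensity (fun x => D (Z x)) ∧
      ∀ X : Θ → ℝ, Measurable X → (∀ x < 1, ∀ y < 1, X x < X y → Z x ≤ Z y) →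
        ∀ C, (∀ x, |X x| ≤ C) → ∫ x, X x ∂(G' : Measure Θ) ≤ ∫ x, X x ∂(G : Measure Θ) := by
  obtain ⟨G', D, hD, hG', hmap⟩ := exists_antitone_rearrangement (hM.invariant.1 hG) hZ
    (fun z => hM.measure_subsingleton fun x hx y hy =>
      hinj ((show Z x = z from hx).trans (show Z y = z from hy).symm))
  have hGd : (G : Measure Θ) = (F : Measure Θ).withDensity
      ((G : Measure Θ).rnDeriv (F : Measure Θ)) :=
    (Measure.withDensity_rnDeriv_eq _ _ (hM.prior_ac hG)).symm
  have hfm := Measure.measurable_rnDeriv (G : Measure Θ) (F : Measure Θ)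
  have hDm : Measurable fun x => D (Z x) := hD.measurable.comp hZ
  refine ⟨G', hM.invariant.2 G hG G' ?_ (isRearrangement_of_map_eq hfm hDm hGd hG' hmap),
    D, hD, hG', ?_⟩
  · change (G' : Measure Θ) ≪ (F : Measure Θ)
    rw [hG']
    exact withDensity_absolutelyContinuous _ _
  intro X hX hXZ C hC
  -- Shifting by the bound C makes X nonnegative; under a probability measure the shift changes
  -- every expectation by the same C.
  have hY : Measurable fun x => (X x + C).toNNReal := (hX.add_const C).real_toNNReal
  have key : ∀ H : ProbabilityMeasure Θ, ∫⁻ x, ((X x + C).toNNReal : ℝ≥0∞) ∂(H : Measure Θ) =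
      ENNReal.ofReal (∫ x, X x ∂(H : Measure Θ) + C) := fun H => by
    have hi := integrable_of_abs_le (G := (H : Measure Θ)) hX hC
    have h1 : ∫ x, X x ∂(H : Measure Θ) + C = ∫ x, (X x + C) ∂(H : Measure Θ) := by
      rw [integral_add hi (integrable_const C)]
      simp
    have hi' : Integrable (fun x => X x + C) (H : Measure Θ) := hi.add (integrable_const C)
    rw [h1, ofReal_integral_eq_lintegral_ofReal hi'
      (ae_of_all _ fun x => by have := (abs_le.1 (hC x)).1; simp only [Pi.zero_apply]; linarith)]
    rfl
  have : IsProbabilityMeasure ((F : Measure Θ).withDensity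
      ((G : Measure Θ).rnDeriv (F : Measure Θ))) := hGd ▸ inferInstance
  have : IsProbabilityMeasure ((F : Measure Θ).withDensity fun x => D (Z x)) :=
    hG' ▸ inferInstance
  have h := lintegral_le_of_map_eq (μ := (F : Measure Θ)) hfm hDm hmap
    hM.measure_compl_Iio_one hY (fun x hx y hy hxy => hD (hXZ x hx y hy (by
      by_contra hle
      exact not_le.2 hxy (Real.toNNReal_le_toNNReal (by linarith)))))
  rw [← hG', ← hGd, key, key] at h
  have h0 : 0 ≤ ∫ x, X x ∂(G : Measure Θ) + C := by
    have := (abs_le.1 (abs_integral_le_of_abs_le (G := (G : Measure Θ)) hC)).1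
    linarith
  have := (ENNReal.ofReal_le_ofReal_iff h0).1 h
  linarith

/-- Every prior has a rearrangement with a non-decreasing density. -/
theorem exists_monotone_density (hM : IsBidderModel F 𝒬B) {G : ProbabilityMeasure Θ}
    (hG : G ∈ 𝒬B) : ∃ G' ∈ 𝒬B, ∃ f : Θ → ℝ≥0∞, Monotone f ∧
      (G' : Measure Θ) = (F : Measure Θ).withDensity f ∧
      ∀ X : Θ → ℝ, Measurable X → AntitoneOn X (Iio 1) → ∀ C, (∀ x, |X x| ≤ C) →
        ∫ x, X x ∂(G' : Measure Θ) ≤ ∫ x, X x ∂(G : Measure Θ) := by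
  obtain ⟨G', hG', D, hD, hd, h⟩ := hM.exists_ranked_density hG
    (Z := fun x : Θ => -(x : ℝ)) measurable_subtype_coe.neg
    (neg_injective.comp Subtype.val_injective)
  refine ⟨G', hG', _, fun x y hxy => hD (neg_le_neg hxy), hd, fun X hX hanti C hC =>
    h X hX (fun x hx y hy hxy => ?_) C hC⟩
  refine neg_le_neg (le_of_not_ge fun hle => ?_)
  exact not_le.2 hxy (hanti hx hy hle)

/-- Chebyshev's inequality on B for f and the indicator of A: if f is lower on A than on the rest of
B, its average over A is at most its average over B. The top type is null and may be ignored. -/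
theorem measure_mul_le (hM : IsBidderModel F 𝒬B) {f : Θ → ℝ≥0∞} (hf : Measurable f)
    {A B : Set Θ} (hA : MeasurableSet A) (hB : MeasurableSet B) (hAB : A ⊆ B)
    (hfA : ∀ x ∈ A, ∀ y ∈ B \ A, x < 1 → y < 1 → f x ≤ f y) :
    (F : Measure Θ).withDensity f A * (F : Measure Θ) B ≤
      (F : Measure Θ).withDensity f B * (F : Measure Θ) A := by
  have hS : ((F : Measure Θ).restrict B) (B ∩ Iio 1)ᶜ = 0 := by
    rw [compl_inter]
    refine measure_union_null ?_ ?_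
    · rw [Measure.restrict_apply hB.compl, compl_inter_self, measure_empty]
    · exact Measure.restrict_le_self.absolutelyContinuous hM.measure_compl_Iio_one
  have h := lintegral_mul_mul_le (μ := (F : Measure Θ).restrict B) hS hf
    (g := A.indicator 1) (measurable_one.indicator hA) (pairing_le_of_opposite ?_)
  · have e1 : ∀ x, f x * A.indicator 1 x = A.indicator f x := fun x => by
      by_cases hx : x ∈ A <;> simp [hx]
    simp only [e1] at h
    rw [lintegral_indicator hA, lintegral_indicator_one hA, Measure.restrict_restrict hA,
      inter_eq_left.2 hAB, Measure.restrict_apply_univ, Measure.restrict_apply hA,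
      inter_eq_left.2 hAB] at h
    rwa [withDensity_apply _ hA, withDensity_apply _ hB]
  · rintro x ⟨hxB, hx1⟩ y ⟨hyB, hy1⟩
    by_cases hx : x ∈ A <;> by_cases hy : y ∈ A
    · simpa [hx, hy] using le_total _ _
    · left
      simpa [hx, hy] using hfA x hx y ⟨hyB, hy⟩ hx1 hy1
    · right
      simpa [hx, hy] using hfA y hy x ⟨hxB, hx⟩ hy1 hx1
    · simpa [hx, hy] using le_total _ _

/-- The reverse correlation: a set on which the density is high receives at least its reference
share of B. -/
theorem mul_measure_le (hM : IsBidderModel F 𝒬B) {f : Θ → ℝ≥0∞} (hf : Measurable f)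
    {A B : Set Θ} (hA : MeasurableSet A) (hB : MeasurableSet B) (hAB : A ⊆ B)
    (hfA : ∀ x ∈ A, ∀ y ∈ B \ A, x < 1 → y < 1 → f y ≤ f x) :
    (F : Measure Θ).withDensity f B * (F : Measure Θ) A ≤
      (F : Measure Θ).withDensity f A * (F : Measure Θ) B := by
  have hS : ((F : Measure Θ).restrict B) (B ∩ Iio 1)ᶜ = 0 := by
    rw [compl_inter]
    refine measure_union_null ?_ ?_
    · rw [Measure.restrict_apply hB.compl, compl_inter_self, measure_empty]
    · exact Measure.restrict_le_self.absolutelyContinuous hM.measure_compl_Iio_one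
  have h := mul_lintegral_le_lintegral_mul (μ := (F : Measure Θ).restrict B) hS hf
    (g := A.indicator 1) (measurable_one.indicator hA) (pairing_le_of_similar ?_)
  · have e1 : ∀ x, f x * A.indicator 1 x = A.indicator f x := fun x => by
      by_cases hx : x ∈ A <;> simp [hx]
    simp only [e1] at h
    rw [lintegral_indicator_one hA, lintegral_indicator hA, Measure.restrict_restrict hA,
      inter_eq_left.2 hAB, Measure.restrict_apply_univ, Measure.restrict_apply hA,
      inter_eq_left.2 hAB] at h
    rwa [withDensity_apply _ hA, withDensity_apply _ hB]
  · rintro x ⟨hxB, hx1⟩ y ⟨hyB, hy1⟩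
    by_cases hx : x ∈ A <;> by_cases hy : y ∈ A
    · simpa [hx, hy] using le_total _ _
    · right
      simpa [hx, hy] using hfA x hx y ⟨hyB, hy⟩ hx1 hy1
    · left
      simpa [hx, hy] using hfA y hy x ⟨hxB, hx⟩ hy1 hx1
    · simpa [hx, hy] using le_total _ _

/-- The ratio of the worst-case distribution function to the reference one is non-decreasing. -/
theorem worstCDF_mul_le (hM : IsBidderModel F 𝒬B) {t u : ℝ} (htu : t ≤ u) :
    worstCDF 𝒬B t * (F : Measure Θ).real {θ' | (θ' : ℝ) < u} ≤
      worstCDF 𝒬B u * (F : Measure Θ).real {θ' | (θ' : ℝ) < t} := by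
  rcases measureReal_nonneg.eq_or_lt (a := (0 : ℝ))
    (b := (F : Measure Θ).real {θ' | (θ' : ℝ) < t}) with h0 | hpos
  · have h : (F : Measure Θ) {θ' | (θ' : ℝ) < t} = 0 := by
      rwa [eq_comm, measureReal_eq_zero_iff] at h0
    obtain ⟨G, hG⟩ := hM.nonempty
    have hz : worstCDF 𝒬B t = 0 := by
      refine le_antisymm ((worstCDF_le hG t).trans ?_) (worstCDF_nonneg _ _)
      rw [measureReal_def, hM.prior_ac hG h, ENNReal.toReal_zero]
    rw [hz, ← h0]
    simp
  rw [← div_le_iff₀ hpos]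
  refine le_worstCDF hM.nonempty fun G hG => ?_
  -- The rearrangement G' has less mass below u than G, and its increasing density gives the types
  -- below t at most their reference share of that mass. Since w(t) is at most the mass of G' below
  -- t, this bounds G from below.
  obtain ⟨G', hG', f, hf, hd, hle⟩ := hM.exists_monotone_density hG
  have h1 : (G' : Measure Θ).real {θ' | (θ' : ℝ) < u} ≤
      (G : Measure Θ).real {θ' | (θ' : ℝ) < u} := by
    have := hle ({θ' : Θ | (θ' : ℝ) < u}.indicator 1)
      (measurable_one.indicator (measurableSet_coe_lt u)) (fun x _ y _ hxy => ?_) 1 ?_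
    · rwa [integral_indicator_one (measurableSet_coe_lt u),
        integral_indicator_one (measurableSet_coe_lt u)] at this
    · by_cases hy : y ∈ {θ' : Θ | (θ' : ℝ) < u}
      · have hx : x ∈ {θ' : Θ | (θ' : ℝ) < u} := lt_of_le_of_lt (show (x : ℝ) ≤ y from hxy) hy
        rw [indicator_of_mem hx, indicator_of_mem hy]
        exact le_rfl
      · rw [indicator_of_notMem hy]
        exact indicator_nonneg (fun _ _ => zero_le_one) x
    · intro x
      by_cases hx : x ∈ {θ' : Θ | (θ' : ℝ) < u} <;> simp [hx]
  have h2 := hM.measure_mul_le hf.measurable (measurableSet_coe_lt t) (measurableSet_coe_lt u)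
    (fun x hx => lt_of_lt_of_le hx htu) (fun x hx y hy _ _ => hf (by
      have : (t : ℝ) ≤ y := not_lt.1 hy.2
      exact_mod_cast (lt_of_lt_of_le hx this).le))
  rw [← hd] at h2
  have h3 := ENNReal.toReal_mono (by finiteness) h2
  rw [ENNReal.toReal_mul, ENNReal.toReal_mul] at h3
  refine le_trans ?_ h1
  rw [div_le_iff₀ hpos]
  refine le_trans ?_ h3
  exact mul_le_mul_of_nonneg_right (worstCDF_le hG' t) measureReal_nonneg

/-- The ratio w/F is non-decreasing and at most 1 at the right end, where F has all its mass. -/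
theorem worstCDF_le_measure (hM : IsBidderModel F 𝒬B) {t : ℝ} (ht : t ≤ 1) :
    worstCDF 𝒬B t ≤ (F : Measure Θ).real {θ' | (θ' : ℝ) < t} := by
  have h := hM.worstCDF_mul_le ht
  have h1 : (F : Measure Θ).real {θ' | (θ' : ℝ) < 1} = 1 := by
    have h0 : (F : Measure Θ) {θ' : Θ | (θ' : ℝ) < 1} = 1 :=
      (prob_compl_eq_zero_iff (measurableSet_coe_lt 1)).1 hM.measure_compl_Iio_one
    rw [measureReal_def, h0, ENNReal.toReal_one]
  rw [h1, mul_one] at h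
  exact h.trans (mul_le_of_le_one_left measureReal_nonneg (worstCDF_le_one hM.nonempty 1))

end IsBidderModel

/-! ### The envelope formula -/

section Envelope

/-- A function whose decrements are dominated by those of `(b - a) * (w b - w a)` does not
decrease. -/
theorem le_of_increments {w D : ℝ → ℝ} {T : ℝ} (hT : 0 ≤ T)
    (h : ∀ a b, 0 ≤ a → a ≤ b → b ≤ T → D a - (b - a) * (w b - w a) ≤ D b) : D 0 ≤ D T := by
  -- Cut [0, T] into n equal pieces. The error terms telescope to T (w T - w 0) / n, which vanishes
  -- in the limit; w needs no continuity.
  have key : ∀ n : ℕ, 0 < n → D 0 - T * (w T - w 0) / n ≤ D T := by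
    intro n hn
    have hn' : (0 : ℝ) < n := Nat.cast_pos.2 hn
    have hk : ∀ k : ℕ, k ≤ n →
        D 0 - T / n * (w (k * (T / n)) - w 0) ≤ D (k * (T / n)) := by
      intro k
      induction k with
      | zero => intro _; simp
      | succ k ih =>
        intro hkn
        have h1 := ih (Nat.le_of_succ_le hkn)
        have hTn : 0 ≤ T / n := by positivity
        have hle : (k : ℝ) * (T / n) ≤ ((k + 1 : ℕ) : ℝ) * (T / n) := by
          push_cast; nlinarith
        have hT' : ((k + 1 : ℕ) : ℝ) * (T / n) ≤ T := by
          have : ((k + 1 : ℕ) : ℝ) ≤ n := by exact_mod_cast hkn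
          calc ((k + 1 : ℕ) : ℝ) * (T / n) ≤ n * (T / n) := by gcongr
            _ = T := by field_simp
        have h2 := h _ _ (by positivity) hle hT'
        have e : ((k + 1 : ℕ) : ℝ) * (T / n) - k * (T / n) = T / n := by push_cast; ring
        rw [e] at h2
        linarith
    have h1 := hk n le_rfl
    have e : (n : ℝ) * (T / n) = T := by field_simp
    rw [e] at h1
    have e' : T * (w T - w 0) / n = T / n * (w T - w 0) := by ring
    rwa [e']
  have hlim : Tendsto (fun n : ℕ => D 0 - T * (w T - w 0) / n) atTop (𝓝 (D 0 - 0)) :=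
    tendsto_const_nhds.sub (tendsto_const_div_atTop_nhds_zero_nat _)
  rw [sub_zero] at hlim
  exact le_of_tendsto hlim ((eventually_gt_atTop 0).mono key)

/-- The information rent of type `t`, the integral of the worst-case distribution function. -/
noncomputable def rent (𝒬B : Set (ProbabilityMeasure Θ)) (t : ℝ) : ℝ :=
  ∫ x in (0 : ℝ)..t, worstCDF 𝒬B x

variable {𝒬B : Set (ProbabilityMeasure Θ)}

theorem rent_zero (𝒬B : Set (ProbabilityMeasure Θ)) : rent 𝒬B 0 = 0 :=
  intervalIntegral.integral_same

theorem intervalIntegrable_worstCDF (hne : 𝒬B.Nonempty) (a b : ℝ) :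
    IntervalIntegrable (worstCDF 𝒬B) volume a b :=
  (monotone_worstCDF hne).intervalIntegrable

theorem rent_sub (hne : 𝒬B.Nonempty) (a b : ℝ) :
    rent 𝒬B b - rent 𝒬B a = ∫ x in a..b, worstCDF 𝒬B x :=
  intervalIntegral.integral_interval_sub_left (intervalIntegrable_worstCDF hne _ _)
    (intervalIntegrable_worstCDF hne _ _)

theorem le_rent_sub (hne : 𝒬B.Nonempty) {a b : ℝ} (hab : a ≤ b) :
    (b - a) * worstCDF 𝒬B a ≤ rent 𝒬B b - rent 𝒬B a := by
  rw [rent_sub hne]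
  have := intervalIntegral.integral_mono_on hab (intervalIntegrable_const (c := worstCDF 𝒬B a))
    (intervalIntegrable_worstCDF hne a b) fun x hx => monotone_worstCDF hne hx.1
  simpa using this

theorem rent_sub_le (hne : 𝒬B.Nonempty) {a b : ℝ} (hab : a ≤ b) :
    rent 𝒬B b - rent 𝒬B a ≤ (b - a) * worstCDF 𝒬B b := by
  rw [rent_sub hne]
  have := intervalIntegral.integral_mono_on hab (intervalIntegrable_worstCDF hne a b)
    (intervalIntegrable_const (c := worstCDF 𝒬B b)) fun x hx => monotone_worstCDF hne hx.2
  simpa using this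

theorem coe_projIcc_of_mem {r : ℝ} (h0 : 0 ≤ r) (h1 : r ≤ 1) :
    ((projIcc (0 : ℝ) 1 zero_le_one r : Θ) : ℝ) = r :=
  congrArg Subtype.val (projIcc_of_mem zero_le_one ⟨h0, h1⟩)

/-- On a short interval V grows by at least its length times w at the left end, the rent by at most
its length times w at the right end; `le_of_increments` absorbs the difference. -/
theorem rent_le_of_increments (hne : 𝒬B.Nonempty) {V : Θ → ℝ} (h0 : 0 ≤ V 0)
    (hV : ∀ a θ : Θ, a ≤ θ → θ < 1 → V a + (θ - a) * worstCDF 𝒬B a ≤ V θ) {θ : Θ} (hθ : θ < 1) :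
    rent 𝒬B θ ≤ V θ := by
  have hθ1 : (θ : ℝ) < 1 := hθ
  have := le_of_increments (w := worstCDF 𝒬B)
    (D := fun r => V (projIcc 0 1 zero_le_one r) - rent 𝒬B r) θ.2.1 (fun a b ha hab hb => by
      have h1 := hV (projIcc 0 1 zero_le_one a) (projIcc 0 1 zero_le_one b)
        (monotone_projIcc _ hab) (by
          rw [← Subtype.coe_lt_coe, coe_projIcc_of_mem (ha.trans hab) (hb.trans hθ1.le)]
          exact hb.trans_lt hθ1)
      rw [coe_projIcc_of_mem (ha.trans hab) (hb.trans hθ1.le),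
        coe_projIcc_of_mem ha ((hab.trans hb).trans hθ1.le)] at h1
      have h2 := rent_sub_le hne hab
      linarith)
  have e : projIcc (0 : ℝ) 1 zero_le_one θ = θ := projIcc_val _ θ
  have e0 : projIcc (0 : ℝ) 1 zero_le_one 0 = 0 :=
    projIcc_left zero_le_one
  simp only [e, e0, rent_zero] at this
  linarith

/-- The mirror image, with w taken at the right end. Restricting the hypothesis to 0 < θ, where
equilibrium bids are controlled, is harmless: an interval ending at 0 is degenerate. -/
theorem le_rent_of_increments (hne : 𝒬B.Nonempty) {V : Θ → ℝ} (h0 : V 0 ≤ 0)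
    (hV : ∀ a θ : Θ, a ≤ θ → 0 < θ → θ < 1 → V θ ≤ V a + (θ - a) * worstCDF 𝒬B θ) {θ : Θ}
    (hθ : θ < 1) : V θ ≤ rent 𝒬B θ := by
  have hθ1 : (θ : ℝ) < 1 := hθ
  have := le_of_increments (w := worstCDF 𝒬B)
    (D := fun r => rent 𝒬B r - V (projIcc 0 1 zero_le_one r)) θ.2.1 (fun a b ha hab hb => by
      rcases (ha.trans hab).eq_or_lt with hb0 | hb0
      · have : a = b := by linarith
        simp [this]
      have h1 := hV (projIcc 0 1 zero_le_one a) (projIcc 0 1 zero_le_one b)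
        (monotone_projIcc _ hab) (by
          rw [← Subtype.coe_lt_coe, coe_projIcc_of_mem (ha.trans hab) (hb.trans hθ1.le)]
          exact hb0) (by
          rw [← Subtype.coe_lt_coe, coe_projIcc_of_mem (ha.trans hab) (hb.trans hθ1.le)]
          exact hb.trans_lt hθ1)
      rw [coe_projIcc_of_mem (ha.trans hab) (hb.trans hθ1.le),
        coe_projIcc_of_mem ha ((hab.trans hb).trans hθ1.le)] at h1
      have h2 := le_rent_sub hne hab
      linarith)
  have e : projIcc (0 : ℝ) 1 zero_le_one θ = θ := projIcc_val _ θ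
  have e0 : projIcc (0 : ℝ) 1 zero_le_one 0 = 0 :=
    projIcc_left zero_le_one
  simp only [e, e0, rent_zero] at this
  linarith

end Envelope

/-! ### Equilibria -/

theorem highestBidWins_le_one (b b' : ℝ≥0) : highestBidWins b b' ≤ 1 := by
  unfold highestBidWins
  split_ifs
  · exact le_rfl
  · exact half_le_self zero_le_one
  · exact zero_le_one

theorem antitone_highestBidWins (b : ℝ≥0) : Antitone (highestBidWins b) := by
  intro x y hxy
  rcases lt_trichotomy y b with h | h | h
  · simp [highestBidWins, h, hxy.trans_lt h]
  · subst h
    rcases hxy.lt_or_eq with h | h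
    · simp [highestBidWins, h]
    · rw [h]
  · have h0 : highestBidWins b y = 0 := by simp [highestBidWins, h.not_gt, h.ne]
    rw [h0]
    exact zero_le

/-- Separates what a bidder would obtain by winning all ties from the half lost at a tie, the form
needed when comparing a bid with slight overbids. -/
theorem coe_highestBidWins (b b' : ℝ≥0) : (highestBidWins b b' : ℝ) =
    (if b' ≤ b then 1 else 0) - 1 / 2 * (if b' = b then 1 else 0) := by
  unfold highestBidWins
  rcases lt_trichotomy b' b with h | h | h
  · simp [h, h.le, h.ne]
  · subst h; norm_num
  · simp [h.not_gt, h.not_ge, h.ne', h.ne]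

/-- The properties shared by the four auction formats: the higher bid wins, nobody pays more than
her bid, and payments depend measurably on the competitor's bid. -/
structure Auction.IsStandard (A : Auction) : Prop where
  x_eq : A.x = highestBidWins
  τ_le : ∀ b b', A.τ b b' ≤ b
  measurable_τ : ∀ b, Measurable (A.τ b)

theorem isStandard_firstPrice : firstPrice.IsStandard where
  x_eq := rfl
  τ_le b b' := mul_le_of_le_one_right zero_le (highestBidWins_le_one b b')
  measurable_τ b := (antitone_highestBidWins b).measurable.const_mul b

theorem isStandard_secondPrice : secondPrice.IsStandard where
  x_eq := rfl
  τ_le b b' := by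
    change b' * highestBidWins b b' ≤ b
    rcases le_or_gt b' b with h | h
    · exact (mul_le_of_le_one_right zero_le (highestBidWins_le_one b b')).trans h
    · simp [highestBidWins, h.not_gt, h.ne]
  measurable_τ b := measurable_id.mul (antitone_highestBidWins b).measurable

theorem isStandard_allPay : allPay.IsStandard where
  x_eq := rfl
  τ_le _ _ := le_rfl
  measurable_τ _ := measurable_const

theorem warOfAttrition_τ (b b' : ℝ≥0) : warOfAttrition.τ b b' = min b b' := by
  change (if b' < b then b' else b) = min b b'
  split_ifs with h
  · exact (min_eq_right h.le).symm
  · exact (min_eq_left (not_lt.1 h)).symm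

theorem isStandard_warOfAttrition : warOfAttrition.IsStandard where
  x_eq := rfl
  τ_le b b' := by rw [warOfAttrition_τ]; exact min_le_left _ _
  measurable_τ b := by
    have : warOfAttrition.τ b = fun b' => min b b' := funext (warOfAttrition_τ b)
    rw [this]
    exact measurable_const.min measurable_id

/-! ### Imitation, ties and worst-case winning probabilities. -/

section Equilibrium

variable {A : Auction} {𝒬B : Set (ProbabilityMeasure Θ)} {s : Θ → ℝ≥0}

namespace Auction.IsStandard

theorem abs_x_le (hA : A.IsStandard) (b b' : ℝ≥0) : |(A.x b b' : ℝ)| ≤ 1 := by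
  rw [abs_of_nonneg (NNReal.coe_nonneg _), hA.x_eq]
  exact_mod_cast highestBidWins_le_one b b'

theorem abs_payoff_le (hA : A.IsStandard) (θ : Θ) (b b' : ℝ≥0) :
    |(θ : ℝ) * (A.x b b' : ℝ) - (A.τ b b' : ℝ)| ≤ 1 + b := by
  have h1 : (A.τ b b' : ℝ) ≤ b := by exact_mod_cast hA.τ_le b b'
  have h2 := (A.τ b b').2
  have h3 := (abs_le.1 (hA.abs_x_le b b')).2
  have h4 := (A.x b b').2
  have h5 : (θ : ℝ) * (A.x b b' : ℝ) ≤ 1 := mul_le_one₀ θ.2.2 h4 h3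
  have h6 : 0 ≤ (θ : ℝ) * (A.x b b' : ℝ) := mul_nonneg θ.2.1 h4
  rw [abs_le]
  constructor <;> linarith

theorem measurable_x (hA : A.IsStandard) (hs : Measurable s) (b : ℝ≥0) :
    Measurable fun θ' => (A.x b (s θ') : ℝ) := by
  rw [hA.x_eq]
  exact ((antitone_highestBidWins b).measurable.comp hs).coe_nnreal_real

theorem measurable_payoff (hA : A.IsStandard) (hs : Measurable s) (θ : Θ) (b : ℝ≥0) :
    Measurable fun θ' => (θ : ℝ) * (A.x b (s θ') : ℝ) - (A.τ b (s θ') : ℝ) :=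
  ((hA.measurable_x hs b).const_mul _).sub ((hA.measurable_τ b).comp hs).coe_nnreal_real

theorem payoff_le (hA : A.IsStandard) (s : Θ → ℝ≥0) (θ : Θ) (b : ℝ≥0) {G : ProbabilityMeasure Θ}
    (hG : G ∈ 𝒬B) : A.payoff 𝒬B s θ b ≤
      ∫ θ', ((θ : ℝ) * (A.x b (s θ') : ℝ) - (A.τ b (s θ') : ℝ)) ∂(G : Measure Θ) :=
  worstExp_le (fun x => hA.abs_payoff_le θ b (s x)) hG

theorem winProb_le (hA : A.IsStandard) (s : Θ → ℝ≥0) (θ : Θ) {G : ProbabilityMeasure Θ}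
    (hG : G ∈ 𝒬B) : A.winProb 𝒬B s θ ≤ ∫ θ', (A.x (s θ) (s θ') : ℝ) ∂(G : Measure Θ) :=
  worstExp_le (fun x => hA.abs_x_le (s θ) (s x)) hG

theorem winProb_nonneg (hne : 𝒬B.Nonempty) (A : Auction) (s : Θ → ℝ≥0) (θ : Θ) :
    0 ≤ A.winProb 𝒬B s θ :=
  le_worstExp hne fun _ _ => integral_nonneg fun _ => NNReal.coe_nonneg _

/-- The payoff from a given bid increases in the type at least at the rate given by the worst-case
probability of winning. -/
theorem payoff_add_le (hA : A.IsStandard) (hne : 𝒬B.Nonempty) (hs : Measurable s) {a θ : Θ}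
    (haθ : a ≤ θ) : A.payoff 𝒬B s a (s a) + (θ - a) * A.winProb 𝒬B s a ≤
      A.payoff 𝒬B s θ (s a) := by
  refine le_worstExp hne fun G hG => ?_
  have h1 := hA.payoff_le s a (s a) hG
  have h2 := hA.winProb_le s a hG
  have h3 : (0 : ℝ) ≤ θ - a := sub_nonneg.2 haθ
  have hi := integrable_of_abs_le (G := (G : Measure Θ)) (hA.measurable_payoff hs a (s a))
    fun x => hA.abs_payoff_le a (s a) (s x)
  have hx := (integrable_of_abs_le (G := (G : Measure Θ)) (hA.measurable_x hs (s a))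
    fun x => hA.abs_x_le (s a) (s x)).const_mul ((θ : ℝ) - a)
  calc _ ≤ _ := add_le_add h1 (mul_le_mul_of_nonneg_left h2 h3)
    _ = ∫ θ', (((a : ℝ) * (A.x (s a) (s θ') : ℝ) - (A.τ (s a) (s θ') : ℝ)) +
          ((θ : ℝ) - a) * (A.x (s a) (s θ') : ℝ)) ∂(G : Measure Θ) := by
        rw [integral_add hi hx, integral_const_mul]
    _ = _ := by congr 1; ext x; ring

theorem payoff_zero_nonneg (hA : A.IsStandard) (hne : 𝒬B.Nonempty) (s : Θ → ℝ≥0) (θ : Θ) :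
    0 ≤ A.payoff 𝒬B s θ 0 := by
  refine le_worstExp hne fun G hG => integral_nonneg fun x => ?_
  have : A.τ 0 (s x) = 0 := le_antisymm (hA.τ_le 0 _) zero_le
  simp only [this, NNReal.coe_zero, sub_zero, Pi.zero_apply]
  exact mul_nonneg θ.2.1 (NNReal.coe_nonneg _)

end Auction.IsStandard

namespace Auction.IsEquilibrium

theorem measurable (hs : A.IsEquilibrium 𝒬B s) : Measurable s := measurable_of_monotoneOn_Iio hs.1

theorem payoff_nonneg (hs : A.IsEquilibrium 𝒬B s) (hA : A.IsStandard) (hne : 𝒬B.Nonempty) {θ : Θ}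
    (hθ : θ < 1) : 0 ≤ A.payoff 𝒬B s θ (s θ) :=
  (hA.payoff_zero_nonneg hne s θ).trans (hs.2 θ hθ 0)

/-- Type θ can imitate a lower type a, whose bid is worth more to θ by at least (θ - a) times the
worst-case winning probability of a. Accumulating these gains from the nonnegative payoff of type 0
yields the rent. -/
theorem rent_le (hs : A.IsEquilibrium 𝒬B s) (hA : A.IsStandard) (hne : 𝒬B.Nonempty)
    (hw : ∀ θ : Θ, θ < 1 → worstCDF 𝒬B θ ≤ A.winProb 𝒬B s θ) {θ : Θ} (hθ : θ < 1) :
    rent 𝒬B θ ≤ A.payoff 𝒬B s θ (s θ) := by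
  refine rent_le_of_increments hne (V := fun θ => A.payoff 𝒬B s θ (s θ))
    (hs.payoff_nonneg hA hne zero_lt_one) (fun a θ haθ hθ => ?_) hθ
  refine le_trans ?_ ((hA.payoff_add_le hne hs.measurable haθ).trans (hs.2 θ hθ (s a)))
  have h3 : (0 : ℝ) ≤ θ - a := sub_nonneg.2 haθ
  have := mul_le_mul_of_nonneg_left (hw a (haθ.trans_lt hθ)) h3
  linarith

end Auction.IsEquilibrium

/-- If a bidder who ties with positive probability could win all ties at no cost and does not
gain by doing so, then she may lose for sure. -/
theorem IsBidderModel.exists_measure_le_lt {F : ProbabilityMeasure Θ} (hM : IsBidderModel F 𝒬B)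
    (hs : MonotoneOn s (Iio 1)) {b : ℝ≥0} (hE : (F : Measure Θ) {θ' | s θ' = b} ≠ 0) {h : Θ → ℝ}
    (hm : Measurable h) (hanti : AntitoneOn h (Iio 1)) {C : ℝ} (hC : ∀ x, |h x| ≤ C) {κ : ℝ}
    (hκ : 0 < κ)
    (hle : worstExp 𝒬B h ≤ worstExp 𝒬B fun θ' => h θ' - κ * if s θ' = b then 1 else 0)
    {δ : ℝ} (hδ : 0 < δ) : ∃ G ∈ 𝒬B, (G : Measure Θ).real {θ' | s θ' ≤ b} < δ := by
  have hsm := measurable_of_monotoneOn_Iio hs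
  have hEm : MeasurableSet {θ' | s θ' = b} := hsm (measurableSet_singleton b)
  have hLm : MeasurableSet {θ' | s θ' ≤ b} := hsm measurableSet_Iic
  set p := (F : Measure Θ).real {θ' | s θ' = b} with hp
  have hp0 : 0 < p := ENNReal.toReal_pos hE (measure_ne_top _ _)
  -- The slack κ δ p is chosen so that a prior this close to the worst case of h must give the tie
  -- less than δ p. Making its density increasing preserves closeness because h is decreasing.
  obtain ⟨G, hG, hlt⟩ := exists_integral_lt (c := worstExp 𝒬B h + κ * (δ * p)) hM.nonempty
    (h := h) (by have := mul_pos hκ (mul_pos hδ hp0); linarith)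
  obtain ⟨G', hG', f, hf, hd, hle'⟩ := hM.exists_monotone_density hG
  refine ⟨G', hG', ?_⟩
  have h1 := hle' h hm hanti C hC
  have hint : ∫ x, (if s x = b then (1 : ℝ) else 0) ∂(G' : Measure Θ) =
      (G' : Measure Θ).real {θ' | s θ' = b} := by
    rw [← integral_indicator_one hEm]
    refine integral_congr_ae (ae_of_all _ fun x => ?_)
    by_cases hx : s x = b
    · simp [hx]
    · simp [hx]
  have hCE : ∀ x, |(if s x = b then (1 : ℝ) else 0)| ≤ 1 := fun x => by split_ifs <;> simp
  have hEm' : Measurable fun x => if s x = b then (1 : ℝ) else 0 :=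
    Measurable.ite hEm measurable_const measurable_const
  have h2 : worstExp 𝒬B (fun θ' => h θ' - κ * if s θ' = b then 1 else 0) ≤
      ∫ x, h x ∂(G' : Measure Θ) - κ * (G' : Measure Θ).real {θ' | s θ' = b} := by
    rw [← hint, ← integral_const_mul, ← integral_sub (integrable_of_abs_le hm hC)
      ((integrable_of_abs_le hEm' hCE).const_mul κ)]
    refine worstExp_le (C := C + κ) (fun x => (abs_sub _ _).trans ?_) hG'
    refine add_le_add (hC x) ?_
    rw [abs_mul, abs_of_pos hκ]
    exact mul_le_of_le_one_right hκ.le (hCE x)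
  have h3 : (G' : Measure Θ).real {θ' | s θ' = b} < δ * p := by
    refine lt_of_mul_lt_mul_left ?_ hκ.le
    linarith
  -- The tie occupies the top of {s ≤ b}. An increasing density gives it at least its reference
  -- share, so a small tie probability forces the whole set to have small probability.
  have h4 := hM.mul_measure_le hf.measurable hEm hLm
    (fun x hx => le_of_eq (show s x = b from hx)) (fun x hx y hy hx1 hy1 => hf (by
      refine le_of_not_ge fun hxy => hy.2 (le_antisymm hy.1 ?_)
      exact (show s x = b from hx).symm.le.trans (hs hx1 hy1 hxy)))
  rw [← hd] at h4
  have h5 := ENNReal.toReal_mono (by finiteness) h4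
  rw [ENNReal.toReal_mul, ENNReal.toReal_mul] at h5
  have h6 : (F : Measure Θ).real {θ' | s θ' ≤ b} ≤ 1 := measureReal_le_one
  have h7 : (G' : Measure Θ).real {θ' | s θ' ≤ b} * p ≤
      (G' : Measure Θ).real {θ' | s θ' = b} * 1 :=
    h5.trans (mul_le_mul_of_nonneg_left h6 measureReal_nonneg)
  exact lt_of_mul_lt_mul_right (by linarith) hp0.le

/-- A deviation that is nearly as good as `h` state by state bounds the worst case of `h`. -/
theorem worstExp_le_of_deviations (hA : A.IsStandard) (hne : 𝒬B.Nonempty) (hs : Measurable s)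
    {θ : Θ} {v : ℝ} (hv : ∀ b, A.payoff 𝒬B s θ b ≤ v) {h : Θ → ℝ} (hm : Measurable h) {C : ℝ}
    (hC : ∀ x, |h x| ≤ C)
    (hdev : ∀ ε > 0, ∃ b, ∀ θ',
      h θ' - ε ≤ (θ : ℝ) * (A.x b (s θ') : ℝ) - (A.τ b (s θ') : ℝ)) : worstExp 𝒬B h ≤ v := by
  refine le_of_forall_pos_le_add fun ε hε => ?_
  obtain ⟨b, hb⟩ := hdev ε hε
  rw [← sub_le_iff_le_add]
  refine le_trans (le_worstExp hne fun G hG => ?_) (hv b)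
  refine (sub_le_sub_right (worstExp_le hC hG) ε).trans ?_
  have hi := integrable_of_abs_le (G := (G : Measure Θ)) hm hC
  have e : ∫ x, h x ∂(G : Measure Θ) - ε = ∫ x, (h x - ε) ∂(G : Measure Θ) := by
    rw [integral_sub hi (integrable_const ε)]
    simp
  rw [e]
  exact integral_mono (hi.sub (integrable_const ε)) (integrable_of_abs_le
    (hA.measurable_payoff hs θ b) fun x => hA.abs_payoff_le θ b (s x)) hb

/-- Without relevant ties, the worst-case probability of winning is the worst-case probability that
the competitor's type is lower. -/
theorem winProb_eq_worstCDF {F : ProbabilityMeasure Θ} (hM : IsBidderModel F 𝒬B)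
    (hA : A.IsStandard) (hs : MonotoneOn s (Iio 1)) {θ : Θ} (hθ : θ < 1)
    (htie : (F : Measure Θ) {θ' | s θ' = s θ} ≠ 0 → ∀ δ > 0, ∃ G ∈ 𝒬B,
      (G : Measure Θ).real {θ' | s θ' ≤ s θ} < δ) :
    A.winProb 𝒬B s θ = worstCDF 𝒬B θ := by
  have hsm := measurable_of_monotoneOn_Iio hs
  by_cases hE : (F : Measure Θ) {θ' | s θ' = s θ} = 0
  · refine iInf_congr fun G => ?_
    rw [← integral_indicator_one (measurableSet_coe_lt θ)]
    refine integral_congr_ae ?_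
    have h1 : ∀ᵐ x ∂((G : ProbabilityMeasure Θ) : Measure Θ), x ∈ Iio (1 : Θ) :=
      hM.prior_ac G.2 hM.measure_compl_Iio_one
    have h2 : ∀ᵐ x ∂((G : ProbabilityMeasure Θ) : Measure Θ), s x ≠ s θ :=
      measure_mono_null (fun x hx => not_not.1 hx) (hM.prior_ac G.2 hE)
    filter_upwards [h1, h2] with x hx1 hx2
    rw [hA.x_eq]
    rcases lt_or_ge x θ with h | h
    · have hlt : s x < s θ := lt_of_le_of_ne (hs hx1 hθ h.le) hx2
      have hmem : x ∈ {θ' : Θ | (θ' : ℝ) < θ} := h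
      rw [indicator_of_mem hmem]
      simp [highestBidWins, hlt]
    · have hlt : s θ < s x := lt_of_le_of_ne (hs hθ hx1 h) hx2.symm
      have hmem : x ∉ {θ' : Θ | (θ' : ℝ) < θ} := not_lt.2 h
      rw [indicator_of_notMem hmem]
      simp [highestBidWins, hlt.not_gt, hlt.ne]
  -- With a relevant tie both quantities are zero, because some priors make {s ≤ s θ} arbitrarily
  -- unlikely.
  · have key : ∀ δ > 0, A.winProb 𝒬B s θ < δ ∧ worstCDF 𝒬B θ < δ := by
      intro δ hδ
      obtain ⟨G, hG, hlt⟩ := htie hE δ hδ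
      refine ⟨lt_of_le_of_lt ((hA.winProb_le s θ hG).trans ?_) hlt,
        lt_of_le_of_lt ((worstCDF_le hG θ).trans ?_) hlt⟩
      · have hLm : MeasurableSet {θ' | s θ' ≤ s θ} := hsm measurableSet_Iic
        rw [← integral_indicator_one hLm]
        refine integral_mono (integrable_of_abs_le (hA.measurable_x hsm (s θ))
          fun x => hA.abs_x_le (s θ) (s x)) ?_ fun x => ?_
        · exact (integrable_const (1 : ℝ)).indicator hLm
        · by_cases hx : x ∈ {θ' | s θ' ≤ s θ}
          · simp only [indicator_of_mem hx]
            exact (abs_le.1 (hA.abs_x_le _ _)).2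
          · have hlt : s θ < s x := lt_of_not_ge hx
            simp [indicator_of_notMem hx, hA.x_eq, highestBidWins, hlt.not_gt, hlt.ne]
      · refine ENNReal.toReal_mono (measure_ne_top _ _) (measure_mono fun x hx => ?_)
        exact hs (lt_trans (show x < θ from hx) hθ) hθ (show x < θ from hx).le
    have h1 := Auction.IsStandard.winProb_nonneg hM.nonempty A s θ
    have h2 := worstCDF_nonneg 𝒬B θ
    refine le_antisymm (le_of_forall_pos_le_add fun δ hδ => ?_)
      (le_of_forall_pos_le_add fun δ hδ => ?_)
    · linarith [(key δ hδ).1]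
    · linarith [(key δ hδ).2]

end Equilibrium

/-! ### Necessary conditions on equilibrium bids and payments. -/

section EquilibriumBids

variable {A : Auction} {F : ProbabilityMeasure Θ} {𝒬B : Set (ProbabilityMeasure Θ)} {s : Θ → ℝ≥0}

/-- Some prior in every rearrangement class gives a set at least its reference probability. -/
theorem IsBidderModel.exists_measure_ge (hM : IsBidderModel F 𝒬B) {G : ProbabilityMeasure Θ}
    (hG : G ∈ 𝒬B) {Z : Θ → ℝ} (hZ : Measurable Z) (hinj : Function.Injective Z) {A : Set Θ}
    (hA : MeasurableSet A) (hAZ : ∀ x ∈ A, ∀ y ∉ A, x < 1 → y < 1 → Z x ≤ Z y) :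
    ∃ G' ∈ 𝒬B, (F : Measure Θ).real A ≤ (G' : Measure Θ).real A ∧
      ∀ X : Θ → ℝ, Measurable X → (∀ x < 1, ∀ y < 1, X x < X y → Z x ≤ Z y) →
        ∀ C, (∀ x, |X x| ≤ C) → ∫ x, X x ∂(G' : Measure Θ) ≤ ∫ x, X x ∂(G : Measure Θ) := by
  obtain ⟨G', hG', D, hD, hd, h⟩ := hM.exists_ranked_density hG hZ hinj
  refine ⟨G', hG', ?_, h⟩
  have h1 := hM.mul_measure_le (hD.measurable.comp hZ) hA MeasurableSet.univ (subset_univ A)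
    (fun x hx y hy hx1 hy1 => hD (hAZ x hx y hy.2 hx1 hy1))
  have hd' : (G' : Measure Θ) = (F : Measure Θ).withDensity (D ∘ Z) := hd
  rw [← hd', measure_univ, measure_univ, one_mul, mul_one] at h1
  exact ENNReal.toReal_mono (measure_ne_top _ _) h1

theorem IsBidderModel.measure_Iio_ne_zero (hM : IsBidderModel F 𝒬B) {θ : Θ} (hθ : 0 < θ) :
    (F : Measure Θ) (Iio θ) ≠ 0 := fun h =>
  hM.measure_Ioo_ne_zero hθ (measure_mono_null (fun _ hx => hx.2) h)

/-- In an equilibrium of an auction in which raising the bid costs at most as much as the increase,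
relevant ties do not occur. -/
theorem Auction.IsEquilibrium.winProb_eq (hs : A.IsEquilibrium 𝒬B s) (hM : IsBidderModel F 𝒬B)
    (hA : A.IsStandard) (hmono : ∀ b, Monotone (A.τ b))
    (hlip : ∀ b ε b', A.τ (b + ε) b' ≤ A.τ b b' + ε) {θ : Θ} (h0 : 0 < θ) (h1 : θ < 1) :
    A.winProb 𝒬B s θ = worstCDF 𝒬B θ := by
  refine winProb_eq_worstCDF hM hA hs.1 h1 fun hE δ hδ => ?_
  have hsm := hs.measurable
  have hθ0 : (0 : ℝ) < θ := h0
  have hLm : MeasurableSet {θ' | s θ' ≤ s θ} := hsm measurableSet_Iic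
  -- This would be the payoff if all ties were won at no extra cost. Overbids by ε come within ε of
  -- it in every state, while the actual bid falls short by θ / 2 exactly at ties.
  let h : Θ → ℝ := fun θ' => (θ : ℝ) * (if s θ' ≤ s θ then 1 else 0) - (A.τ (s θ) (s θ') : ℝ)
  have hm : Measurable h := ((Measurable.ite hLm measurable_const measurable_const).const_mul _).sub
    ((hA.measurable_τ _).comp hsm).coe_nnreal_real
  have hC : ∀ x, |h x| ≤ 1 + s θ := fun x => by
    have h2 : (A.τ (s θ) (s x) : ℝ) ≤ s θ := by exact_mod_cast hA.τ_le _ _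
    have h3 : (0 : ℝ) ≤ A.τ (s θ) (s x) := NNReal.coe_nonneg _
    have h4 : (θ : ℝ) ≤ 1 := θ.2.2
    simp only [h]
    rw [abs_le]
    split_ifs <;> constructor <;> linarith
  refine hM.exists_measure_le_lt hs.1 hE hm ?_ hC (κ := θ / 2) (by positivity) ?_ hδ
  · intro x hx y hy hxy
    have hsxy := hs.1 hx hy hxy
    have h2 : (A.τ (s θ) (s x) : ℝ) ≤ A.τ (s θ) (s y) := by exact_mod_cast hmono (s θ) hsxy
    simp only [h]
    by_cases hy' : s y ≤ s θ
    · rw [if_pos hy', if_pos (hsxy.trans hy')]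
      linarith
    · rw [if_neg hy']
      split_ifs <;> linarith
  · refine (worstExp_le_of_deviations hA hM.nonempty hsm (hs.2 θ h1) hm hC
      fun ε hε => ⟨s θ + ε.toNNReal, fun θ' => ?_⟩).trans (le_of_eq ?_)
    · have hpos : (0 : ℝ≥0) < ε.toNNReal := Real.toNNReal_pos.2 hε
      have h2 : (A.τ (s θ + ε.toNNReal) (s θ') : ℝ) ≤ A.τ (s θ) (s θ') + ε := by
        have := hlip (s θ) ε.toNNReal (s θ')
        rw [← NNReal.coe_le_coe, NNReal.coe_add, Real.coe_toNNReal _ hε.le] at this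
        exact this
      simp only [h]
      split_ifs with hle
      · have hlt : s θ' < s θ + ε.toNNReal := lt_of_le_of_lt hle (lt_add_of_pos_right _ hpos)
        have hx : A.x (s θ + ε.toNNReal) (s θ') = 1 := by
          rw [hA.x_eq]; simp [highestBidWins, hlt]
        rw [hx, NNReal.coe_one]
        linarith
      · have : 0 ≤ (θ : ℝ) * (A.x (s θ + ε.toNNReal) (s θ') : ℝ) :=
          mul_nonneg hθ0.le (NNReal.coe_nonneg _)
        linarith
    · refine congrArg (worstExp 𝒬B) (funext fun θ' => ?_)
      rw [hA.x_eq, coe_highestBidWins]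
      simp only [h]
      ring

/-! #### The all-pay auction -/

/-- The payment is certain, so ambiguity affects only the probability of winning. -/
theorem allPay_payoff (hne : 𝒬B.Nonempty) (hs : Measurable s) (θ : Θ) (b : ℝ≥0) :
    allPay.payoff 𝒬B s θ b =
      θ * worstExp 𝒬B (fun θ' => (highestBidWins b (s θ') : ℝ)) - b := by
  have hi : ∀ G : ProbabilityMeasure Θ, ∫ θ', ((θ : ℝ) * (allPay.x b (s θ') : ℝ) -
      (allPay.τ b (s θ') : ℝ)) ∂(G : Measure Θ) =
      θ * ∫ θ', (highestBidWins b (s θ') : ℝ) ∂(G : Measure Θ) - b := fun G => by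
    change ∫ θ', ((θ : ℝ) * (highestBidWins b (s θ') : ℝ) - (b : ℝ)) ∂(G : Measure Θ) = _
    have hx : Integrable (fun θ' => (θ : ℝ) * (highestBidWins b (s θ') : ℝ)) (G : Measure Θ) :=
      (integrable_of_abs_le (isStandard_allPay.measurable_x hs b)
        fun x => isStandard_allPay.abs_x_le b (s x)).const_mul _
    rw [integral_sub hx (integrable_const _), integral_const_mul]
    simp
  refine le_antisymm ?_ (le_worstExp hne fun G hG => ?_)
  · rw [le_sub_iff_add_le, worstExp, Real.mul_iInf_of_nonneg θ.2.1]
    have := hne.to_subtype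
    refine le_ciInf fun G => ?_
    rw [← le_sub_iff_add_le, ← hi]
    exact isStandard_allPay.payoff_le s θ b G.2
  · rw [hi]
    exact sub_le_sub_right (mul_le_mul_of_nonneg_left
      (worstExp_le (fun x => isStandard_allPay.abs_x_le b (s x)) hG) θ.2.1) _

theorem allPay_winProb_eq (hM : IsBidderModel F 𝒬B) (hs : allPay.IsEquilibrium 𝒬B s) {θ : Θ}
    (h0 : 0 < θ) (h1 : θ < 1) : allPay.winProb 𝒬B s θ = worstCDF 𝒬B θ :=
  hs.winProb_eq hM isStandard_allPay (fun _ => monotone_const) (fun _ _ _ => le_rfl) h0 h1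

/-- Extends the bound to type 0, whose ties are not controlled: there w vanishes. -/
theorem worstCDF_le_winProb (hne : 𝒬B.Nonempty)
    (h : ∀ θ : Θ, 0 < θ → θ < 1 → A.winProb 𝒬B s θ = worstCDF 𝒬B θ) {θ : Θ} (hθ : θ < 1) :
    worstCDF 𝒬B θ ≤ A.winProb 𝒬B s θ := by
  rcases (unitInterval.nonneg' (t := θ)).eq_or_lt with rfl | h0
  · have : worstCDF 𝒬B ((0 : Θ) : ℝ) = 0 := worstCDF_zero hne
    rw [this]
    exact Auction.IsStandard.winProb_nonneg hne A s 0
  · exact (h θ h0 hθ).symm.le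

/-- The all-pay auction has only one equilibrium, up to the bids of the extreme types. -/
theorem allPay_bid_eq (hM : IsBidderModel F 𝒬B) (hs : allPay.IsEquilibrium 𝒬B s) {θ : Θ}
    (h0 : 0 < θ) (h1 : θ < 1) : (s θ : ℝ) = θ * worstCDF 𝒬B θ - rent 𝒬B θ := by
  have hsm := hs.measurable
  have hw := fun (θ : Θ) (h0 : 0 < θ) (h1 : θ < 1) => allPay_winProb_eq hM hs h0 h1
  have hV : allPay.payoff 𝒬B s θ (s θ) = θ * worstCDF 𝒬B θ - s θ := by
    rw [allPay_payoff hM.nonempty hsm, ← hw θ h0 h1]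
    rfl
  have hle := hs.rent_le isStandard_allPay hM.nonempty
    (fun θ hθ => worstCDF_le_winProb hM.nonempty hw hθ) h1
  have hge := le_rent_of_increments hM.nonempty (V := fun θ => allPay.payoff 𝒬B s θ (s θ)) (by
      rw [allPay_payoff hM.nonempty hsm]
      simp) (fun a θ haθ h0 h1 => by
      -- Downward imitation: since the payoff is affine in the type for a fixed bid, type a bidding
      -- as θ obtains the payoff of θ less (θ - a) w(θ).
      have h2 := hs.2 a (haθ.trans_lt h1) (s θ)
      refine le_trans (le_of_eq ?_) (add_le_add_left h2 _)
      rw [allPay_payoff hM.nonempty hsm, allPay_payoff hM.nonempty hsm, ← hw θ h0 h1]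
      change _ = _ + ((θ : ℝ) - a) * worstExp 𝒬B fun θ' => (highestBidWins (s θ) (s θ') : ℝ)
      ring) h1
  simp only [hV] at hle hge
  linarith

/-! #### The war of attrition -/

/-- Under the reference belief, expected payments in the war of attrition are at most those in the
all-pay auction. -/
theorem warOfAttrition_lintegral_min_le (hM : IsBidderModel F 𝒬B)
    (hs : warOfAttrition.IsEquilibrium 𝒬B s) {θ : Θ} (h0 : 0 < θ) (h1 : θ < 1) :
    ∫⁻ θ', (min (s θ) (s θ') : ℝ≥0) ∂(F : Measure Θ) ≤
      ENNReal.ofReal (θ * worstCDF 𝒬B θ - rent 𝒬B θ) := by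
  have hsm := hs.measurable
  have hA := isStandard_warOfAttrition
  have hw : ∀ θ : Θ, 0 < θ → θ < 1 → warOfAttrition.winProb 𝒬B s θ = worstCDF 𝒬B θ :=
    fun θ h0 h1 => hs.winProb_eq hM hA (fun b x y hxy => by
      rw [warOfAttrition_τ, warOfAttrition_τ]
      exact min_le_min_left b hxy) (fun b ε b' => by
      rw [warOfAttrition_τ, warOfAttrition_τ]
      rcases le_total b b' with h | h
      · rw [min_eq_left h]
        exact min_le_left _ _
      · rw [min_eq_right h]
        exact (min_le_right _ _).trans le_self_add) h0 h1
  have hle := hs.rent_le hA hM.nonempty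
    (fun θ hθ => worstCDF_le_winProb hM.nonempty hw hθ) h1
  refine ENNReal.le_of_forall_pos_le_add fun δ hδ _ => ?_
  have hx : ∀ x, |(warOfAttrition.x (s θ) (s x) : ℝ)| ≤ 1 := fun x => hA.abs_x_le _ _
  have hxm := hA.measurable_x hsm (s θ)
  obtain ⟨G, hG, hlt⟩ := exists_integral_lt (c := worstCDF 𝒬B θ + δ) hM.nonempty
    (h := fun θ' => (warOfAttrition.x (s θ) (s θ') : ℝ)) (by
      have : (0 : ℝ) < δ := hδ
      change warOfAttrition.winProb 𝒬B s θ < _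
      rw [hw θ h0 h1]
      linarith)
  -- G' nearly minimises the probability of winning. Evaluated at G', the lower bound R(θ) on the
  -- payoff turns into an upper bound on the expected payment.
  obtain ⟨G', hG', f, hf, hd, hmin⟩ := hM.exists_monotone_density hG
  have hx1 := (hmin _ hxm (fun x hx y hy hxy => by
    exact_mod_cast antitone_highestBidWins (s θ) (hs.1 hx hy hxy)) 1 hx).trans_lt hlt
  have hmm : Measurable fun θ' => min (s θ) (s θ') := measurable_const.min hsm
  have h2 := hA.payoff_le s θ (s θ) hG'
  have hi := integrable_of_abs_le (G := (G' : Measure Θ)) hxm hx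
  have hmi : Integrable (fun θ' => ((min (s θ) (s θ') : ℝ≥0) : ℝ)) (G' : Measure Θ) :=
    integrable_of_abs_le hmm.coe_nnreal_real (C := s θ) fun x => by
      rw [abs_of_nonneg (NNReal.coe_nonneg _)]
      exact_mod_cast min_le_left _ _
  simp only [warOfAttrition_τ] at h2
  rw [integral_sub (hi.const_mul _) hmi, integral_const_mul] at h2
  have h3 : ∫ θ', ((min (s θ) (s θ') : ℝ≥0) : ℝ) ∂(G' : Measure Θ) ≤
      θ * worstCDF 𝒬B θ - rent 𝒬B θ + δ := by
    have h4 : (θ : ℝ) * ∫ θ', (warOfAttrition.x (s θ) (s θ') : ℝ) ∂(G' : Measure Θ) ≤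
        θ * (worstCDF 𝒬B θ + δ) := mul_le_mul_of_nonneg_left hx1.le θ.2.1
    have h5 : (θ : ℝ) * δ ≤ δ := mul_le_of_le_one_left δ.2 θ.2.2
    linarith
  -- Payment and density of G' both increase in the competitor's type, so G' overstates the expected
  -- payment relative to F.
  have h4 : ∫⁻ θ', (min (s θ) (s θ') : ℝ≥0) ∂(F : Measure Θ) ≤
      ∫⁻ θ', (min (s θ) (s θ') : ℝ≥0) ∂(G' : Measure Θ) := by
    have hme : Measurable fun θ' => ((min (s θ) (s θ') : ℝ≥0) : ℝ≥0∞) := hmm.coe_nnreal_ennreal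
    have := mul_lintegral_le_lintegral_mul (μ := (F : Measure Θ)) hM.measure_compl_Iio_one
      hf.measurable hme (pairing_le_of_similar fun x hx y hy => by
        rcases le_total x y with hxy | hxy
        · exact Or.inl ⟨hf hxy, by exact_mod_cast min_le_min_left _ (hs.1 hx hy hxy)⟩
        · exact Or.inr ⟨hf hxy, by exact_mod_cast min_le_min_left _ (hs.1 hy hx hxy)⟩)
    have hf1 : ∫⁻ x, f x ∂(F : Measure Θ) = 1 := by
      rw [← setLIntegral_univ, ← withDensity_apply _ MeasurableSet.univ, ← hd, measure_univ]
    rw [hf1, one_mul, measure_univ, mul_one] at this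
    rw [hd, lintegral_withDensity_eq_lintegral_mul _ hf.measurable hme]
    exact this
  refine h4.trans ?_
  have h5 : ∫⁻ θ', (min (s θ) (s θ') : ℝ≥0) ∂(G' : Measure Θ) =
      ENNReal.ofReal (∫ θ', ((min (s θ) (s θ') : ℝ≥0) : ℝ) ∂(G' : Measure Θ)) := by
    rw [ofReal_integral_eq_lintegral_ofReal hmi (ae_of_all _ fun _ => NNReal.coe_nonneg _)]
    simp
  rw [h5, ← ENNReal.ofReal_coe_nnreal]
  exact (ENNReal.ofReal_le_ofReal h3).trans ENNReal.ofReal_add_le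

/-! #### The first-price auction -/

theorem firstPrice_integrand (θ : Θ) (b b' : ℝ≥0) :
    (θ : ℝ) * (firstPrice.x b b' : ℝ) - (firstPrice.τ b b' : ℝ) =
      (θ - b) * (highestBidWins b b' : ℝ) := by
  change (θ : ℝ) * (highestBidWins b b' : ℝ) - ((b * highestBidWins b b' : ℝ≥0) : ℝ) = _
  rw [NNReal.coe_mul]
  ring

theorem firstPrice_payoff {θ : Θ} {b : ℝ≥0} (hb : (b : ℝ) ≤ θ) :
    firstPrice.payoff 𝒬B s θ b =
      (θ - b) * worstExp 𝒬B (fun θ' => (highestBidWins b (s θ') : ℝ)) := by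
  rw [worstExp, Real.mul_iInf_of_nonneg (sub_nonneg.2 hb)]
  refine iInf_congr fun G => ?_
  simp only [firstPrice_integrand]
  rw [integral_const_mul]

/-- Some prior gives the types below θ positive probability, and against them the bid wins at least
half the time. A bid above θ would then have a negative expected payoff, whereas bidding 0
guarantees a nonnegative one. -/
theorem firstPrice_bid_le (hM : IsBidderModel F 𝒬B) (hs : firstPrice.IsEquilibrium 𝒬B s) {θ : Θ}
    (h0 : 0 < θ) (h1 : θ < 1) : (s θ : ℝ) ≤ θ := by
  by_contra! hlt
  obtain ⟨G, hG⟩ := hM.nonempty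
  obtain ⟨G', hG', hge, -⟩ := hM.exists_measure_ge hG measurable_subtype_coe
    Subtype.val_injective (measurableSet_Iio (a := θ))
    (fun x hx y hy _ _ => ((show x < θ from hx).trans_le (not_lt.1 hy)).le)
  have hpos : 0 < (F : Measure Θ).real (Iio θ) :=
    ENNReal.toReal_pos (hM.measure_Iio_ne_zero h0) (measure_ne_top _ _)
  have h2 := (hs.payoff_nonneg isStandard_firstPrice hM.nonempty h1).trans
    (isStandard_firstPrice.payoff_le s θ (s θ) hG')
  simp only [firstPrice_integrand] at h2
  rw [integral_const_mul] at h2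
  have h3 : 1 / 2 * (G' : Measure Θ).real (Iio θ) ≤
      ∫ θ', (highestBidWins (s θ) (s θ') : ℝ) ∂(G' : Measure Θ) := by
    rw [← integral_indicator_one measurableSet_Iio, ← integral_const_mul]
    refine integral_mono (((integrable_const (1 : ℝ)).indicator measurableSet_Iio).const_mul _)
      (integrable_of_abs_le (isStandard_firstPrice.measurable_x hs.measurable (s θ))
        fun x => isStandard_firstPrice.abs_x_le (s θ) (s x)) fun x => ?_
    by_cases hx : x ∈ Iio θ
    · have hle := hs.1 (lt_trans (show x < θ from hx) h1) h1 (show x < θ from hx).le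
      simp only [indicator_of_mem hx, coe_highestBidWins, if_pos hle]
      split_ifs <;> norm_num
    · simp [indicator_of_notMem hx]
  have : 0 < ∫ θ', (highestBidWins (s θ) (s θ') : ℝ) ∂(G' : Measure Θ) := by linarith
  nlinarith

theorem firstPrice_winProb_eq (hM : IsBidderModel F 𝒬B) (hs : firstPrice.IsEquilibrium 𝒬B s)
    {θ : Θ} (h1 : θ < 1) : firstPrice.winProb 𝒬B s θ = worstCDF 𝒬B θ := by
  have hA := isStandard_firstPrice
  refine winProb_eq_worstCDF hM hA hs.1 h1 fun hE δ hδ => ?_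
  have hsm := hs.measurable
  -- Type θ may bid its valuation and gain nothing from winning ties. But a tie of positive
  -- probability contains more than 0, 1 and the type equal to the bid, so some tied type η bids
  -- strictly below its valuation; its incentives are used instead.
  obtain ⟨η, hη, hη0, hη1, hηb⟩ : ∃ η : Θ, s η = s θ ∧ 0 < η ∧ η < 1 ∧ (s θ : ℝ) ≠ η := by
    by_contra! hcon
    refine hE (measure_mono_null (t := {0} ∪ ({1} ∪ {x : Θ | (x : ℝ) = s θ})) (fun x hx => ?_)
      (measure_union_null (hM.measure_singleton 0) (measure_union_null (hM.measure_singleton 1)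
        (hM.measure_subsingleton fun x hx y hy =>
          Subtype.ext ((show (x : ℝ) = s θ from hx).trans (show (y : ℝ) = s θ from hy).symm)))))
    rcases (unitInterval.nonneg' (t := x)).eq_or_lt with h0 | h0
    · exact Or.inl h0.symm
    rcases (unitInterval.le_one' (t := x)).eq_or_lt with h1 | h1
    · exact Or.inr (Or.inl h1)
    · exact Or.inr (Or.inr (hcon x hx h0 h1).symm)
  set b := s θ
  have hbη : (b : ℝ) < η := lt_of_le_of_ne (hη ▸ firstPrice_bid_le hM hs hη0 hη1) hηb
  have hκ : 0 < (η : ℝ) - b := sub_pos.2 hbη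
  have hLm : MeasurableSet {θ' | s θ' ≤ b} := hsm measurableSet_Iic
  let h : Θ → ℝ := fun θ' => ((η : ℝ) - b) * (if s θ' ≤ b then 1 else 0)
  have hm : Measurable h := (Measurable.ite hLm measurable_const measurable_const).const_mul _
  have hC : ∀ x, |h x| ≤ (η : ℝ) - b := fun x => by
    simp only [h]
    rw [abs_of_nonneg (mul_nonneg hκ.le (by split_ifs <;> simp))]
    exact mul_le_of_le_one_right hκ.le (by split_ifs <;> simp)
  refine hM.exists_measure_le_lt hs.1 hE hm ?_ hC (κ := ((η : ℝ) - b) / 2) (by positivity) ?_ hδ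
  · intro x hx y hy hxy
    have hsxy := hs.1 hx hy hxy
    refine mul_le_mul_of_nonneg_left ?_ hκ.le
    by_cases hy' : s y ≤ b
    · rw [if_pos hy', if_pos (hsxy.trans hy')]
    · rw [if_neg hy']
      split_ifs <;> simp
  -- The overbid is capped at η, so that winning additional states never causes a loss.
  · refine (worstExp_le_of_deviations hA hM.nonempty hsm (hs.2 η hη1) hm hC
      fun ε hε => ⟨b + (min ε (η - b)).toNNReal, fun θ' => ?_⟩).trans (le_of_eq ?_)
    · have hmin : 0 < min ε ((η : ℝ) - b) := lt_min hε hκ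
      have hpos : (0 : ℝ≥0) < (min ε ((η : ℝ) - b)).toNNReal := Real.toNNReal_pos.2 hmin
      rw [firstPrice_integrand, NNReal.coe_add, Real.coe_toNNReal _ hmin.le]
      have h2 := min_le_left ε ((η : ℝ) - b)
      have h3 := min_le_right ε ((η : ℝ) - b)
      simp only [h]
      split_ifs with hle
      · have hlt : s θ' < b + (min ε ((η : ℝ) - b)).toNNReal :=
          lt_of_le_of_lt hle (lt_add_of_pos_right _ hpos)
        have hx : highestBidWins (b + (min ε ((η : ℝ) - b)).toNNReal) (s θ') = 1 := by
          simp [highestBidWins, hlt]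
        rw [hx, NNReal.coe_one]
        linarith
      · have : 0 ≤ ((η : ℝ) - (b + min ε ((η : ℝ) - b))) *
            (highestBidWins (b + (min ε ((η : ℝ) - b)).toNNReal) (s θ') : ℝ) :=
          mul_nonneg (by linarith) (NNReal.coe_nonneg _)
        linarith
    · refine congrArg (worstExp 𝒬B) (funext fun θ' => ?_)
      rw [hη, firstPrice_integrand, coe_highestBidWins]
      simp only [h]
      ring

/-- A lower bound for equilibrium bids in the first-price auction. -/
theorem firstPrice_sub_bid_mul_le (hM : IsBidderModel F 𝒬B)
    (hs : firstPrice.IsEquilibrium 𝒬B s) {θ : Θ} (h0 : 0 < θ) (h1 : θ < 1) :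
    ((θ : ℝ) - s θ) * worstCDF 𝒬B θ ≤ rent 𝒬B θ := by
  have hA := isStandard_firstPrice
  have hV : ∀ θ : Θ, 0 < θ → θ < 1 →
      firstPrice.payoff 𝒬B s θ (s θ) = (θ - s θ) * worstCDF 𝒬B θ := fun θ h0 h1 => by
    rw [firstPrice_payoff (firstPrice_bid_le hM hs h0 h1), ← firstPrice_winProb_eq hM hs h1]
    rfl
  rw [← hV θ h0 h1]
  refine le_rent_of_increments hM.nonempty (V := fun θ => firstPrice.payoff 𝒬B s θ (s θ)) ?_ ?_ h1
  · obtain ⟨G, hG⟩ := hM.nonempty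
    refine (hA.payoff_le s 0 (s 0) hG).trans (integral_nonpos fun x => ?_)
    simp only [firstPrice_integrand]
    exact mul_nonpos_of_nonpos_of_nonneg (by simp) (NNReal.coe_nonneg _)
  · intro a θ haθ h0 h1
    have ha1 := haθ.trans_lt h1
    have hw := worstCDF_nonneg 𝒬B θ
    -- Type a can profitably imitate θ only if it can afford that bid. Otherwise θ earns at most θ -
    -- a per win, and the nonnegative payoff of a suffices.
    rcases le_total (s θ : ℝ) a with h | h
    · have h2 := hs.2 a ha1 (s θ)
      refine le_trans (le_of_eq ?_) (add_le_add_left h2 _)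
      rw [firstPrice_payoff h, hV θ h0 h1, ← firstPrice_winProb_eq hM hs h1]
      change _ = _ * firstPrice.winProb 𝒬B s θ + _
      ring
    · have h2 := hs.payoff_nonneg hA hM.nonempty ha1
      simp only [hV θ h0 h1]
      nlinarith

end EquilibriumBids

/-! ### Existence of equilibria, and the bound on second-price bids. -/

section Existence

variable {A : Auction} {F : ProbabilityMeasure Θ} {𝒬B : Set (ProbabilityMeasure Θ)} {s : Θ → ℝ≥0}

/-- The information rent is convex. -/
theorem tangent_le_rent (hne : 𝒬B.Nonempty) (t u : ℝ) :
    (u - t) * worstCDF 𝒬B t + rent 𝒬B t ≤ rent 𝒬B u := by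
  rcases le_total t u with h | h
  · linarith [le_rent_sub hne h]
  · linarith [rent_sub_le hne h]

theorem rent_le_mul (hne : 𝒬B.Nonempty) (t : ℝ) : rent 𝒬B t ≤ t * worstCDF 𝒬B t := by
  have := tangent_le_rent hne t 0
  rw [rent_zero] at this
  linarith

theorem rent_nonneg (hne : 𝒬B.Nonempty) (t : ℝ) : 0 ≤ rent 𝒬B t := by
  have := tangent_le_rent hne 0 t
  rwa [worstCDF_zero hne, rent_zero, mul_zero, add_zero] at this

theorem monotone_rent (hne : 𝒬B.Nonempty) : Monotone (rent 𝒬B) := fun a b hab => by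
  have := mul_nonneg (sub_nonneg.2 hab) (worstCDF_nonneg 𝒬B a)
  linarith [le_rent_sub hne hab]

/-- An inequality between the worst-case distribution function and the rent that holds to the left
of `t` extends to `t`. -/
theorem sub_mul_worstCDF_le (hne : 𝒬B.Nonempty) (hcpt : IsCompact 𝒬B) {t β γ : ℝ} (hβ : 0 ≤ β)
    (hγ : 0 ≤ γ)
    (h : ∀ r, 0 ≤ r → r < t → (r - β) * worstCDF 𝒬B r ≤ rent 𝒬B r + γ) :
    (t - β) * worstCDF 𝒬B t ≤ rent 𝒬B t + γ := by
  by_contra! hlt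
  have hR : 0 ≤ rent 𝒬B t + γ := add_nonneg (rent_nonneg hne t) hγ
  have hw0 := worstCDF_nonneg 𝒬B t
  have htβ : 0 < t - β := by
    by_contra! hle
    exact absurd (mul_nonpos_of_nonpos_of_nonneg hle hw0) (not_le.2 (hR.trans_lt hlt))
  obtain ⟨c, hc, hcw⟩ := exists_between ((div_lt_iff₀ htβ).2 (mul_comm (t - β) _ ▸ hlt))
  have hc0 : 0 < c := (div_nonneg hR htβ.le).trans_lt hc
  -- By left-continuity w exceeds c just below t. As c is larger than (R(t) + γ) / (t - β), any r
  -- close enough to t violates the assumed inequality.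
  obtain ⟨t', ht't, hct'⟩ := exists_lt_worstCDF hne hcpt hcw
  have h1 : β + (rent 𝒬B t + γ) / c < t := by
    have h3 := (div_lt_iff₀ htβ).1 hc
    have : (rent 𝒬B t + γ) / c < t - β := (div_lt_iff₀ hc0).2 (by linarith)
    linarith
  obtain ⟨r, hr, hrt⟩ := exists_between (max_lt ht't h1)
  have hr1 : t' < r := (le_max_left _ _).trans_lt hr
  have hr2 : (rent 𝒬B t + γ) / c < r - β := by
    linarith [(le_max_right t' (β + (rent 𝒬B t + γ) / c)).trans_lt hr]
  have hrβ : 0 < r - β := (div_nonneg hR hc0.le).trans_lt hr2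
  have h2 := h r (by linarith) hrt
  have h3 := (div_lt_iff₀ hc0).1 hr2
  have h4 : (r - β) * c ≤ (r - β) * worstCDF 𝒬B r :=
    mul_le_mul_of_nonneg_left (hct'.le.trans (monotone_worstCDF hne hr1.le)) hrβ.le
  linarith [monotone_rent hne hrt.le]

/-- The reference distribution has full support, so that the worst-case distribution function is
strictly increasing where it is positive. -/
theorem IsBidderModel.worstCDF_lt (hM : IsBidderModel F 𝒬B) {a b : Θ} (hab : a < b)
    (hb : 0 < worstCDF 𝒬B b) : worstCDF 𝒬B a < worstCDF 𝒬B b := by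
  have hab' : (a : ℝ) < b := hab
  have h := hM.worstCDF_mul_le hab'.le
  have hlt : (F : Measure Θ).real {θ' | (θ' : ℝ) < a} < (F : Measure Θ).real {θ' | (θ' : ℝ) < b} := by
    have hd : Disjoint {θ' : Θ | (θ' : ℝ) < a} (Ioo a b) :=
      disjoint_left.2 fun x hx hx' => lt_asymm (show x < a from hx) hx'.1
    have hpos : 0 < (F : Measure Θ).real (Ioo a b) :=
      ENNReal.toReal_pos (hM.measure_Ioo_ne_zero hab) (measure_ne_top _ _)
    have h2 : (F : Measure Θ).real ({θ' : Θ | (θ' : ℝ) < a} ∪ Ioo a b) ≤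
        (F : Measure Θ).real {θ' | (θ' : ℝ) < b} := by
      refine measureReal_mono (union_subset (fun x hx => ?_) fun x hx => ?_)
      · exact lt_trans (show (x : ℝ) < a from hx) hab'
      · exact hx.2
    rw [measureReal_union hd measurableSet_Ioo] at h2
    linarith
  have hF : 0 < (F : Measure Θ).real {θ' | (θ' : ℝ) < b} := measureReal_nonneg.trans_lt hlt
  exact lt_of_mul_lt_mul_right (h.trans_lt (mul_lt_mul_of_pos_left hlt hb)) hF.le

/-- Where the strategy is strictly increasing, lower types are beaten. -/
theorem IsBidderModel.worstCDF_le_winProb (hM : IsBidderModel F 𝒬B) (hA : A.IsStandard)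
    (hs : Measurable s) {θ : Θ} (h : ∀ θ', 0 < θ' → θ' < θ → s θ' < s θ) :
    worstCDF 𝒬B θ ≤ A.winProb 𝒬B s θ := by
  refine le_worstExp hM.nonempty fun G hG => (worstCDF_le hG θ).trans ?_
  rw [← integral_indicator_one (measurableSet_coe_lt θ)]
  refine integral_mono_ae ((integrable_const (1 : ℝ)).indicator (measurableSet_coe_lt θ))
    (integrable_of_abs_le (hA.measurable_x hs (s θ)) fun x => hA.abs_x_le (s θ) (s x)) ?_
  have h0 : ∀ᵐ x ∂(G : Measure Θ), x ≠ 0 :=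
    measure_mono_null (fun x hx => not_not.1 hx) (hM.prior_ac hG (hM.measure_singleton 0))
  filter_upwards [h0] with x hx0
  by_cases hx : x ∈ {θ' : Θ | (θ' : ℝ) < θ}
  · have hlt := h x (lt_of_le_of_ne unitInterval.nonneg' hx0.symm) hx
    rw [indicator_of_mem hx, hA.x_eq]
    simp [highestBidWins, hlt]
  · rw [indicator_of_notMem hx]
    exact NNReal.coe_nonneg _

/-- Every bid `b` corresponds to a type `t` such that lower types bid at most `b` and bidding `b`
is not more likely to win than beating all types below `t`. -/
theorem IsBidderModel.exists_type_of_bid (hM : IsBidderModel F 𝒬B) (hs : MonotoneOn s (Iio 1))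
    (b : ℝ≥0) : ∃ t : ℝ, 0 ≤ t ∧ t ≤ 1 ∧ (∀ θ' : Θ, (θ' : ℝ) < t → s θ' ≤ b) ∧
      worstExp 𝒬B (fun θ' => (highestBidWins b (s θ') : ℝ)) ≤ worstCDF 𝒬B t := by
  have hsm := measurable_of_monotoneOn_Iio hs
  -- The type t is the supremum of the types bidding at most b. If there are none, the convention
  -- that the supremum of the empty set is 0 gives the right value.
  set K : Set ℝ := {r | ∃ θ' : Θ, θ' < 1 ∧ s θ' ≤ b ∧ (θ' : ℝ) = r}
  have hK : BddAbove K := ⟨1, by rintro _ ⟨θ', _, _, rfl⟩; exact θ'.2.2⟩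
  have hK0 : 0 ≤ sSup K := Real.sSup_nonneg (by rintro _ ⟨θ', _, _, rfl⟩; exact θ'.2.1)
  refine ⟨sSup K, hK0, Real.sSup_le (by rintro _ ⟨θ', _, _, rfl⟩; exact θ'.2.2) zero_le_one, ?_,
    le_worstCDF hM.nonempty fun G hG => ?_⟩
  · intro θ' hθ'
    have hne : K.Nonempty := by
      by_contra hne
      rw [not_nonempty_iff_eq_empty] at hne
      rw [hne, Real.sSup_empty] at hθ'
      exact absurd θ'.2.1 (not_le.2 hθ')
    obtain ⟨_, ⟨θ'', h1, h2, rfl⟩, hlt⟩ := exists_lt_of_lt_csSup hne hθ'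
    have hlt' : θ' < θ'' := hlt
    exact (hs (hlt'.trans h1) h1 hlt'.le).trans h2
  · refine (worstExp_le (C := 1) (fun x => isStandard_allPay.abs_x_le b (s x)) hG).trans ?_
    have hKm := measurableSet_coe_lt (sSup K)
    rw [← integral_indicator_one hKm]
    refine integral_mono_ae (integrable_of_abs_le (isStandard_allPay.measurable_x hsm b)
      fun x => isStandard_allPay.abs_x_le b (s x))
      ((integrable_const (1 : ℝ)).indicator (measurableSet_coe_lt _)) ?_
    have h1 : ∀ᵐ x ∂(G : Measure Θ), x ∈ Iio (1 : Θ) := hM.prior_ac hG hM.measure_compl_Iio_one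
    have hKs : {x : Θ | (x : ℝ) = sSup K}.Subsingleton := fun x hx y hy =>
      Subtype.ext ((show (x : ℝ) = sSup K from hx).trans (show (y : ℝ) = sSup K from hy).symm)
    have h2 : ∀ᵐ x : Θ ∂(G : Measure Θ), (x : ℝ) ≠ sSup K :=
      measure_mono_null (fun x hx => not_not.1 hx)
        (hM.prior_ac hG (hM.measure_subsingleton hKs))
    filter_upwards [h1, h2] with x hx1 hx2
    by_cases hx : x ∈ {θ' : Θ | (θ' : ℝ) < sSup K}
    · rw [indicator_of_mem hx]
      exact (abs_le.1 (isStandard_allPay.abs_x_le b (s x))).2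
    · rw [indicator_of_notMem hx]
      have hlt : b < s x := by
        by_contra! hle
        exact hx (lt_of_le_of_ne (le_csSup hK ⟨x, hx1, hle, rfl⟩) hx2)
      have h0 : highestBidWins b (s x) = 0 := by simp [highestBidWins, hlt.not_gt, hlt.ne]
      exact le_of_eq (congrArg NNReal.toReal h0)

/-! #### The all-pay auction -/

/-- The bid θ w(θ) - R(θ) leaves type θ at least R(θ). A bid b with associated type t wins with
worst-case probability at most w(t) and satisfies t w(t) - R(t) ≤ b. Its payoff is therefore at most
R(t) + (θ - t) w(t), a tangent value that convexity bounds by R(θ). -/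
theorem exists_isEquilibrium_allPay (hM : IsBidderModel F 𝒬B) :
    ∃ s, allPay.IsEquilibrium 𝒬B s := by
  have hne := hM.nonempty
  have hcoe : ∀ θ : Θ, ((θ * worstCDF 𝒬B θ - rent 𝒬B θ).toNNReal : ℝ) =
      θ * worstCDF 𝒬B θ - rent 𝒬B θ := fun θ =>
    Real.coe_toNNReal _ (sub_nonneg.2 (rent_le_mul hne θ))
  set s : Θ → ℝ≥0 := fun θ => (θ * worstCDF 𝒬B θ - rent 𝒬B θ).toNNReal with hsdef
  have hdiff : ∀ a b : Θ, a ≤ b → a * (worstCDF 𝒬B b - worstCDF 𝒬B a) ≤ (s b : ℝ) - s a := by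
    intro a b hab
    have := rent_sub_le hne (show (a : ℝ) ≤ b from hab)
    simp only [hsdef, hcoe]
    linarith
  have hmono : Monotone s := fun a b hab => by
    have h1 := hdiff a b hab
    have h2 := mul_nonneg a.2.1 (sub_nonneg.2 (monotone_worstCDF hne (show (a : ℝ) ≤ b from hab)))
    rw [← NNReal.coe_le_coe]
    linarith
  have hw : ∀ θ : Θ, worstCDF 𝒬B θ ≤ allPay.winProb 𝒬B s θ := fun θ => by
    rcases (worstCDF_nonneg 𝒬B θ).eq_or_lt with h0 | h0
    · rw [← h0]
      exact Auction.IsStandard.winProb_nonneg hne _ s θ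
    refine hM.worstCDF_le_winProb isStandard_allPay hmono.measurable fun θ' h1 h2 => ?_
    have h3 := hdiff θ' θ h2.le
    have h4 := mul_pos (show (0 : ℝ) < θ' from h1) (sub_pos.2 (hM.worstCDF_lt h2 h0))
    rw [← NNReal.coe_lt_coe]
    linarith
  refine ⟨s, hmono.monotoneOn _, fun θ hθ b => ?_⟩
  obtain ⟨t, ht0, ht1, htb, hWt⟩ := hM.exists_type_of_bid (hmono.monotoneOn (Iio 1)) b
  rw [allPay_payoff hne hmono.measurable, allPay_payoff hne hmono.measurable]
  have h1 := sub_mul_worstCDF_le hne hM.compact le_rfl (NNReal.coe_nonneg b) (fun r hr0 hrt => by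
    have h2 := htb ⟨r, hr0, (hrt.le.trans ht1)⟩ hrt
    rw [← NNReal.coe_le_coe, hcoe] at h2
    simp only at h2
    rw [sub_zero]
    linarith)
  rw [sub_zero] at h1
  have h2 := mul_le_mul_of_nonneg_left hWt θ.2.1
  have h3 := mul_le_mul_of_nonneg_left (hw θ) θ.2.1
  have h4 := tangent_le_rent hne t θ
  have h5 : (s θ : ℝ) = θ * worstCDF 𝒬B θ - rent 𝒬B θ := hcoe θ
  change _ ≤ θ * allPay.winProb 𝒬B s θ - s θ
  linarith

/-! #### The first-price auction -/

/-- The bid solves (θ - s) w = R. A deviation b ≤ θ with associated type t satisfies (t - b) w(t) ≤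
R(t), so it earns at most the tangent value R(t) + (θ - t) w(t) ≤ R(θ); bids above θ earn at most
zero. -/
theorem exists_isEquilibrium_firstPrice (hM : IsBidderModel F 𝒬B) :
    ∃ s, firstPrice.IsEquilibrium 𝒬B s ∧ firstPrice.BidsValueIfHopeless 𝒬B s := by
  have hne := hM.nonempty
  -- this formula gives the bid `θ` if the worst-case winning probability is zero
  set s : Θ → ℝ≥0 := fun θ => (θ - rent 𝒬B θ / worstCDF 𝒬B θ).toNNReal with hsdef
  have hcoe : ∀ θ : Θ, (s θ : ℝ) = θ - rent 𝒬B θ / worstCDF 𝒬B θ := fun θ => by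
    refine Real.coe_toNNReal _ (sub_nonneg.2 ?_)
    exact div_le_of_le_mul₀ (worstCDF_nonneg _ _) θ.2.1 (rent_le_mul hne θ)
  have hkey : ∀ θ : Θ, ((θ : ℝ) - s θ) * worstCDF 𝒬B θ = rent 𝒬B θ := fun θ => by
    rw [hcoe]
    rcases (worstCDF_nonneg 𝒬B θ).eq_or_lt with h0 | h0
    · have h1 := rent_le_mul hne θ
      have h2 := rent_nonneg hne θ
      rw [← h0] at h1 ⊢
      linarith
    · field_simp
      ring
  have hle : ∀ θ : Θ, (s θ : ℝ) ≤ θ := fun θ => by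
    rw [hcoe]
    linarith [div_nonneg (rent_nonneg hne θ) (worstCDF_nonneg 𝒬B θ)]
  have hdiff : ∀ a b : Θ, a ≤ b → 0 < worstCDF 𝒬B b →
      ((b : ℝ) - a) * worstCDF 𝒬B b - (rent 𝒬B b - rent 𝒬B a) ≤ ((s b : ℝ) - s a) * worstCDF 𝒬B b := by
    intro a b hab hb
    have h1 := hkey b
    have h2 : ((a : ℝ) - s a) * worstCDF 𝒬B b ≥ rent 𝒬B a := by
      rw [← hkey a]
      exact mul_le_mul_of_nonneg_left (monotone_worstCDF hne (show (a : ℝ) ≤ b from hab))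
        (sub_nonneg.2 (hle a))
    linarith
  have hmono : Monotone s := fun a b hab => by
    have hab' : (a : ℝ) ≤ b := hab
    rw [← NNReal.coe_le_coe]
    rcases (worstCDF_nonneg 𝒬B b).eq_or_lt with h0 | h0
    · rw [hcoe b, ← h0, div_zero, sub_zero]
      exact (hle a).trans hab'
    · have h1 := hdiff a b hab h0
      have h2 := rent_sub_le hne hab'
      exact sub_nonneg.1 (nonneg_of_mul_nonneg_left (by linarith) h0)
  have hw : ∀ θ : Θ, worstCDF 𝒬B θ ≤ firstPrice.winProb 𝒬B s θ := fun θ => by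
    rcases (worstCDF_nonneg 𝒬B θ).eq_or_lt with h0 | h0
    · rw [← h0]
      exact Auction.IsStandard.winProb_nonneg hne _ s θ
    refine hM.worstCDF_le_winProb isStandard_firstPrice hmono.measurable fun a _ haθ => ?_
    have haθ' : (a : ℝ) < θ := haθ
    have h1 := hdiff a θ haθ.le h0
    -- The intermediate type makes the inequality strict: up to m the rent grows at rate at most
    -- w(m) < w(θ).
    obtain ⟨m, ham, hmθ⟩ := exists_between haθ
    have ham' : (a : ℝ) < m := ham
    have hmθ' : (m : ℝ) < θ := hmθ
    have h2 := rent_sub_le hne hmθ'.le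
    have h3 := rent_sub_le hne ham'.le
    have h4 := mul_lt_mul_of_pos_left (hM.worstCDF_lt hmθ h0) (sub_pos.2 ham')
    rw [← NNReal.coe_lt_coe]
    exact sub_pos.1 (pos_of_mul_pos_left (by linarith) h0.le)
  refine ⟨s, ⟨hmono.monotoneOn _, fun θ hθ b => ?_⟩, fun θ _ h0 => ?_⟩
  · have hV : rent 𝒬B θ ≤ firstPrice.payoff 𝒬B s θ (s θ) := by
      rw [firstPrice_payoff (hle θ), ← hkey θ]
      exact mul_le_mul_of_nonneg_left (hw θ) (sub_nonneg.2 (hle θ))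
    refine le_trans ?_ hV
    rcases le_total (b : ℝ) θ with hb | hb
    · obtain ⟨t, ht0, ht1, htb, hWt⟩ := hM.exists_type_of_bid (hmono.monotoneOn (Iio 1)) b
      have h1 := sub_mul_worstCDF_le hne hM.compact (NNReal.coe_nonneg b) le_rfl
        (fun r hr0 hrt => by
          have h2 := htb ⟨r, hr0, (hrt.le.trans ht1)⟩ hrt
          rw [← NNReal.coe_le_coe] at h2
          have h3 := hkey ⟨r, hr0, (hrt.le.trans ht1)⟩
          have h4 := mul_le_mul_of_nonneg_right h2 (worstCDF_nonneg 𝒬B r)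
          rw [sub_mul] at h3
          rw [sub_mul, add_zero]
          linarith)
      rw [firstPrice_payoff hb]
      have h2 := mul_le_mul_of_nonneg_left hWt (sub_nonneg.2 hb)
      linarith [tangent_le_rent hne t θ]
    · refine le_trans ?_ (rent_nonneg hne θ)
      obtain ⟨G, hG⟩ := hne
      refine (isStandard_firstPrice.payoff_le s θ b hG).trans (integral_nonpos fun x => ?_)
      simp only [firstPrice_integrand]
      exact mul_nonpos_of_nonpos_of_nonneg (sub_nonpos.2 hb) (NNReal.coe_nonneg _)
  · have hw0 : worstCDF 𝒬B θ = 0 := le_antisymm (h0 ▸ hw θ) (worstCDF_nonneg _ _)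
    rw [hcoe, hw0, div_zero, sub_zero]

/-! #### The second-price auction -/

theorem secondPrice_integrand (θ : Θ) (b b' : ℝ≥0) :
    (θ : ℝ) * (secondPrice.x b b' : ℝ) - (secondPrice.τ b b' : ℝ) =
      (θ - b') * (highestBidWins b b' : ℝ) := by
  change (θ : ℝ) * (highestBidWins b b' : ℝ) - ((b' * highestBidWins b b' : ℝ≥0) : ℝ) = _
  rw [NNReal.coe_mul]
  ring

/-- Truthful bidding wins exactly when this is profitable, ties being worth nothing; it is optimal
against each opposing bid, whatever the prior. -/
theorem sub_mul_highestBidWins_self (v b' : ℝ≥0) :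
    ((v : ℝ) - b') * (highestBidWins v b' : ℝ) = max ((v : ℝ) - b') 0 := by
  rcases lt_trichotomy b' v with h | h | h
  · have h' : (b' : ℝ) ≤ v := by exact_mod_cast h.le
    simp [highestBidWins, h, h']
  · simp [h]
  · have h' : (v : ℝ) ≤ b' := by exact_mod_cast h.le
    simp [highestBidWins, h.not_gt, h.ne, h']

theorem sub_mul_highestBidWins_le (v b b' : ℝ≥0) :
    ((v : ℝ) - b') * (highestBidWins b b' : ℝ) ≤ max ((v : ℝ) - b') 0 := by
  have h1 : (highestBidWins b b' : ℝ) ≤ 1 := by exact_mod_cast highestBidWins_le_one b b'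
  have h0 := NNReal.coe_nonneg (highestBidWins b b')
  rcases le_total ((v : ℝ) - b') 0 with h | h
  · rw [max_eq_right h]
    exact mul_nonpos_of_nonpos_of_nonneg h h0
  · rw [max_eq_left h]
    exact mul_le_of_le_one_right h h1

/-- Bidding one's valuation is an equilibrium of the second-price auction. -/
theorem exists_isEquilibrium_secondPrice (hne : 𝒬B.Nonempty) :
    ∃ s, secondPrice.IsEquilibrium 𝒬B s := by
  have hmono : Monotone unitInterval.toNNReal := fun a b hab => hab
  refine ⟨unitInterval.toNNReal, hmono.monotoneOn _, fun θ _ b => le_worstExp hne fun G hG => ?_⟩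
  have hA := isStandard_secondPrice
  refine (hA.payoff_le _ θ b hG).trans (integral_mono
    (integrable_of_abs_le (hA.measurable_payoff hmono.measurable θ b) fun x =>
      hA.abs_payoff_le θ b _)
    (integrable_of_abs_le (hA.measurable_payoff hmono.measurable θ _) fun x =>
      hA.abs_payoff_le θ _ _) fun x => ?_)
  simp only [secondPrice_integrand]
  exact (sub_mul_highestBidWins_le (unitInterval.toNNReal θ) b _).trans
    (sub_mul_highestBidWins_self (unitInterval.toNNReal θ) _).symm.le

/-- Nobody bids more than her valuation in an equilibrium of the second-price auction. -/
theorem secondPrice_bid_le (hM : IsBidderModel F 𝒬B) (hs : secondPrice.IsEquilibrium 𝒬B s) {a : Θ}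
    (ha : a < 1) : (s a : ℝ) ≤ a := by
  have hA := isStandard_secondPrice
  have hsm := hs.measurable
  -- If s a exceeded some θ > a, then type θ would bid at least as much as all types in [a, θ),
  -- winning at least half the time against them at a price above θ. Each such meeting costs at
  -- least κ compared with truthful bidding.
  have key : ∀ θ : Θ, a < θ → θ < 1 → (s a : ℝ) ≤ θ := by
    intro θ haθ hθ
    by_contra! hlt
    set v : ℝ≥0 := unitInterval.toNNReal θ
    have hv : (v : ℝ) = θ := rfl
    set κ : ℝ := ((s a : ℝ) - θ) / 2
    have hκ : 0 < κ := by simp only [κ]; linarith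
    set p := (F : Measure Θ).real (Ico a θ)
    have hp : 0 < p := ENNReal.toReal_pos (fun h =>
      hM.measure_Ioo_ne_zero haθ (measure_mono_null Ioo_subset_Ico_self h)) (measure_ne_top _ _)
    set k : Θ → ℝ := fun θ' => max ((v : ℝ) - s θ') 0 with hk
    have hkeq : secondPrice.payoff 𝒬B s θ v = worstExp 𝒬B k := by
      refine congrArg (worstExp 𝒬B) (funext fun θ' => ?_)
      rw [secondPrice_integrand, ← hv, sub_mul_highestBidWins_self]
    have hkm : Measurable k := (measurable_const.sub hsm.coe_nnreal_real).max measurable_const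
    have hkC : ∀ x, |k x| ≤ v := fun x => by
      rw [hk, abs_of_nonneg (le_max_right _ _)]
      exact max_le (sub_le_self _ (NNReal.coe_nonneg _)) (NNReal.coe_nonneg _)
    obtain ⟨G, hG, hGlt⟩ := exists_integral_lt (c := worstExp 𝒬B k + κ * p) hM.nonempty (h := k)
      (by have := mul_pos hκ hp; linarith)
    -- the types in `[a, θ)` come first, then those above `θ`, then those below `a`
    let Z : Θ → ℝ := fun x => if a ≤ x then (x : ℝ) - a else 1 + (a - x)
    have hZ1 : ∀ x, a ≤ x → Z x = (x : ℝ) - a := fun x hx => if_pos hx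
    have hZ2 : ∀ x, x < a → Z x = 1 + ((a : ℝ) - x) := fun x hx => if_neg (not_le.2 hx)
    have hZ12 : ∀ x y, a ≤ x → y < a → Z x < Z y := fun x y hx hy => by
      rw [hZ1 x hx, hZ2 y hy]
      have h1 : (y : ℝ) < a := hy
      have h2 : (x : ℝ) ≤ 1 := x.2.2
      have h3 : (0 : ℝ) ≤ a := a.2.1
      linarith
    have hZm : Measurable Z := Measurable.ite measurableSet_Ici
      (measurable_subtype_coe.sub_const _) ((measurable_subtype_coe.const_sub _).const_add _)
    have hinj : Function.Injective Z := by
      intro x y hxy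
      rcases le_or_gt a x with hx | hx <;> rcases le_or_gt a y with hy | hy
      · rw [hZ1 x hx, hZ1 y hy] at hxy
        exact Subtype.ext (by linarith)
      · exact absurd hxy (hZ12 x y hx hy).ne
      · exact absurd hxy (hZ12 y x hy hx).ne'
      · rw [hZ2 x hx, hZ2 y hy] at hxy
        exact Subtype.ext (by linarith)
    obtain ⟨G', hG', hge, hmin⟩ := hM.exists_measure_ge hG hZm hinj
      (measurableSet_Ico (a := a) (b := θ)) (fun x hx y hy _ _ => by
        rcases le_or_gt a y with hay | hya
        · rw [hZ1 x hx.1, hZ1 y hay]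
          have h2 : (x : ℝ) < θ := hx.2
          have h3 : (θ : ℝ) ≤ y := not_lt.1 fun h => hy ⟨hay, h⟩
          linarith
        · exact (hZ12 x y hx.1 hya).le)
    -- The truthful payoff k vanishes on all types from a on and decreases below a. The ranking can
    -- thus load [a, θ) first without raising the expectation of k, leaving a prior that is nearly
    -- worst for truth-telling yet penalises the overbid.
    have h1 := hmin k hkm (fun x hx y hy hxy => by
      have hya : y < a := by
        by_contra! hay
        have h2 : (s a : ℝ) ≤ s y := by exact_mod_cast hs.1 ha hy hay
        have h3 : k y = 0 := max_eq_right (by linarith)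
        rw [h3] at hxy
        exact absurd (le_max_right _ _) (not_le.2 hxy)
      rcases le_or_gt a x with hax | hxa
      · exact (hZ12 x y hax hya).le
      · rw [hZ2 x hxa, hZ2 y hya]
        have hyx : y ≤ x := by
          by_contra! hlt
          have h2 : (s x : ℝ) ≤ s y := by exact_mod_cast hs.1 hx hy hlt.le
          exact absurd (max_le_max_right 0 (sub_le_sub_left h2 _)) (not_le.2 hxy)
        have : (y : ℝ) ≤ x := hyx
        linarith) v hkC
    have h2 := hA.payoff_le s θ (s θ) hG'
    have h3 : ∫ θ', ((θ : ℝ) * (secondPrice.x (s θ) (s θ') : ℝ) -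
        (secondPrice.τ (s θ) (s θ') : ℝ)) ∂(G' : Measure Θ) ≤
        ∫ θ', k θ' ∂(G' : Measure Θ) - κ * (G' : Measure Θ).real (Ico a θ) := by
      have hi : Integrable ((Ico a θ).indicator (1 : Θ → ℝ)) (G' : Measure Θ) :=
        (integrable_const (1 : ℝ)).indicator measurableSet_Ico
      have hki := integrable_of_abs_le (G := (G' : Measure Θ)) hkm hkC
      rw [← integral_indicator_one measurableSet_Ico, ← integral_const_mul,
        ← integral_sub hki (hi.const_mul κ)]
      refine integral_mono (integrable_of_abs_le (hA.measurable_payoff hsm θ (s θ))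
        fun x => hA.abs_payoff_le θ (s θ) (s x)) (hki.sub (hi.const_mul κ)) fun x => ?_
      simp only [secondPrice_integrand]
      by_cases hx : x ∈ Ico a θ
      · have hx1 : x < 1 := hx.2.trans hθ
        have h4 : (s a : ℝ) ≤ s x := by exact_mod_cast hs.1 ha hx1 hx.1
        have h5 := hs.1 hx1 hθ hx.2.le
        have h6 : 1 / 2 ≤ (highestBidWins (s θ) (s x) : ℝ) := by
          rw [coe_highestBidWins, if_pos h5]
          split_ifs <;> norm_num
        have h7 : 0 ≤ k x := le_max_right _ _
        rw [indicator_of_mem hx]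
        simp only [Pi.one_apply, κ]
        nlinarith
      · rw [indicator_of_notMem hx, mul_zero, sub_zero]
        exact sub_mul_highestBidWins_le v (s θ) (s x)
    have h4 := hs.2 θ hθ v
    have h5 := mul_le_mul_of_nonneg_left hge hκ.le
    rw [hkeq] at h4
    linarith
  refine le_of_forall_gt_imp_ge_of_dense fun c hc => ?_
  have h1 : (a : ℝ) < min c 1 := lt_min hc ha
  obtain ⟨r, har, hr⟩ := exists_between h1
  have hr0 : 0 ≤ r := a.2.1.trans har.le
  have hr1 : r < 1 := hr.trans_le (min_le_right _ _)
  exact (key ⟨r, hr0, hr1.le⟩ har hr1).trans (hr.le.trans (min_le_left _ _))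

end Existence

/-! ### Worst-case revenue -/

section Revenue

variable {F : ProbabilityMeasure Θ} {𝒬B : Set (ProbabilityMeasure Θ)}

/-- The two marginals of an independent belief that is absolutely continuous with respect to a
product measure are absolutely continuous with respect to the factors. -/
theorem ac_of_prod_ac {Q₁ Q₂ : ProbabilityMeasure Θ}
    (h : Q₁.prod Q₂ ∈ acBeliefs (F.prod F)) : Q₁ ∈ acBeliefs F ∧ Q₂ ∈ acBeliefs F := by
  have h' : (Q₁ : Measure Θ).prod (Q₂ : Measure Θ) ≪ (F : Measure Θ).prod (F : Measure Θ) := h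
  constructor <;> intro A hA
  · have h1 := h' (show (F : Measure Θ).prod (F : Measure Θ) (A ×ˢ univ) = 0 by
      rw [Measure.prod_prod, hA, zero_mul])
    rwa [Measure.prod_prod, measure_univ, mul_one] at h1
  · have h1 := h' (show (F : Measure Θ).prod (F : Measure Θ) (univ ×ˢ A) = 0 by
      rw [Measure.prod_prod, hA, mul_zero])
    rwa [Measure.prod_prod, measure_univ, one_mul] at h1

/-- The rearrangement of a belief about one type with a decreasing density. -/
theorem exists_antitone_density (hF : ∀ x, (F : Measure Θ) {x} = 0) {Q : ProbabilityMeasure Θ}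
    (hQ : Q ∈ acBeliefs F) : ∃ Q' : ProbabilityMeasure Θ, ∃ d : Θ → ℝ≥0∞, Antitone d ∧
      (Q' : Measure Θ) = (F : Measure Θ).withDensity d ∧
      (F : Measure Θ).map d = (F : Measure Θ).map ((Q : Measure Θ).rnDeriv F) ∧
      ∀ X : Θ → ℝ≥0, Measurable X → MonotoneOn X (Iio 1) →
        ∫⁻ x, X x ∂(Q' : Measure Θ) ≤ ∫⁻ x, X x ∂(Q : Measure Θ) := by
  obtain ⟨Q', D, hD, hd, hmap⟩ := exists_antitone_rearrangement hQ
    (Z := fun x : Θ => (x : ℝ)) measurable_subtype_coe (fun z => by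
      have hz : {x : Θ | (x : ℝ) = z}.Subsingleton := fun x hx y hy =>
        Subtype.ext ((show (x : ℝ) = z from hx).trans (show (y : ℝ) = z from hy).symm)
      rcases hz.eq_empty_or_singleton with h | ⟨x, h⟩
      · rw [h, measure_empty]
      · rw [h, hF])
  have hdm : Measurable fun x : Θ => D x := hD.measurable.comp measurable_subtype_coe
  refine ⟨Q', fun x => D x, fun x y hxy => hD hxy, hd, hmap, fun X hX hmono => ?_⟩
  have hQd : (Q : Measure Θ) = (F : Measure Θ).withDensity ((Q : Measure Θ).rnDeriv F) :=
    eq_withDensity_of_mem_acBeliefs hQ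
  have : IsProbabilityMeasure ((F : Measure Θ).withDensity ((Q : Measure Θ).rnDeriv F)) :=
    hQd ▸ inferInstance
  have : IsProbabilityMeasure ((F : Measure Θ).withDensity fun x => D x) := hd ▸ inferInstance
  have h1 : (F : Measure Θ) (Iio 1)ᶜ = 0 := measure_mono_null
    (fun x hx => le_antisymm unitInterval.le_one' (not_lt.1 fun h => hx h)) (hF 1)
  have h := lintegral_le_of_map_eq (μ := (F : Measure Θ)) (Measure.measurable_rnDeriv _ _) hdm hmap
    h1 hX (fun x hx y hy hxy => hD (le_of_not_ge fun hle => not_le.2 hxy (hmono hy hx hle)))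
  rwa [← hd, ← hQd] at h

/-- Rearranging both factors of an independent belief. -/
theorem isRearrangement_prod {Q₁ Q₂ Q₁' Q₂' : ProbabilityMeasure Θ} {d₁ d₂ : Θ → ℝ≥0∞}
    (hQ₁ : Q₁ ∈ acBeliefs F) (hQ₂ : Q₂ ∈ acBeliefs F) (hm₁ : Measurable d₁) (hm₂ : Measurable d₂)
    (hd₁ : (Q₁' : Measure Θ) = (F : Measure Θ).withDensity d₁)
    (hd₂ : (Q₂' : Measure Θ) = (F : Measure Θ).withDensity d₂)
    (h₁ : (F : Measure Θ).map d₁ = (F : Measure Θ).map ((Q₁ : Measure Θ).rnDeriv F))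
    (h₂ : (F : Measure Θ).map d₂ = (F : Measure Θ).map ((Q₂ : Measure Θ).rnDeriv F)) :
    ((Q₁'.prod Q₂' : ProbabilityMeasure (Θ × Θ)) : Measure (Θ × Θ)) =
      ((F.prod F : ProbabilityMeasure (Θ × Θ)) : Measure (Θ × Θ)).withDensity
        (fun z => d₁ z.1 * d₂ z.2) ∧
    IsRearrangement (F.prod F) (Q₁'.prod Q₂') (Q₁.prod Q₂) := by
  have hr₁ := Measure.measurable_rnDeriv (Q₁ : Measure Θ) (F : Measure Θ)
  have hr₂ := Measure.measurable_rnDeriv (Q₂ : Measure Θ) (F : Measure Θ)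
  have hprod : ∀ {R₁ R₂ : ProbabilityMeasure Θ} {e₁ e₂ : Θ → ℝ≥0∞}, Measurable e₁ →
      Measurable e₂ → (R₁ : Measure Θ) = (F : Measure Θ).withDensity e₁ →
      (R₂ : Measure Θ) = (F : Measure Θ).withDensity e₂ →
      ((R₁.prod R₂ : ProbabilityMeasure (Θ × Θ)) : Measure (Θ × Θ)) =
        ((F.prod F : ProbabilityMeasure (Θ × Θ)) : Measure (Θ × Θ)).withDensity
          (fun z => e₁ z.1 * e₂ z.2) := by
    intro R₁ R₂ e₁ e₂ he₁ he₂ hR₁ hR₂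
    have : SFinite ((F : Measure Θ).withDensity e₁) := hR₁ ▸ inferInstance
    have : SFinite ((F : Measure Θ).withDensity e₂) := hR₂ ▸ inferInstance
    rw [ProbabilityMeasure.toMeasure_prod, ProbabilityMeasure.toMeasure_prod, hR₁, hR₂, prod_withDensity he₁ he₂]
  have hmap : ∀ {e₁ e₂ : Θ → ℝ≥0∞}, Measurable e₁ → Measurable e₂ →
      ((F.prod F : ProbabilityMeasure (Θ × Θ)) : Measure (Θ × Θ)).map
        (fun z => e₁ z.1 * e₂ z.2) =
      (((F : Measure Θ).map e₁).prod ((F : Measure Θ).map e₂)).map fun p => p.1 * p.2 := by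
    intro e₁ e₂ he₁ he₂
    rw [ProbabilityMeasure.toMeasure_prod, Measure.map_prod_map _ _ he₁ he₂,
      Measure.map_map (g := fun p : ℝ≥0∞ × ℝ≥0∞ => p.1 * p.2)
        (measurable_fst.mul measurable_snd) (he₁.prodMap he₂)]
    rfl
  refine ⟨hprod hm₁ hm₂ hd₁ hd₂, isRearrangement_of_map_eq
    ((hr₁.comp measurable_fst).mul (hr₂.comp measurable_snd))
    ((hm₁.comp measurable_fst).mul (hm₂.comp measurable_snd))
    (hprod hr₁ hr₂ (eq_withDensity_of_mem_acBeliefs hQ₁)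
      (eq_withDensity_of_mem_acBeliefs hQ₂)) (hprod hm₁ hm₂ hd₁ hd₂) ?_⟩
  exact (hmap hm₁ hm₂).trans ((by rw [h₁, h₂] : _ = _).trans (hmap hr₁ hr₂).symm)

/-- A function on the type profiles is non-decreasing in both types, top types excluded. -/
def ProfileMonotone {α : Type*} [Preorder α] (X : Θ × Θ → α) : Prop :=
  ∀ x x' y y' : Θ, x ≤ x' → y ≤ y' → x' < 1 → y' < 1 → X (x, y) ≤ X (x', y')

/-- A function on the type profiles is non-increasing in both types, top types excluded. -/
def ProfileAntitone {α : Type*} [Preorder α] (X : Θ × Θ → α) : Prop :=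
  ∀ x x' y y' : Θ, x ≤ x' → y ≤ y' → x' < 1 → y' < 1 → X (x', y') ≤ X (x, y)

/-- For independent beliefs, making the densities of both factors decreasing reduces the expectation
of a function that is non-decreasing in both types. -/
theorem lintegral_prod_le_of_le {Q₁ Q₂ Q₁' Q₂' : ProbabilityMeasure Θ}
    (hF : ∀ x, (F : Measure Θ) {x} = 0) (hQ₂ : Q₂ ∈ acBeliefs F) (hQ₁' : Q₁' ∈ acBeliefs F)
    (h₁ : ∀ X : Θ → ℝ≥0, Measurable X → MonotoneOn X (Iio 1) →
      ∫⁻ x, X x ∂(Q₁' : Measure Θ) ≤ ∫⁻ x, X x ∂(Q₁ : Measure Θ))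
    (h₂ : ∀ X : Θ → ℝ≥0, Measurable X → MonotoneOn X (Iio 1) →
      ∫⁻ x, X x ∂(Q₂' : Measure Θ) ≤ ∫⁻ x, X x ∂(Q₂ : Measure Θ))
    {X : Θ × Θ → ℝ≥0} (hX : Measurable X) (hmono : ProfileMonotone X) :
    ∫⁻ z, X z ∂((Q₁'.prod Q₂' : ProbabilityMeasure (Θ × Θ)) : Measure (Θ × Θ)) ≤
      ∫⁻ z, X z ∂((Q₁.prod Q₂ : ProbabilityMeasure (Θ × Θ)) : Measure (Θ × Θ)) := by
  have hXe : Measurable fun z => (X z : ℝ≥0∞) := hX.coe_nnreal_ennreal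
  have htop : (F : Measure Θ) (Iio 1)ᶜ = 0 := measure_mono_null
    (fun x hx => le_antisymm unitInterval.le_one' (not_lt.1 fun h => hx h)) (hF 1)
  rw [ProbabilityMeasure.toMeasure_prod, ProbabilityMeasure.toMeasure_prod]
  calc ∫⁻ z, X z ∂(Q₁' : Measure Θ).prod (Q₂' : Measure Θ)
      = ∫⁻ x, ∫⁻ y, X (x, y) ∂(Q₂' : Measure Θ) ∂(Q₁' : Measure Θ) :=
        lintegral_prod _ hXe.aemeasurable
    _ ≤ ∫⁻ x, ∫⁻ y, X (x, y) ∂(Q₂ : Measure Θ) ∂(Q₁' : Measure Θ) := by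
        have hae : ∀ᵐ x ∂(Q₁' : Measure Θ), x ∈ Iio (1 : Θ) := hQ₁' htop
        refine lintegral_mono_ae ?_
        filter_upwards [hae] with x hx
        exact h₂ (fun y => X (x, y)) (hX.comp measurable_prodMk_left)
          fun y _ y' hy' hyy' => hmono x x y y' le_rfl hyy' hx hy'
    _ = ∫⁻ z, X z ∂(Q₁' : Measure Θ).prod (Q₂ : Measure Θ) :=
        (lintegral_prod _ hXe.aemeasurable).symm
    _ = ∫⁻ y, ∫⁻ x, X (x, y) ∂(Q₁' : Measure Θ) ∂(Q₂ : Measure Θ) :=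
        lintegral_prod_symm _ hXe.aemeasurable
    _ ≤ ∫⁻ y, ∫⁻ x, X (x, y) ∂(Q₁ : Measure Θ) ∂(Q₂ : Measure Θ) := by
        have hae : ∀ᵐ x ∂(Q₂ : Measure Θ), x ∈ Iio (1 : Θ) := hQ₂ htop
        refine lintegral_mono_ae ?_
        filter_upwards [hae] with y hy
        exact h₁ (fun x => X (x, y)) (hX.comp measurable_prodMk_right)
          fun x _ x' hx' hxx' => hmono x x' y y hxx' le_rfl hx' hy
    _ = ∫⁻ z, X z ∂(Q₁ : Measure Θ).prod (Q₂ : Measure Θ) :=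
        (lintegral_prod_symm _ hXe.aemeasurable).symm

/-- Each factor is rearranged separately. The rearrangement is chosen as a function of the belief,
so that equal factors stay equal and the IID domain is preserved. -/
theorem exists_profileAntitone_of_indep (hF : ∀ x, (F : Measure Θ) {x} = 0)
    {X : Θ × Θ → ℝ≥0} (hX : Measurable X) (hmono : ProfileMonotone X) {Q₁ Q₂ : ProbabilityMeasure Θ}
    (hQ₁ : Q₁ ∈ acBeliefs F) (hQ₂ : Q₂ ∈ acBeliefs F) : ∃ Q₁' Q₂' : ProbabilityMeasure Θ,
      (Q₁ = Q₂ → Q₁' = Q₂') ∧ Q₁'.prod Q₂' ∈ acBeliefs (F.prod F) ∧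
      IsRearrangement (F.prod F) (Q₁'.prod Q₂') (Q₁.prod Q₂) ∧
      ∃ g : Θ × Θ → ℝ≥0∞, Measurable g ∧ ProfileAntitone g ∧
        ((Q₁'.prod Q₂' : ProbabilityMeasure (Θ × Θ)) : Measure (Θ × Θ)) =
          ((F.prod F : ProbabilityMeasure (Θ × Θ)) : Measure (Θ × Θ)).withDensity g ∧
        ∫⁻ z, X z ∂((Q₁'.prod Q₂' : ProbabilityMeasure (Θ × Θ)) : Measure (Θ × Θ)) ≤
          ∫⁻ z, X z ∂((Q₁.prod Q₂ : ProbabilityMeasure (Θ × Θ)) : Measure (Θ × Θ)) := by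
  choose R d hd hR hmap hle using fun Q : {Q // Q ∈ acBeliefs F} => exists_antitone_density hF Q.2
  set q₁ : {Q // Q ∈ acBeliefs F} := ⟨Q₁, hQ₁⟩
  set q₂ : {Q // Q ∈ acBeliefs F} := ⟨Q₂, hQ₂⟩
  obtain ⟨h1, h2⟩ := isRearrangement_prod hQ₁ hQ₂ (hd q₁).measurable (hd q₂).measurable (hR q₁)
    (hR q₂) (hmap q₁) (hmap q₂)
  have hRac : R q₁ ∈ acBeliefs F := by
    change (R q₁ : Measure Θ) ≪ (F : Measure Θ)
    rw [hR]
    exact withDensity_absolutelyContinuous _ _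
  refine ⟨R q₁, R q₂, fun h => congrArg R (Subtype.ext h), ?_, h2, _,
    ((hd q₁).measurable.comp measurable_fst).mul ((hd q₂).measurable.comp measurable_snd),
    fun x x' y y' hx hy _ _ => mul_le_mul' (hd q₁ hx) (hd q₂ hy), h1,
    lintegral_prod_le_of_le hF hQ₂ hRac (hle q₁) (hle q₂) hX hmono⟩
  change ((R q₁).prod (R q₂) : Measure (Θ × Θ)) ≪ _
  rw [h1]
  exact withDensity_absolutelyContinuous _ _

/-- X may be constant on large sets. Adding a strictly increasing term leaves at most one point of
each level set on every section below the top type, so the perturbed function has no atoms; the term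
is at most ε since the types sum to at most 2. -/
theorem exists_profileAntitone_of_acBeliefs (hF : ∀ x, (F : Measure Θ) {x} = 0)
    {X : Θ × Θ → ℝ≥0} (hX : Measurable X) (hmono : ProfileMonotone X)
    {Q : ProbabilityMeasure (Θ × Θ)} (hQ : Q ∈ acBeliefs (F.prod F)) {ε : ℝ≥0} (hε : 0 < ε) :
    ∃ Q' ∈ acBeliefs (F.prod F), IsRearrangement (F.prod F) Q' Q ∧
      ∃ g : Θ × Θ → ℝ≥0∞, Measurable g ∧ ProfileAntitone g ∧
        (Q' : Measure (Θ × Θ)) =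
          ((F.prod F : ProbabilityMeasure (Θ × Θ)) : Measure (Θ × Θ)).withDensity g ∧
        ∫⁻ z, X z ∂(Q' : Measure (Θ × Θ)) ≤ ∫⁻ z, X z ∂(Q : Measure (Θ × Θ)) + ε := by
  -- a strictly increasing perturbation of `X`
  set W : Θ × Θ → ℝ≥0 := fun z =>
    X z + ε / 2 * (unitInterval.toNNReal z.1 + unitInterval.toNNReal z.2) with hW
  have hn : Measurable unitInterval.toNNReal := unitInterval.toNNReal_continuous.measurable
  have hWm : Measurable W :=
    hX.add (((hn.comp measurable_fst).add (hn.comp measurable_snd)).const_mul _)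
  have htop : (F : Measure Θ) (Iio 1)ᶜ = 0 := measure_mono_null
    (fun x hx => le_antisymm unitInterval.le_one' (not_lt.1 fun h => hx h)) (hF 1)
  have hWmono : ProfileMonotone W := fun x x' y y' hx hy hx' hy' => by
    have h1 : unitInterval.toNNReal x ≤ unitInterval.toNNReal x' := hx
    have h2 : unitInterval.toNNReal y ≤ unitInterval.toNNReal y' := hy
    have h3 := hmono x x' y y' hx hy hx' hy'
    simp only [hW]
    gcongr
  have hatom : ∀ z : ℝ, ((F.prod F : ProbabilityMeasure (Θ × Θ)) : Measure (Θ × Θ))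
      {p | (W p : ℝ) = z} = 0 := by
    intro z
    have hWz : MeasurableSet {p | (W p : ℝ) = z} :=
      hWm.coe_nnreal_real (measurableSet_singleton z)
    rw [ProbabilityMeasure.toMeasure_prod, Measure.measure_prod_null hWz]
    have hae : ∀ᵐ x ∂(F : Measure Θ), x ∈ Iio (1 : Θ) := htop
    filter_upwards [hae] with x hx
    have hsub : ({y : Θ | y < 1 ∧ (W (x, y) : ℝ) = z}).Subsingleton := by
      have hlt : ∀ y y' : Θ, y < y' → y' < 1 → W (x, y) < W (x, y') := fun y y' hyy' hy' => by
        have h1 : unitInterval.toNNReal y < unitInterval.toNNReal y' := hyy'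
        have h3 := hmono x x y y' le_rfl hyy'.le hx hy'
        have h4 : 0 < ε / 2 := half_pos hε
        simp only [hW]
        exact add_lt_add_of_le_of_lt h3 (mul_lt_mul_of_pos_left (by gcongr) h4)
      rintro y ⟨hy, hyz⟩ y' ⟨hy', hyz'⟩
      have heq : W (x, y) = W (x, y') := NNReal.coe_injective (hyz.trans hyz'.symm)
      rcases lt_trichotomy y y' with h | h | h
      · exact absurd heq (hlt y y' h hy').ne
      · exact h
      · exact absurd heq (hlt y' y h hy).ne'
    refine measure_mono_null (t := {y : Θ | y < 1 ∧ (W (x, y) : ℝ) = z} ∪ {1})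
      (fun y hy => ?_) (measure_union_null ?_ (hF 1))
    · rcases (unitInterval.le_one' (t := y)).lt_or_eq with h | h
      · exact Or.inl ⟨h, hy⟩
      · exact Or.inr h
    · rcases hsub.eq_empty_or_singleton with h | ⟨y, h⟩
      · rw [h, measure_empty]
      · rw [h, hF]
  obtain ⟨Q', D, hD, hd, hmap⟩ := exists_antitone_rearrangement hQ hWm.coe_nnreal_real hatom
  have hrm := Measure.measurable_rnDeriv (Q : Measure (Θ × Θ))
    ((F.prod F : ProbabilityMeasure (Θ × Θ)) : Measure (Θ × Θ))
  have hgm : Measurable fun z => D (W z) := hD.measurable.comp hWm.coe_nnreal_real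
  have hQd := eq_withDensity_of_mem_acBeliefs hQ
  refine ⟨Q', ?_, isRearrangement_of_map_eq hrm hgm hQd hd hmap, fun z => D (W z), hgm,
    fun x x' y y' hx hy hx' hy' => hD (by exact_mod_cast hWmono x x' y y' hx hy hx' hy'), hd, ?_⟩
  · change (Q' : Measure (Θ × Θ)) ≪ _
    rw [hd]
    exact withDensity_absolutelyContinuous _ _
  have : IsProbabilityMeasure (((F.prod F : ProbabilityMeasure (Θ × Θ)) :
      Measure (Θ × Θ)).withDensity fun z => D (W z)) := hd ▸ inferInstance
  have : IsProbabilityMeasure (((F.prod F : ProbabilityMeasure (Θ × Θ)) :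
      Measure (Θ × Θ)).withDensity ((Q : Measure (Θ × Θ)).rnDeriv
        ((F.prod F : ProbabilityMeasure (Θ × Θ)) : Measure (Θ × Θ)))) := hQd ▸ inferInstance
  have h := lintegral_le_of_map_eq hrm hgm hmap (S := univ) (by simp) hWm
    (fun z _ z' _ hzz' => hD (by exact_mod_cast hzz'.le))
  rw [← hd, ← hQd] at h
  calc ∫⁻ z, X z ∂(Q' : Measure (Θ × Θ)) ≤ ∫⁻ z, W z ∂(Q' : Measure (Θ × Θ)) :=
        lintegral_mono fun z => ENNReal.coe_le_coe.2 (le_self_add : X z ≤ W z)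
    _ ≤ ∫⁻ z, W z ∂(Q : Measure (Θ × Θ)) := h
    _ ≤ ∫⁻ z, ((X z : ℝ≥0∞) + ε) ∂(Q : Measure (Θ × Θ)) := by
        refine lintegral_mono fun z => ?_
        have h1 : unitInterval.toNNReal z.1 ≤ 1 := z.1.2.2
        have h2 : unitInterval.toNNReal z.2 ≤ 1 := z.2.2.2
        have h3 : W z ≤ X z + ε := by
          simp only [hW]
          gcongr
          calc ε / 2 * (unitInterval.toNNReal z.1 + unitInterval.toNNReal z.2)
              ≤ ε / 2 * (1 + 1) := by gcongr
            _ = ε := by rw [one_add_one_eq_two, div_mul_cancel₀ _ two_ne_zero]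
        rw [← ENNReal.coe_add]
        exact ENNReal.coe_le_coe.2 h3
    _ = ∫⁻ z, X z ∂(Q : Measure (Θ × Θ)) + ε := by
        rw [lintegral_add_right _ measurable_const, lintegral_const, measure_univ, mul_one]

/-- The comparison of worst-case revenues reduces to the beliefs whose densities are non-increasing
in both types. -/
theorem iInf_lintegral_le (hF : ∀ x, (F : Measure Θ) {x} = 0)
    {𝒬 : Set (ProbabilityMeasure (Θ × Θ))}
    (h𝒬 : IsRearrangementInvariant (F.prod F) (acBeliefs (F.prod F)) 𝒬 ∨
      IsRearrangementInvariant (F.prod F) (indepBeliefs (F.prod F)) 𝒬 ∨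
      IsRearrangementInvariant (F.prod F) (iidBeliefs (F.prod F)) 𝒬)
    {X Y : Θ × Θ → ℝ≥0} (hX : Measurable X) (hY : Measurable Y) (hmono : ProfileMonotone X)
    (hXY : ∀ g : Θ × Θ → ℝ≥0∞, Measurable g → ProfileAntitone g →
      ∫⁻ z, g z * Y z ∂(F : Measure Θ).prod (F : Measure Θ) ≤
        ∫⁻ z, g z * X z ∂(F : Measure Θ).prod (F : Measure Θ)) :
    ⨅ Q ∈ 𝒬, ∫⁻ z, Y z ∂(Q : Measure (Θ × Θ)) ≤ ⨅ Q ∈ 𝒬, ∫⁻ z, X z ∂(Q : Measure (Θ × Θ)) := by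
  refine le_iInf₂ fun Q hQ => ENNReal.le_of_forall_pos_le_add fun ε hε _ => ?_
  obtain ⟨Q', hQ', g, hgm, hg, hd, hle⟩ : ∃ Q' ∈ 𝒬, ∃ g : Θ × Θ → ℝ≥0∞, Measurable g ∧
      ProfileAntitone g ∧ (Q' : Measure (Θ × Θ)) =
        ((F.prod F : ProbabilityMeasure (Θ × Θ)) : Measure (Θ × Θ)).withDensity g ∧
      ∫⁻ z, X z ∂(Q' : Measure (Θ × Θ)) ≤ ∫⁻ z, X z ∂(Q : Measure (Θ × Θ)) + ε := by
    rcases h𝒬 with h | h | h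
    · obtain ⟨Q', hac, hr, g, hg⟩ := exists_profileAntitone_of_acBeliefs hF hX hmono (h.1 hQ) hε
      exact ⟨Q', h.2 Q hQ Q' hac hr, g, hg⟩
    · obtain ⟨hac, Q₁, Q₂, rfl⟩ := h.1 hQ
      obtain ⟨Q₁', Q₂', -, hac', hr, g, hg1, hg2, hg3, hg4⟩ := exists_profileAntitone_of_indep hF
        hX hmono (ac_of_prod_ac hac).1 (ac_of_prod_ac hac).2
      exact ⟨_, h.2 _ hQ _ ⟨hac', Q₁', Q₂', rfl⟩ hr, g, hg1, hg2, hg3, hg4.trans le_self_add⟩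
    · obtain ⟨hac, Q₁, rfl⟩ := h.1 hQ
      obtain ⟨Q₁', Q₂', heq, hac', hr, g, hg1, hg2, hg3, hg4⟩ := exists_profileAntitone_of_indep hF
        hX hmono (ac_of_prod_ac hac).1 (ac_of_prod_ac hac).2
      obtain rfl := heq rfl
      exact ⟨_, h.2 _ hQ _ ⟨hac', Q₁', rfl⟩ hr, g, hg1, hg2, hg3, hg4.trans le_self_add⟩
  -- Only X needs to be monotone: the infimum for Y is bounded by its value at the belief Q'
  -- obtained from rearranging for X.
  refine le_trans (iInf₂_le Q' hQ') (le_trans ?_ hle)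
  rw [hd, lintegral_withDensity_eq_lintegral_mul _ hgm hX.coe_nnreal_ennreal,
    lintegral_withDensity_eq_lintegral_mul _ hgm hY.coe_nnreal_ennreal]
  exact hXY g hgm hg

/-- Expected revenues can be compared bidder by bidder, conditional on the bidder's own type. -/
theorem lintegral_mul_le_of_forall (hF : ∀ x, (F : Measure Θ) {x} = 0)
    {X Y : Θ × Θ → ℝ≥0} {x y : Θ → Θ → ℝ≥0∞}
    (hx : Measurable (Function.uncurry x)) (hy : Measurable (Function.uncurry y))
    (hY : ∀ θ θ' : Θ, θ < 1 → θ' < 1 → θ ≠ θ' → (Y (θ, θ') : ℝ≥0∞) ≤ y θ θ' + y θ' θ)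
    (hX : ∀ θ θ' : Θ, θ < 1 → θ' < 1 → x θ θ' + x θ' θ ≤ X (θ, θ'))
    (h : ∀ θ : Θ, 0 < θ → θ < 1 → ∀ f : Θ → ℝ≥0∞, Measurable f → AntitoneOn f (Iio 1) →
      ∫⁻ θ', f θ' * y θ θ' ∂(F : Measure Θ) ≤ ∫⁻ θ', f θ' * x θ θ' ∂(F : Measure Θ))
    {g : Θ × Θ → ℝ≥0∞} (hg : Measurable g) (hanti : ProfileAntitone g) :
    ∫⁻ z, g z * Y z ∂(F : Measure Θ).prod (F : Measure Θ) ≤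
      ∫⁻ z, g z * X z ∂(F : Measure Θ).prod (F : Measure Θ) := by
  have htop : ∀ᵐ x ∂(F : Measure Θ), x < 1 := measure_mono_null
    (fun x hx => le_antisymm unitInterval.le_one' (not_lt.1 fun h => hx h)) (hF 1)
  have hbot : ∀ᵐ x ∂(F : Measure Θ), 0 < x := measure_mono_null
    (fun x hx => le_antisymm (not_lt.1 fun h => hx h) unitInterval.nonneg') (hF 0)
  have h1 : ∀ᵐ z ∂(F : Measure Θ).prod (F : Measure Θ), z.1 < 1 :=
    Measure.quasiMeasurePreserving_fst.ae htop
  have h2 : ∀ᵐ z ∂(F : Measure Θ).prod (F : Measure Θ), z.2 < 1 :=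
    Measure.quasiMeasurePreserving_snd.ae htop
  have h3 : ∀ᵐ z ∂(F : Measure Θ).prod (F : Measure Θ), z.1 ≠ z.2 := by
    have hm : MeasurableSet {z : Θ × Θ | z.1 = z.2} :=
      measurableSet_eq_fun measurable_fst measurable_snd
    refine measure_mono_null (t := {z : Θ × Θ | z.1 = z.2}) (fun z hz => not_not.1 hz) ?_
    rw [Measure.measure_prod_null hm]
    refine ae_of_all _ fun a => measure_mono_null (fun b hb => ?_) (hF a)
    exact (show a = b from hb).symm
  have hys : Measurable fun z : Θ × Θ => y z.2 z.1 := hy.comp measurable_swap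
  have hxs : Measurable fun z : Θ × Θ => x z.2 z.1 := hx.comp measurable_swap
  have hy' : Measurable fun z : Θ × Θ => y z.1 z.2 := hy
  have hgy : Measurable fun z : Θ × Θ => g z * y z.1 z.2 := hg.mul hy'
  have hgys : Measurable fun z : Θ × Θ => g z * y z.2 z.1 := hg.mul hys
  have hx' : Measurable fun z : Θ × Θ => x z.1 z.2 := hx
  have hgx : Measurable fun z : Θ × Θ => g z * x z.1 z.2 := hg.mul hx'
  have hgxs : Measurable fun z : Θ × Θ => g z * x z.2 z.1 := hg.mul hxs
  have h4 : ∫⁻ z, g z * y z.1 z.2 ∂(F : Measure Θ).prod (F : Measure Θ) ≤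
      ∫⁻ z, g z * x z.1 z.2 ∂(F : Measure Θ).prod (F : Measure Θ) := by
    rw [lintegral_prod _ hgy.aemeasurable, lintegral_prod _ hgx.aemeasurable]
    refine lintegral_mono_ae ?_
    filter_upwards [htop, hbot] with θ hθ1 hθ0
    exact h θ hθ0 hθ1 (fun θ' => g (θ, θ')) (hg.comp measurable_prodMk_left)
      fun a _ b hb hab => hanti θ θ a b le_rfl hab hθ1 hb
  have h5 : ∫⁻ z, g z * y z.2 z.1 ∂(F : Measure Θ).prod (F : Measure Θ) ≤
      ∫⁻ z, g z * x z.2 z.1 ∂(F : Measure Θ).prod (F : Measure Θ) := by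
    rw [lintegral_prod_symm _ hgys.aemeasurable, lintegral_prod_symm _ hgxs.aemeasurable]
    refine lintegral_mono_ae ?_
    filter_upwards [htop, hbot] with θ hθ1 hθ0
    exact h θ hθ0 hθ1 (fun θ' => g (θ', θ)) (hg.comp measurable_prodMk_right)
      fun a _ b hb hab => hanti a b θ θ hab le_rfl hb hθ1
  calc ∫⁻ z, g z * Y z ∂(F : Measure Θ).prod (F : Measure Θ)
      ≤ ∫⁻ z, (g z * y z.1 z.2 + g z * y z.2 z.1) ∂(F : Measure Θ).prod (F : Measure Θ) := by
        refine lintegral_mono_ae ?_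
        filter_upwards [h1, h2, h3] with z hz1 hz2 hz3
        rw [← mul_add]
        exact mul_le_mul_right (hY z.1 z.2 hz1 hz2 hz3) _
    _ = ∫⁻ z, g z * y z.1 z.2 ∂(F : Measure Θ).prod (F : Measure Θ) +
          ∫⁻ z, g z * y z.2 z.1 ∂(F : Measure Θ).prod (F : Measure Θ) :=
        lintegral_add_left hgy _
    _ ≤ ∫⁻ z, g z * x z.1 z.2 ∂(F : Measure Θ).prod (F : Measure Θ) +
          ∫⁻ z, g z * x z.2 z.1 ∂(F : Measure Θ).prod (F : Measure Θ) := add_le_add h4 h5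
    _ = ∫⁻ z, (g z * x z.1 z.2 + g z * x z.2 z.1) ∂(F : Measure Θ).prod (F : Measure Θ) :=
        (lintegral_add_left hgx _).symm
    _ ≤ ∫⁻ z, g z * X z ∂(F : Measure Θ).prod (F : Measure Θ) := by
        refine lintegral_mono_ae ?_
        filter_upwards [h1, h2] with z hz1 hz2
        rw [← mul_add]
        exact mul_le_mul_right (hX z.1 z.2 hz1 hz2) _

end Revenue

/-! ### Revenue comparisons between the formats. -/

section Comparison

variable {F : ProbabilityMeasure Θ} {𝒬B : Set (ProbabilityMeasure Θ)} {s sI sA sW sII : Θ → ℝ≥0}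

theorem firstPrice_total (b b' : ℝ≥0) :
    firstPrice.τ b b' + firstPrice.τ b' b = max b b' := by
  change b * highestBidWins b b' + b' * highestBidWins b' b = max b b'
  rcases lt_trichotomy b b' with h | h | h
  · simp [highestBidWins, h, h.not_gt, h.ne, h.le]
  · subst h
    simp only [highestBidWins, lt_irrefl, if_false, if_true, max_self, ← mul_add, add_halves,
      mul_one]
  · simp [highestBidWins, h, h.not_gt, h.ne, h.le]

theorem secondPrice_total (b b' : ℝ≥0) :
    secondPrice.τ b b' + secondPrice.τ b' b = min b b' := by
  change b' * highestBidWins b b' + b * highestBidWins b' b = min b b'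
  rcases lt_trichotomy b b' with h | h | h
  · simp [highestBidWins, h, h.not_gt, h.ne, h.le]
  · subst h
    simp only [highestBidWins, lt_irrefl, if_false, if_true, min_self, ← mul_add, add_halves,
      mul_one]
  · simp [highestBidWins, h, h.not_gt, h.ne, h.le]

theorem worstCaseRevenue_transfer (A : Auction) (𝒬 : Set (ProbabilityMeasure (Θ × Θ)))
    (s : Θ → ℝ≥0) : worstCaseRevenue 𝒬 (A.transfer s) =
      ⨅ Q ∈ 𝒬, ∫⁻ z, ((A.τ (s z.1) (s z.2) + A.τ (s z.2) (s z.1) : ℝ≥0) : ℝ≥0∞)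
        ∂(Q : Measure (Θ × Θ)) := rfl

theorem IsBidderModel.restrict_Iio_compl (hM : IsBidderModel F 𝒬B) (θ : Θ) :
    (F : Measure Θ).restrict (Iio θ) (Iio θ ∩ Iio 1)ᶜ = 0 := by
  rw [compl_inter]
  refine measure_union_null ?_ ?_
  · rw [Measure.restrict_apply measurableSet_Iio.compl, compl_inter_self, measure_empty]
  · exact Measure.restrict_le_self.absolutelyContinuous hM.measure_compl_Iio_one

/-- The integral of the reference distribution function, written as an expectation. -/
theorem mul_measure_le_integral_max_sub (F : ProbabilityMeasure Θ) {a b : ℝ} (hab : a ≤ b) :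
    (b - a) * (F : Measure Θ).real {θ' | (θ' : ℝ) < a} ≤
      ∫ x : Θ, max (b - (x : ℝ)) 0 ∂(F : Measure Θ) -
        ∫ x : Θ, max (a - (x : ℝ)) 0 ∂(F : Measure Θ) := by
  have hi : ∀ c : ℝ, Integrable (fun x : Θ => max (c - (x : ℝ)) 0) (F : Measure Θ) := fun c =>
    integrable_of_abs_le ((measurable_const.sub measurable_subtype_coe).max measurable_const)
      (C := |c|) fun x => by
        rw [abs_of_nonneg (le_max_right _ _)]
        exact max_le (by linarith [le_abs_self c, x.2.1]) (abs_nonneg c)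
  rw [← integral_sub (hi b) (hi a), ← integral_indicator_one (measurableSet_coe_lt a),
    ← integral_const_mul]
  refine integral_mono (((integrable_const (1 : ℝ)).indicator (measurableSet_coe_lt a)).const_mul _)
    ((hi b).sub (hi a)) fun x => ?_
  by_cases hx : x ∈ {θ' : Θ | (θ' : ℝ) < a}
  · have hx' : (x : ℝ) < a := hx
    simp only [indicator_of_mem hx, Pi.one_apply, mul_one]
    rw [max_eq_left (by linarith), max_eq_left (by linarith)]
    linarith
  · simp only [indicator_of_notMem hx, mul_zero]
    exact sub_nonneg.2 (max_le_max_right 0 (by linarith))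

/-- The monotonicity of w/F integrated over [0, θ]: R(θ) F(θ) ≤ w(θ) ∫ F, where the last integral
from 0 to θ equals the expectation of max(θ - θ', 0). -/
theorem rent_mul_measure_le (hM : IsBidderModel F 𝒬B) (θ : Θ) :
    rent 𝒬B θ * (F : Measure Θ).real {θ' | (θ' : ℝ) < θ} ≤
      worstCDF 𝒬B θ * ∫ x : Θ, max ((θ : ℝ) - (x : ℝ)) 0 ∂(F : Measure Θ) := by
  set p := (F : Measure Θ).real {θ' | (θ' : ℝ) < θ}
  have hp : 0 ≤ p := measureReal_nonneg
  set Φ : ℝ → ℝ := fun t => ∫ x : Θ, max (t - (x : ℝ)) 0 ∂(F : Measure Θ)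
  have h := le_of_increments (w := fun t => p * worstCDF 𝒬B t)
    (D := fun t => worstCDF 𝒬B θ * Φ t - p * rent 𝒬B t) θ.2.1 (fun a b _ hab hb => by
      have h1 := mul_measure_le_integral_max_sub F hab
      have h2 := mul_le_mul_of_nonneg_left h1 (worstCDF_nonneg 𝒬B θ)
      have h3 := mul_le_mul_of_nonneg_left (rent_sub_le hM.nonempty hab) hp
      have h4 := mul_le_mul_of_nonneg_left (hM.worstCDF_mul_le (hab.trans hb)) (sub_nonneg.2 hab)
      simp only [Φ]
      linarith)
  have h0 : Φ 0 = 0 := by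
    have : ∀ x : Θ, max (0 - (x : ℝ)) 0 = 0 := fun x => max_eq_right (by linarith [x.2.1])
    simp only [Φ, this, integral_zero]
  simp only [h0, rent_zero] at h
  linarith

/-- First-price bids are at least the expected type of a competitor with a lower type. -/
theorem firstPrice_lintegral_le (hM : IsBidderModel F 𝒬B) (hs : firstPrice.IsEquilibrium 𝒬B s)
    (hs' : firstPrice.BidsValueIfHopeless 𝒬B s) {θ : Θ} (h0 : 0 < θ) (h1 : θ < 1) :
    ∫⁻ x in Iio θ, (unitInterval.toNNReal x : ℝ≥0∞) ∂(F : Measure Θ) ≤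
      s θ * (F : Measure Θ) (Iio θ) := by
  -- When w(θ) = 0 the rent bound says nothing about the bid, and the assumption on hopeless types
  -- is needed.
  rcases (worstCDF_nonneg 𝒬B θ).eq_or_lt with hw | hw
  · have hsθ : s θ = unitInterval.toNNReal θ := NNReal.coe_injective
      (hs' θ h1 ((firstPrice_winProb_eq hM hs h1).trans hw.symm))
    rw [← setLIntegral_const, hsθ]
    exact setLIntegral_mono measurable_const fun x hx => ENNReal.coe_le_coe.2
      (show (x : ℝ) ≤ θ from le_of_lt hx)
  set p := (F : Measure Θ).real (Iio θ) with hp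
  have hnm : Measurable unitInterval.toNNReal := unitInterval.toNNReal_continuous.measurable
  have hi : Integrable (fun x : Θ => (x : ℝ)) (F : Measure Θ) :=
    integrable_of_abs_le measurable_subtype_coe (C := 1) fun x => by
      rw [abs_of_nonneg x.2.1]; exact x.2.2
  have h2 := rent_mul_measure_le hM θ
  have h3 := firstPrice_sub_bid_mul_le hM hs h0 h1
  have h4 : ∫ x : Θ, max ((θ : ℝ) - (x : ℝ)) 0 ∂(F : Measure Θ) =
      θ * p - ∫ x in Iio θ, (x : ℝ) ∂(F : Measure Θ) := by
    have e : ∀ x : Θ, max ((θ : ℝ) - (x : ℝ)) 0 =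
        (Iio θ).indicator (fun x : Θ => (θ : ℝ) - (x : ℝ)) x := fun x => by
      by_cases hx : x ∈ Iio θ
      · rw [indicator_of_mem hx]
        exact max_eq_left (sub_nonneg.2 (show (x : ℝ) ≤ θ from le_of_lt hx))
      · rw [indicator_of_notMem hx]
        exact max_eq_right (sub_nonpos.2 (show (θ : ℝ) ≤ x from not_lt.1 hx))
    simp only [e]
    rw [integral_indicator measurableSet_Iio, integral_sub (integrable_const _) hi.integrableOn]
    simp [hp, mul_comm]
  have h5 : ∫ x in Iio θ, (x : ℝ) ∂(F : Measure Θ) ≤ s θ * p := by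
    have h6 := mul_le_mul_of_nonneg_right h3 (measureReal_nonneg : 0 ≤ p)
    have h7 : worstCDF 𝒬B θ * (((θ : ℝ) - s θ) * p) ≤
        worstCDF 𝒬B θ * (θ * p - ∫ x in Iio θ, (x : ℝ) ∂(F : Measure Θ)) := by
      rw [h4] at h2
      refine le_trans (le_trans (le_of_eq ?_) h6) h2
      ring
    have h8 := le_of_mul_le_mul_left h7 hw
    linarith
  have h6 : ∫⁻ x in Iio θ, (unitInterval.toNNReal x : ℝ≥0∞) ∂(F : Measure Θ) =
      ENNReal.ofReal (∫ x in Iio θ, (x : ℝ) ∂(F : Measure Θ)) := by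
    rw [ofReal_integral_eq_lintegral_ofReal hi.integrableOn (ae_of_all _ fun x => x.2.1)]
    refine lintegral_congr fun x => ?_
    rw [← ENNReal.ofReal_coe_nnreal, unitInterval.coe_toNNReal]
  rw [h6]
  refine (ENNReal.ofReal_le_ofReal h5).trans (le_of_eq ?_)
  rw [ENNReal.ofReal_mul (NNReal.coe_nonneg _), ENNReal.ofReal_coe_nnreal, hp, ofReal_measureReal]

/-- The revenue from a winner who pays a price that depends only on her own type. -/
theorem lintegral_mul_ite_lt (f : Θ → ℝ≥0∞) (hf : Measurable f) (θ : Θ) (c : ℝ≥0∞) :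
    ∫⁻ x, f x * (if x < θ then c else 0) ∂(F : Measure Θ) =
      (∫⁻ x in Iio θ, f x ∂(F : Measure Θ)) * c := by
  rw [← lintegral_mul_const _ hf, ← lintegral_indicator measurableSet_Iio]
  refine lintegral_congr fun x => ?_
  by_cases hx : x < θ
  · simp [hx]
  · simp [hx]

theorem measurable_ite_lt {u : Θ × Θ → ℝ≥0∞} (hu : Measurable u) :
    Measurable fun z : Θ × Θ => if z.2 < z.1 then u z else 0 :=
  Measurable.ite (measurableSet_lt measurable_snd measurable_fst) hu measurable_const

/-- The worst-case revenue in the first-price auction is at least that in the second-price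
auction. -/
theorem secondPrice_le_firstPrice (hM : IsBidderModel F 𝒬B)
    {𝒬 : Set (ProbabilityMeasure (Θ × Θ))}
    (h𝒬 : IsRearrangementInvariant (F.prod F) (acBeliefs (F.prod F)) 𝒬 ∨
      IsRearrangementInvariant (F.prod F) (indepBeliefs (F.prod F)) 𝒬 ∨
      IsRearrangementInvariant (F.prod F) (iidBeliefs (F.prod F)) 𝒬)
    (hI : firstPrice.IsEquilibrium 𝒬B sI) (hI' : firstPrice.BidsValueIfHopeless 𝒬B sI)
    (hII : secondPrice.IsEquilibrium 𝒬B sII) :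
    worstCaseRevenue 𝒬 (secondPrice.transfer sII) ≤
      worstCaseRevenue 𝒬 (firstPrice.transfer sI) := by
  rw [worstCaseRevenue_transfer, worstCaseRevenue_transfer]
  simp only [firstPrice_total, secondPrice_total]
  have hIm := hI.measurable
  have hIIm := hII.measurable
  have hnm : Measurable unitInterval.toNNReal := unitInterval.toNNReal_continuous.measurable
  refine iInf_lintegral_le hM.measure_singleton h𝒬
    (X := fun z => max (sI z.1) (sI z.2)) (Y := fun z => min (sII z.1) (sII z.2))
    ((hIm.comp measurable_fst).max (hIm.comp measurable_snd))
    ((hIIm.comp measurable_fst).min (hIIm.comp measurable_snd))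
    (fun x x' y y' hx hy hx' hy' => max_le_max (hI.1 (hx.trans_lt hx') hx' hx)
      (hI.1 (hy.trans_lt hy') hy' hy)) fun g hg hanti => ?_
  -- Revenue is charged to the bidder with the higher type: her own bid in the first-price auction,
  -- the competitor's type as an upper bound in the second-price auction.
  refine lintegral_mul_le_of_forall hM.measure_singleton
    (x := fun θ θ' => if θ' < θ then (sI θ : ℝ≥0∞) else 0)
    (y := fun θ θ' => if θ' < θ then (unitInterval.toNNReal θ' : ℝ≥0∞) else 0)
    (measurable_ite_lt (hIm.comp measurable_fst).coe_nnreal_ennreal)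
    (measurable_ite_lt (hnm.comp measurable_snd).coe_nnreal_ennreal) ?_ ?_ ?_ hg hanti
  · intro θ θ' hθ hθ' hne
    have h1 : sII θ ≤ unitInterval.toNNReal θ := secondPrice_bid_le hM hII hθ
    have h2 : sII θ' ≤ unitInterval.toNNReal θ' := secondPrice_bid_le hM hII hθ'
    rcases lt_or_gt_of_ne hne with h | h
    · simp only [if_pos h, if_neg h.not_gt, zero_add]
      exact ENNReal.coe_le_coe.2 ((min_le_left _ _).trans h1)
    · simp only [if_pos h, if_neg h.not_gt, add_zero]
      exact ENNReal.coe_le_coe.2 ((min_le_right _ _).trans h2)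
  · intro θ θ' _ _
    rcases lt_trichotomy θ θ' with h | h | h
    · simp only [if_pos h, if_neg h.not_gt, zero_add]
      exact ENNReal.coe_le_coe.2 (le_max_right _ _)
    · simp [h]
    · simp only [if_pos h, if_neg h.not_gt, add_zero]
      exact ENNReal.coe_le_coe.2 (le_max_left _ _)
  · intro θ h0 h1 f hf hfanti
    have hF0 := hM.measure_Iio_ne_zero h0
    have hFt : (F : Measure Θ) (Iio θ) ≠ ∞ := measure_ne_top _ _
    -- Among the types below θ, the density decreases while the price θ' increases, so its mean is
    -- at most the F-mean, which the first-price bid covers.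
    have hc := lintegral_mul_mul_le (μ := (F : Measure Θ).restrict (Iio θ))
      (hM.restrict_Iio_compl θ) hf hnm.coe_nnreal_ennreal
      (pairing_le_of_opposite fun x hx y hy => by
        rcases le_total x y with h | h
        · exact Or.inr ⟨hfanti hx.2 hy.2 h, ENNReal.coe_le_coe.2 h⟩
        · exact Or.inl ⟨hfanti hy.2 hx.2 h, ENNReal.coe_le_coe.2 h⟩)
    rw [Measure.restrict_apply_univ] at hc
    have hb := firstPrice_lintegral_le hM hI hI' h0 h1
    rw [lintegral_mul_ite_lt f hf]
    have e : ∫⁻ x, f x * (if x < θ then (unitInterval.toNNReal x : ℝ≥0∞) else 0)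
        ∂(F : Measure Θ) =
        ∫⁻ x in Iio θ, f x * (unitInterval.toNNReal x : ℝ≥0∞) ∂(F : Measure Θ) := by
      rw [← lintegral_indicator measurableSet_Iio]
      refine lintegral_congr fun x => ?_
      by_cases hx : x < θ
      · simp [hx]
      · simp [hx]
    rw [e, ← ENNReal.mul_le_mul_iff_left hF0 hFt]
    refine hc.trans ((mul_le_mul_right hb _).trans (le_of_eq ?_))
    rw [mul_assoc]

/-- The worst-case revenue in the first-price auction is at least that in the all-pay auction. -/
theorem allPay_le_firstPrice (hM : IsBidderModel F 𝒬B)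
    {𝒬 : Set (ProbabilityMeasure (Θ × Θ))}
    (h𝒬 : IsRearrangementInvariant (F.prod F) (acBeliefs (F.prod F)) 𝒬 ∨
      IsRearrangementInvariant (F.prod F) (indepBeliefs (F.prod F)) 𝒬 ∨
      IsRearrangementInvariant (F.prod F) (iidBeliefs (F.prod F)) 𝒬)
    (hI : firstPrice.IsEquilibrium 𝒬B sI) (hA : allPay.IsEquilibrium 𝒬B sA) :
    worstCaseRevenue 𝒬 (allPay.transfer sA) ≤ worstCaseRevenue 𝒬 (firstPrice.transfer sI) := by
  rw [worstCaseRevenue_transfer, worstCaseRevenue_transfer]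
  simp only [firstPrice_total]
  have hIm := hI.measurable
  have hAm := hA.measurable
  refine iInf_lintegral_le hM.measure_singleton h𝒬
    (X := fun z => max (sI z.1) (sI z.2)) (Y := fun z => sA z.1 + sA z.2)
    ((hIm.comp measurable_fst).max (hIm.comp measurable_snd))
    ((hAm.comp measurable_fst).add (hAm.comp measurable_snd))
    (fun x x' y y' hx hy hx' hy' => max_le_max (hI.1 (hx.trans_lt hx') hx' hx)
      (hI.1 (hy.trans_lt hy') hy' hy)) fun g hg hanti => ?_
  refine lintegral_mul_le_of_forall hM.measure_singleton
    (x := fun θ θ' => if θ' < θ then (sI θ : ℝ≥0∞) else 0) (y := fun θ _ => (sA θ : ℝ≥0∞))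
    (measurable_ite_lt (hIm.comp measurable_fst).coe_nnreal_ennreal)
    (hAm.comp measurable_fst).coe_nnreal_ennreal
    (fun θ θ' _ _ _ => (ENNReal.coe_add _ _).le) ?_ ?_ hg hanti
  · intro θ θ' _ _
    rcases lt_trichotomy θ θ' with h | h | h
    · simp only [if_pos h, if_neg h.not_gt, zero_add]
      exact ENNReal.coe_le_coe.2 (le_max_right _ _)
    · simp [h]
    · simp only [if_pos h, if_neg h.not_gt, add_zero]
      exact ENNReal.coe_le_coe.2 (le_max_left _ _)
  · intro θ h0 h1 f hf hfanti
    -- The chain is θ w - R ≤ w sI ≤ F sI: the all-pay bid is at most the expected first-price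
    -- payment under F.
    have hbid : (sA θ : ℝ) ≤ (F : Measure Θ).real (Iio θ) * sI θ := by
      have h2 := firstPrice_sub_bid_mul_le hM hI h0 h1
      have h3 := mul_le_mul_of_nonneg_right (hM.worstCDF_le_measure θ.2.2)
        (NNReal.coe_nonneg (sI θ))
      rw [allPay_bid_eq hM hA h0 h1]
      refine le_trans ?_ h3
      linarith
    have hbid' : (sA θ : ℝ≥0∞) ≤ (F : Measure Θ) (Iio θ) * sI θ := by
      rw [← ENNReal.ofReal_coe_nnreal, ← ENNReal.ofReal_coe_nnreal (p := sI θ),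
        ← ofReal_measureReal (μ := (F : Measure Θ)) (s := Iio θ),
        ← ENNReal.ofReal_mul measureReal_nonneg]
      exact ENNReal.ofReal_le_ofReal hbid
    -- A decreasing density gives the event of facing a lower type at least its reference
    -- probability, which favours the format in which only the winner pays.
    have hc := hM.mul_measure_le hf (measurableSet_Iio (a := θ)) MeasurableSet.univ
      (subset_univ _) (fun x hx y hy hx1 hy1 => hfanti hx1 hy1
        ((show x < θ from hx).le.trans (not_lt.1 fun h => hy.2 h)))
    rw [withDensity_apply _ MeasurableSet.univ, withDensity_apply _ measurableSet_Iio,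
      setLIntegral_univ, measure_univ, mul_one] at hc
    rw [lintegral_mul_ite_lt f hf, lintegral_mul_const _ hf]
    calc (∫⁻ x, f x ∂(F : Measure Θ)) * sA θ
        ≤ (∫⁻ x, f x ∂(F : Measure Θ)) * ((F : Measure Θ) (Iio θ) * sI θ) :=
          mul_le_mul_right hbid' _
      _ = (∫⁻ x, f x ∂(F : Measure Θ)) * (F : Measure Θ) (Iio θ) * sI θ := (mul_assoc _ _ _).symm
      _ ≤ _ := mul_le_mul_left hc _

/-- The worst-case revenue in the all-pay auction is at least that in the war of attrition. -/
theorem warOfAttrition_le_allPay (hM : IsBidderModel F 𝒬B)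
    {𝒬 : Set (ProbabilityMeasure (Θ × Θ))}
    (h𝒬 : IsRearrangementInvariant (F.prod F) (acBeliefs (F.prod F)) 𝒬 ∨
      IsRearrangementInvariant (F.prod F) (indepBeliefs (F.prod F)) 𝒬 ∨
      IsRearrangementInvariant (F.prod F) (iidBeliefs (F.prod F)) 𝒬)
    (hA : allPay.IsEquilibrium 𝒬B sA) (hW : warOfAttrition.IsEquilibrium 𝒬B sW) :
    worstCaseRevenue 𝒬 (warOfAttrition.transfer sW) ≤
      worstCaseRevenue 𝒬 (allPay.transfer sA) := by
  rw [worstCaseRevenue_transfer, worstCaseRevenue_transfer]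
  simp only [warOfAttrition_τ]
  have hAm := hA.measurable
  have hWm := hW.measurable
  have hmin : Measurable fun z : Θ × Θ => min (sW z.1) (sW z.2) :=
    (hWm.comp measurable_fst).min (hWm.comp measurable_snd)
  refine iInf_lintegral_le hM.measure_singleton h𝒬
    (X := fun z => sA z.1 + sA z.2)
    (Y := fun z => min (sW z.1) (sW z.2) + min (sW z.2) (sW z.1))
    ((hAm.comp measurable_fst).add (hAm.comp measurable_snd))
    (hmin.add (hmin.comp measurable_swap))
    (fun x x' y y' hx hy hx' hy' => add_le_add (hA.1 (hx.trans_lt hx') hx' hx)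
      (hA.1 (hy.trans_lt hy') hy' hy)) fun g hg hanti => ?_
  refine lintegral_mul_le_of_forall hM.measure_singleton
    (x := fun θ _ => (sA θ : ℝ≥0∞)) (y := fun θ θ' => ((min (sW θ) (sW θ') : ℝ≥0) : ℝ≥0∞))
    (hAm.comp measurable_fst).coe_nnreal_ennreal hmin.coe_nnreal_ennreal
    (fun θ θ' _ _ _ => (ENNReal.coe_add _ _).le) (fun θ θ' _ _ => (ENNReal.coe_add _ _).ge) ?_ hg
    hanti
  intro θ h0 h1 f hf hfanti
  have hmm : Measurable fun θ' => ((min (sW θ) (sW θ') : ℝ≥0) : ℝ≥0∞) :=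
    (measurable_const.min hWm).coe_nnreal_ennreal
  -- The density decreases and the payment in the war of attrition increases in the competitor's
  -- type, so the expected payment is at most that under F; the all-pay bid does not depend on the
  -- competitor.
  have hc := lintegral_mul_mul_le (μ := (F : Measure Θ)) hM.measure_compl_Iio_one hf hmm
    (pairing_le_of_opposite fun x hx y hy => by
      rcases le_total x y with h | h
      · exact Or.inr ⟨hfanti hx hy h, ENNReal.coe_le_coe.2 (min_le_min_left _ (hW.1 hx hy h))⟩
      · exact Or.inl ⟨hfanti hy hx h, ENNReal.coe_le_coe.2 (min_le_min_left _ (hW.1 hy hx h))⟩)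
  rw [measure_univ, mul_one] at hc
  have hb := warOfAttrition_lintegral_min_le hM hW h0 h1
  rw [← allPay_bid_eq hM hA h0 h1, ENNReal.ofReal_coe_nnreal] at hb
  rw [lintegral_mul_const _ hf]
  exact hc.trans (mul_le_mul_right hb _)

end Comparison

/-- A marginal of an IID reference belief with a positive density is equivalent to Lebesgue
measure. -/
theorem ac_of_hasPositiveDensity {F : ProbabilityMeasure Θ}
    (h : HasPositiveDensity (F.prod F)) :
    (F : Measure Θ) ≪ volume ∧ volume ≪ (F : Measure Θ) := by
  obtain ⟨p, hp, hpos, hP⟩ := h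
  rw [ProbabilityMeasure.toMeasure_prod] at hP
  have hpm : Measurable fun z => (p z : ℝ≥0∞) := hp.coe_nnreal_ennreal
  have h1 : (F : Measure Θ).prod (F : Measure Θ) ≪ volume := by
    rw [hP]
    exact withDensity_absolutelyContinuous _ _
  have h2 : (volume : Measure (Θ × Θ)) ≪ (F : Measure Θ).prod (F : Measure Θ) := by
    rw [hP]
    exact withDensity_absolutelyContinuous' hpm.aemeasurable
      (ae_of_all _ fun z => (ENNReal.coe_pos.2 (hpos z)).ne')
  constructor <;> intro A hA
  · have h3 := h1 (show (volume : Measure (Θ × Θ)) (A ×ˢ univ) = 0 by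
      rw [Measure.volume_eq_prod, Measure.prod_prod, hA, zero_mul])
    rwa [Measure.prod_prod, measure_univ, mul_one] at h3
  · have h3 := h2 (show (F : Measure Θ).prod (F : Measure Θ) (A ×ˢ univ) = 0 by
      rw [Measure.prod_prod, hA, zero_mul])
    rwa [Measure.volume_eq_prod, Measure.prod_prod, measure_univ, mul_one] at h3

theorem marginal_prod (F : ProbabilityMeasure Θ) : marginal (F.prod F) = F := by
  refine Subtype.ext ?_
  change ((F : Measure Θ).prod (F : Measure Θ)).map Prod.fst = (F : Measure Θ)
  rw [Measure.map_fst_prod, measure_univ, one_smul]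

end AmbiguousAuction

theorem corollary1
    (P : MeasureTheory.ProbabilityMeasure (AmbiguousAuction.Θ × AmbiguousAuction.Θ))
    (hP_density : AmbiguousAuction.HasPositiveDensity P)
    (hP_iid : AmbiguousAuction.IsIID P)
    -- the seller's set of priors
    (𝒬 : Set (MeasureTheory.ProbabilityMeasure (AmbiguousAuction.Θ × AmbiguousAuction.Θ)))
    (hP_mem : P ∈ 𝒬)
    (h𝒬_compact : IsCompact 𝒬)
    (h𝒬 : AmbiguousAuction.IsRearrangementInvariant P (AmbiguousAuction.acBeliefs P) 𝒬 ∨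
      AmbiguousAuction.IsRearrangementInvariant P (AmbiguousAuction.indepBeliefs P) 𝒬 ∨
      AmbiguousAuction.IsRearrangementInvariant P (AmbiguousAuction.iidBeliefs P) 𝒬)
    -- the bidders' set of priors
    (𝒬B : Set (MeasureTheory.ProbabilityMeasure AmbiguousAuction.Θ))
    (h𝒬B_nonempty : 𝒬B.Nonempty)
    (h𝒬B_compact : IsCompact 𝒬B)
    (h𝒬B : AmbiguousAuction.IsRearrangementInvariant (AmbiguousAuction.marginal P)
      (AmbiguousAuction.acBeliefs (AmbiguousAuction.marginal P)) 𝒬B) :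
    -- the first-price, second-price and all-pay auctions have equilibria
    (∃ sI, AmbiguousAuction.firstPrice.IsEquilibrium 𝒬B sI ∧
      AmbiguousAuction.firstPrice.BidsValueIfHopeless 𝒬B sI) ∧
    (∃ sII, AmbiguousAuction.secondPrice.IsEquilibrium 𝒬B sII) ∧
    (∃ sA, AmbiguousAuction.allPay.IsEquilibrium 𝒬B sA) ∧
    -- first-price versus second-price
    (∀ sI sII, AmbiguousAuction.firstPrice.IsEquilibrium 𝒬B sI →
      AmbiguousAuction.firstPrice.BidsValueIfHopeless 𝒬B sI →
      AmbiguousAuction.secondPrice.IsEquilibrium 𝒬B sII →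
      AmbiguousAuction.worstCaseRevenue 𝒬 (AmbiguousAuction.firstPrice.transfer sI) ≥
        AmbiguousAuction.worstCaseRevenue 𝒬 (AmbiguousAuction.secondPrice.transfer sII)) ∧
    -- first-price versus all-pay
    (∀ sI sA, AmbiguousAuction.firstPrice.IsEquilibrium 𝒬B sI →
      AmbiguousAuction.allPay.IsEquilibrium 𝒬B sA →
      AmbiguousAuction.worstCaseRevenue 𝒬 (AmbiguousAuction.firstPrice.transfer sI) ≥
        AmbiguousAuction.worstCaseRevenue 𝒬 (AmbiguousAuction.allPay.transfer sA)) ∧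
    -- all-pay versus war of attrition, for every equilibrium that the latter may have
    (∀ sA sW, AmbiguousAuction.allPay.IsEquilibrium 𝒬B sA →
      AmbiguousAuction.warOfAttrition.IsEquilibrium 𝒬B sW →
      AmbiguousAuction.worstCaseRevenue 𝒬 (AmbiguousAuction.allPay.transfer sA) ≥
        AmbiguousAuction.worstCaseRevenue 𝒬 (AmbiguousAuction.warOfAttrition.transfer sW)) := by
  obtain ⟨F, rfl⟩ := hP_iid
  rw [AmbiguousAuction.marginal_prod] at h𝒬B
  obtain ⟨hac, hac'⟩ := AmbiguousAuction.ac_of_hasPositiveDensity hP_density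
  have hM : AmbiguousAuction.IsBidderModel F 𝒬B :=
    ⟨hac, hac', h𝒬B_nonempty, h𝒬B_compact, h𝒬B⟩
  exact ⟨AmbiguousAuction.exists_isEquilibrium_firstPrice hM,
    AmbiguousAuction.exists_isEquilibrium_secondPrice h𝒬B_nonempty,
    AmbiguousAuction.exists_isEquilibrium_allPay hM,
    fun _ _ hI hI' hII => AmbiguousAuction.secondPrice_le_firstPrice hM h𝒬 hI hI' hII,
    fun _ _ hI hA => AmbiguousAuction.allPay_le_firstPrice hM h𝒬 hI hA,
    fun _ _ hA hW => AmbiguousAuction.warOfAttrition_le_allPay hM h𝒬 hA hW⟩
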